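/- **Complete Bernstein functions.** Let $\mathcal{CBF}^{\flat}$ be the class of complete Bernstein functions with zero linear drift, that is, of functions $f:[0,\infty)\to[0,\infty)$ of the form $$f(z)=a+\int_0^\infty (1-e^{-zx})\,\pi(x)\,dx,\qquad z\ge 0,$$ where $a\ge 0$, $\int_0^\infty \min(1,x)\,\pi(x)\,dx<\infty$, and $\pi:(0,\infty)\to[0,\infty)$ is completely monotone, i.e. smooth with $(-1)^n\pi^{(n)}\ge 0$ for all $n\ge 0$ ($\pi=0$ is allowed). **Voiculescu transform.** For a probability measure $\mu$ on $\mathbb R$ let $G_\mu(z)=\int_{\mathbb R}\frac{\mu(dx)}{z-x}$ and $F_\mu=1/G_\mu$ on $\mathbb H=\{\operatorname{Im} z>0\}$. For some $\alpha,M>0$ there is an analytic right inverse $F_\mu^{-1}$ of $F_\mu$ on $\Gamma_{\alpha,M}=\{z:|\operatorname{Re}z|<\alpha\operatorname{Im}z,\ \operatorname{Im}z>M\}$ with values in $\mathbb H$ and with $F_\mu^{-1}(z)/z\to1$ as $z\to\infty$ in $\Gamma_{\alpha,M}$. The Voiculescu transform is $\phi_\mu(z)=F_\mu^{-1}(z)-z$.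 For $z>0$, $\phi_\mu(-z)$ denotes the value at $-z$ of the analytic continuation of $\phi_\mu$ from the truncated cone to (a neighbourhood of) $\mathbb H\cup(-\infty,0)$, when this continuation exists, and $\phi_\mu(-0)=\lim_{z\downarrow0}\phi_\mu(-z)$ is its value at $z=0$. **Free convolution and free regular measures.** $\mu_1\boxplus\mu_2$ is the probability measure with $\phi_{\mu_1\boxplus\mu_2}=\phi_{\mu_1}+\phi_{\mu_2}$ on some $\Gamma_{\alpha,M}$, and $\mu^{\boxplus t}$ is the probability measure (if it exists) with $\phi_{\mu^{\boxplus t}}=t\phi_\mu$ on some $\Gamma_{\alpha,M}$. A probability measure $\mu$ is freely infinitely divisible if for every $n\ge1$ it is the $n$-fold free convolution $\mu_n\boxplus\dots\boxplus\mu_n$ of some probability measure $\mu_n$. It is *free regular* if it is freely infinitely divisible and $\mu^{\boxplus t}$ is supported on $[0,\infty)$ for every $t>0$. **Semigroups.** A free regular semigroup is a family $(\mu_t)_{t\ge0}$ of free regular measures with $\mu_s\boxplus\mu_t=\mu_{s+t}$. A $\mathrm{BO}^\flat$ semigroup is a family $(\nu_t)_{t\ge0}$ of sub-probability measures on $[0,\infty)$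 with $\nu_s*\nu_t=\nu_{s+t}$ such that each $\nu_t$ satisfies $\int e^{-zy}\,\nu_t(dy)=e^{-f_t(z)}$, $z>0$, for some $f_t\in\mathcal{CBF}^\flat$. **Proposition 1.** 1. A probability measure $\mu$ on $\mathbb R$ is free regular if and only if $z\in[0,\infty)\mapsto\phi_\mu(-z)$ exists and belongs to $\mathcal{CBF}^\flat$. 2. For every $f\in\mathcal{CBF}^\flat$ there is exactly one free regular measure $\mu$ with $\phi_\mu(-z)=f(z)$ for all $z\ge0$. 3. The relation $\phi_{\mu_t}(-z)=t f(z)$ for all $t,z\ge0$ is a bijection between free regular semigroups $(\mu_t)_{t\ge0}$ and functions $f\in\mathcal{CBF}^\flat$. 4. The relation $\int_{[0,\infty)}e^{-zy}\,\nu_t(dy)=e^{-tf(z)}$ for all $t\ge0$, $z>0$ is a bijection between $\mathrm{BO}^\flat$ semigroups $(\nu_t)_{t\ge0}$ and functions $f\in\mathcal{CBF}^\flat$. -/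

import Mathlib

open MeasureTheory Filter Topology Set
open scoped NNReal ENNReal

namespace FreeRegular

noncomputable section

/-! ### Bernstein functions, as functions `[0,∞) → [0,∞)` -/

/-- `f` is a Bernstein function with killing rate `a`, linear drift `b` and Lévy measure `m`:
`f z = a + b z + ∫_{(0,∞)} (1 - e^{-zx}) m(dx)`, where `m` is concentrated on `(0,∞)` and
`∫ min(1,x) m(dx) < ∞`. -/
structure IsBernsteinTriplet (f : ℝ≥0 → ℝ≥0) (a b : ℝ≥0) (m : Measure ℝ) : Prop where
  concentrated : m (Iic 0) = 0
  levy : ∫⁻ x, ENNReal.ofReal (min 1 x) ∂m < ∞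
  repr : ∀ z : ℝ≥0, (f z : ℝ) = a + b * z + ∫ x, (1 - Real.exp (-(z * x))) ∂m

/-- `g` is completely monotone on `(0,∞)`: it is smooth there and `(-1)^n g^{(n)} ≥ 0`. The zero
function is completely monotone. -/
def IsCompletelyMonotone (g : ℝ → ℝ) : Prop :=
  ContDiffOn ℝ (⊤ : ℕ∞) g (Ioi 0) ∧ ∀ n : ℕ, ∀ x : ℝ, 0 < x → 0 ≤ (-1) ^ n * iteratedDeriv n g x

/-- `f` is a complete Bernstein function with linear drift coefficient `b`: its Lévy measure has a
completely monotone density with respect to Lebesgue measure on `(0,∞)`. -/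
def IsCompleteBernsteinWithDrift (f : ℝ≥0 → ℝ≥0) (b : ℝ≥0) : Prop :=
  ∃ (a : ℝ≥0) (g : ℝ → ℝ), IsCompletelyMonotone g ∧
    IsBernsteinTriplet f a b
      ((volume.restrict (Ioi (0 : ℝ))).withDensity fun x => ENNReal.ofReal (g x))

/-- The class of complete Bernstein functions. -/
def CBF : Set (ℝ≥0 → ℝ≥0) := {f | ∃ b, IsCompleteBernsteinWithDrift f b}

/-- The class of complete Bernstein functions with zero linear drift. -/
def CBFflat : Set (ℝ≥0 → ℝ≥0) := {f | IsCompleteBernsteinWithDrift f 0}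

/-! ### Classical convolution semigroups in the Bondesson class -/

/-- `f` is the Laplace exponent of the measure `ν` on `[0,∞)`. -/
def HasLaplaceExponent (ν : Measure ℝ≥0) (f : ℝ≥0 → ℝ≥0) : Prop :=
  ∀ z : ℝ≥0, 0 < z → ∫ y : ℝ≥0, Real.exp (-((z : ℝ) * y)) ∂ν = Real.exp (-(f z : ℝ))

/-- A sub-probability measure on `[0,∞)` in the Bondesson class whose Laplace exponent has zero
linear drift. -/
def IsBondessonFlat (ν : Measure ℝ≥0) : Prop :=
  ν univ ≤ 1 ∧ ∃ f ∈ CBFflat, HasLaplaceExponent ν f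

/-- A convolution semigroup `(ν_t)_{t ≥ 0}` of driftless Bondesson class measures. -/
def IsBondessonFlatSemigroup (ν : ℝ≥0 → Measure ℝ≥0) : Prop :=
  (∀ t, IsBondessonFlat (ν t)) ∧ ∀ s t, ν (s + t) = (ν s).conv (ν t)

/-! ### The Voiculescu transform and free additive convolution -/

/-- The Cauchy transform `G_μ(z) = ∫ μ(dx) / (z - x)`. -/
def cauchyTransform (μ : ProbabilityMeasure ℝ) (z : ℂ) : ℂ :=
  ∫ x : ℝ, 1 / (z - (x : ℂ)) ∂(μ : Measure ℝ)

/-- The reciprocal Cauchy transform `F_μ = 1 / G_μ`. -/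
def reciprocalCauchy (μ : ProbabilityMeasure ℝ) (z : ℂ) : ℂ := 1 / cauchyTransform μ z

/-- The truncated cone `Γ_{α,M}`. -/
def truncatedCone (α M : ℝ) : Set ℂ := {z | |z.re| < α * z.im ∧ M < z.im}

/-- `φ` represents the Voiculescu transform of `μ`: on some truncated cone `Γ_{α,M}` the function
`z ↦ z + φ z` is analytic, takes values in the upper half-plane, is a right inverse of `F_μ`, and is
asymptotic to `z` at infinity. The last clause selects the inverse branch (`F_μ` need not be
injective on the upper half-plane) and so determines `φ` on the cone. Nothing is said about the
values of `φ` outside the cone. -/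
def IsVoiculescuTransform (μ : ProbabilityMeasure ℝ) (φ : ℂ → ℂ) : Prop :=
  ∃ α M : ℝ, 0 < α ∧ 0 < M ∧
    AnalyticOnNhd ℂ φ (truncatedCone α M) ∧
    (∀ z ∈ truncatedCone α M, 0 < (z + φ z).im ∧ reciprocalCauchy μ (z + φ z) = z) ∧
    Tendsto (fun z => (z + φ z) / z) (Bornology.cobounded ℂ ⊓ 𝓟 (truncatedCone α M)) (𝓝 1)

/-- `χ = μ₁ ⊞ μ₂`: `φ_χ = φ_{μ₁} + φ_{μ₂}` on some truncated cone. -/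
def IsFreeConv (μ₁ μ₂ χ : ProbabilityMeasure ℝ) : Prop :=
  ∃ φ₁ φ₂ : ℂ → ℂ, IsVoiculescuTransform μ₁ φ₁ ∧ IsVoiculescuTransform μ₂ φ₂ ∧
    IsVoiculescuTransform χ fun z => φ₁ z + φ₂ z

/-- `IsFreeConvIter ν n χ`: the measure `χ` is the `n`-fold free convolution of `ν` with itself. -/
def IsFreeConvIter (ν : ProbabilityMeasure ℝ) : ℕ → ProbabilityMeasure ℝ → Prop
  | 0, χ => χ = ⟨Measure.dirac 0, inferInstance⟩
  | 1, χ => χ = ν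
  | n + 2, χ => ∃ ρ, IsFreeConvIter ν (n + 1) ρ ∧ IsFreeConv ρ ν χ

/-- Free infinite divisibility. -/
def IsFreelyInfDiv (μ : ProbabilityMeasure ℝ) : Prop :=
  ∀ n : ℕ, 1 ≤ n → ∃ ν : ProbabilityMeasure ℝ, IsFreeConvIter ν n μ

/-- `χ = μ^{⊞ t}`, the measure with `φ_χ = t φ_μ` on some truncated cone. -/
def IsFreeConvPower (μ : ProbabilityMeasure ℝ) (t : ℝ) (χ : ProbabilityMeasure ℝ) : Prop :=
  ∃ φ : ℂ → ℂ, IsVoiculescuTransform μ φ ∧ IsVoiculescuTransform χ fun z => (t : ℂ) * φ z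

/-- Free regular measures: freely infinitely divisible, and `μ^{⊞ t}` is supported on `[0,∞)` for
all `t > 0`. -/
def IsFreeRegular (μ : ProbabilityMeasure ℝ) : Prop :=
  IsFreelyInfDiv μ ∧
    ∀ t : ℝ, 0 < t → ∃ χ, IsFreeConvPower μ t χ ∧ (χ : Measure ℝ) (Iio 0) = 0

/-- A free convolution semigroup `(μ_t)_{t ≥ 0}` of free regular measures. -/
def IsFreeRegularSemigroup (μ : ℝ≥0 → ProbabilityMeasure ℝ) : Prop :=
  (∀ t, IsFreeRegular (μ t)) ∧ ∀ s t, IsFreeConv (μ s) (μ t) (μ (s + t))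

/-- `f` is the function `z ∈ [0,∞) ↦ φ_μ(-z)`: the Voiculescu transform continues analytically from
a truncated cone to the upper half-plane and across the negative half-axis, the continuation at `-z`
is `f z` for `z > 0`, and `f 0` is the limit of `φ_μ(-z)` as `z ↓ 0`. (The set of continuation is
connected, so the continuation is unique.) -/
def IsVoiculescuOnNegAxis (μ : ProbabilityMeasure ℝ) (f : ℝ≥0 → ℝ≥0) : Prop :=
  (∃ φ : ℂ → ℂ, IsVoiculescuTransform μ φ ∧
    AnalyticOnNhd ℂ φ {z | 0 < z.im ∨ (z.im = 0 ∧ z.re < 0)} ∧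
    ∀ z : ℝ≥0, 0 < z → φ (-((z : ℝ) : ℂ)) = ((f z : ℝ) : ℂ)) ∧
  Tendsto f (𝓝[>] 0) (𝓝 (f 0))

end

end FreeRegular

open FreeRegular

/-! The pivot is one integral representation. On the slit plane a complete Bernstein function has
the form `cbfTransform ρ w`, the integral of `w / (1 - y + y w)` against a finite measure `ρ` on
`[0,1]`. The point `y = 1` carries the constant term, `y = 0` the linear drift, and each `0 < y < 1`
an exponential of rate `s = (1 - y) / y` in the Lévy density, so zero drift means `ρ {0} = 0`.
Compactness of `[0,1]` closes the class under limits with bounded masses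
(`exists_cbfTransform_eq_of_tendsto`). A Herglotz argument identifies the class with the analytic
functions satisfying the pointwise cone condition `IsConeFun` (`isConeFun_cbfTransform`,
`IsConeFun.exists_eqOn_cbfTransform`), which is easy to check. The link with `CBFflat` is
`exists_mem_CBFflat` in one direction and `exists_cbfTransform_eq`, which rests on Bernstein's
theorem for Lévy densities, in the other.

Let `μ` be free regular with Voiculescu transform `φ`, and let `χ = μ^{⊞ t}`. Since `χ` lives on the
positive half-axis, `-F_χ(-w) - w` is a cone function, and its value at `w = -(z + t φ z)` is `t φ
z`. Dividing by `t` and letting `t → 0` gives `φ z = cbfTransform ρ (-z)`; the growth `φ z = o(z)`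
removes the atom at `0` (`exists_cbfTransform_isVoiculescuTransform`).

Conversely, let `f = cbfTransform ρ` with `ρ {0} = 0`. Inverting `z + f (-z)` amounts to solving `Ψ
w = w + f (Ψ w)`. The fixed point iterates have the form `a + b w` with `a ≥ 0`, `b ≥ 1`, so the
quotients `w / Ψ_k w` are cone functions of mass at most `1`. Their limit is again a transform, and
it is `z G(z)` at `z = -w` for a probability measure on the positive half-axis
(`exists_isVoiculescuTransform_cbfTransform`). Applying this to all multiples `t ρ` supplies the
convolution roots and powers.

Uniqueness holds because the Voiculescu transform determines the Cauchy transform, hence the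
measure, and because continuation takes place on a convex domain. For semigroups, `t ↦ f_t z` is
additive and nonnegative, hence linear. On the classical side, measures with a given Laplace
exponent come from compound Poisson approximation, and they are unique by Stone–Weierstrass. -/

namespace FreeRegular

/-! ### Integral transforms over the unit interval and their compactness. -/

open Complex (slitPlane)
open unitInterval

/-- Kernel of the integral representation of complete Bernstein functions. The parameter `y`
corresponds to `1 / (1 + s)` in the classical kernel `w (1 + s) / (w + s)`. -/
noncomputable def cbfKernel (w : ℂ) (y : I) : ℂ := w / (1 - (y : ℝ) + (y : ℝ) * w)

/-- The function represented by the measure `ρ`. -/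
noncomputable def cbfTransform (ρ : Measure I) (w : ℂ) : ℂ := ∫ y, cbfKernel w y ∂ρ

/-- Analytic functions on the slit plane with `f w` in the convex cone generated by `1` and `w`. -/
structure IsConeFun (f : ℂ → ℂ) : Prop where
  differentiableOn : DifferentiableOn ℂ f slitPlane
  cone : ∀ w ∈ slitPlane, ∃ a b : ℝ, 0 ≤ a ∧ 0 ≤ b ∧ f w = a + b * w

lemma add_mul_mem_slitPlane {a b : ℝ} {w : ℂ} (ha : 0 ≤ a) (hb : 0 ≤ b) (hab : 0 < a + b)
    (hw : w ∈ slitPlane) : (a : ℂ) + b * w ∈ slitPlane := by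
  rw [Complex.mem_slitPlane_iff] at hw ⊢
  simp only [Complex.add_re, Complex.ofReal_re, Complex.mul_re, Complex.ofReal_im, zero_mul,
    sub_zero, Complex.add_im, Complex.mul_im, add_zero, zero_add]
  rcases hb.eq_or_lt with rfl | hb
  · left; simpa using hab
  · rcases hw with hw | hw
    · left; positivity
    · right; positivity

lemma cbfDenom_mem_slitPlane {w : ℂ} (hw : w ∈ slitPlane) (y : I) :
    (1 : ℂ) - (y : ℝ) + (y : ℝ) * w ∈ slitPlane := by
  have := add_mul_mem_slitPlane (sub_nonneg.2 y.2.2) y.2.1 (by simp) hw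
  simpa using this

lemma cbfDenom_ne_zero {w : ℂ} (hw : w ∈ slitPlane) (y : I) :
    (1 : ℂ) - (y : ℝ) + (y : ℝ) * w ≠ 0 :=
  Complex.slitPlane_ne_zero (cbfDenom_mem_slitPlane hw y)

lemma continuous_cbfKernel_uncurry :
    Continuous fun p : slitPlane × I ↦ cbfKernel p.1 p.2 := by
  unfold cbfKernel
  refine Continuous.div (by fun_prop) (by fun_prop) fun p ↦ cbfDenom_ne_zero p.1.2 p.2

/-- The kernel as a continuous map into `C(I, ℂ)`. -/
noncomputable def cbfKernelMap : C(slitPlane, C(I, ℂ)) :=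
  ContinuousMap.curry ⟨fun p : slitPlane × I ↦ cbfKernel p.1 p.2, continuous_cbfKernel_uncurry⟩

lemma continuous_cbfKernel {w : ℂ} (hw : w ∈ slitPlane) : Continuous (cbfKernel w) :=
  (cbfKernelMap ⟨w, hw⟩).continuous

lemma integrable_of_continuous {E : Type*} [NormedAddCommGroup E] {ρ : Measure I}
    [IsFiniteMeasure ρ] {f : I → E} (hf : Continuous f) : Integrable f ρ :=
  hf.integrable_of_hasCompactSupport (HasCompactSupport.of_compactSpace f)

lemma integrable_cbfKernel {ρ : Measure I} [IsFiniteMeasure ρ] {w : ℂ} (hw : w ∈ slitPlane) :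
    Integrable (cbfKernel w) ρ := integrable_of_continuous (continuous_cbfKernel hw)

lemma cbfKernel_ofReal {x : ℝ} (y : I) : cbfKernel x y = ((x / (1 - y + y * x) : ℝ) : ℂ) := by
  simp [cbfKernel]

lemma cbfTransform_ofReal (ρ : Measure I) (x : ℝ) :
    cbfTransform ρ x = ((∫ y : I, x / (1 - (y : ℝ) + y * x) ∂ρ : ℝ) : ℂ) := by
  simp_rw [cbfTransform, cbfKernel_ofReal]
  exact integral_ofReal

lemma cbfDenom_pos {x : ℝ} (hx : 0 < x) (y : I) : 0 < 1 - (y : ℝ) + y * x := by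
  rcases y.2.2.eq_or_lt with h | h
  · rw [h]; simpa
  · have := mul_nonneg y.2.1 hx.le
    linarith

lemma ofReal_mem_slitPlane' {x : ℝ} (hx : 0 < x) : (x : ℂ) ∈ slitPlane := by simpa

@[simp] lemma cbfTransform_one (ρ : Measure I) [IsFiniteMeasure ρ] :
    cbfTransform ρ 1 = ρ.real univ := by
  simp [cbfTransform, cbfKernel]

lemma differentiableOn_cbfTransform (ρ : Measure I) [IsFiniteMeasure ρ] :
    DifferentiableOn ℂ (cbfTransform ρ) slitPlane := by
  intro w₀ hw₀
  obtain ⟨ε, hε, hball⟩ := Metric.nhds_basis_closedBall.mem_iff.1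
    (Complex.isOpen_slitPlane.mem_nhds hw₀)
  set F' : ℂ → I → ℂ := fun w y ↦ (1 - (y : ℝ)) / (1 - (y : ℝ) + (y : ℝ) * w) ^ 2 with hF'
  have hcont : ContinuousOn (fun p : ℂ × I ↦ F' p.1 p.2)
      (Metric.closedBall w₀ ε ×ˢ univ) := by
    refine ContinuousOn.div (by fun_prop) (by fun_prop) fun p hp ↦ ?_
    exact pow_ne_zero _ (cbfDenom_ne_zero (hball hp.1) p.2)
  obtain ⟨C, hC⟩ := ((isCompact_closedBall w₀ ε).prod isCompact_univ).exists_bound_of_continuousOn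
    hcont
  have key := hasDerivAt_integral_of_dominated_loc_of_deriv_le (μ := ρ) (F := cbfKernel)
    (F' := F') (bound := fun _ ↦ C) (Metric.ball_mem_nhds w₀ hε)
    ?_ (integrable_cbfKernel hw₀) ?_ ?_ (integrable_const _) ?_
  · exact key.2.differentiableAt.differentiableWithinAt
  · filter_upwards [Complex.isOpen_slitPlane.mem_nhds hw₀] with w hw
    exact (continuous_cbfKernel hw).aestronglyMeasurable
  · refine Continuous.aestronglyMeasurable (Continuous.div (by fun_prop) (by fun_prop) fun y ↦ ?_)
    exact pow_ne_zero _ (cbfDenom_ne_zero hw₀ y)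
  · exact .of_forall fun y w hw ↦ hC (w, y) ⟨Metric.ball_subset_closedBall hw, mem_univ _⟩
  · refine .of_forall fun y w hw ↦ ?_
    have hne := cbfDenom_ne_zero (hball (Metric.ball_subset_closedBall hw)) y
    have h1 : HasDerivAt (fun w : ℂ ↦ (1 : ℂ) - (y : ℝ) + (y : ℝ) * w) ((y : ℝ) : ℂ) w := by
      simpa using ((hasDerivAt_id w).const_mul ((y : ℝ) : ℂ)).const_add ((1 : ℂ) - (y : ℝ))
    refine ((hasDerivAt_id w).div h1 hne).congr_deriv ?_
    simp only [hF', id]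
    congr 1
    ring

/-- Multiply numerator and denominator by the conjugate of the denominator: `w * conj (1 - y + y w)
= (1 - y) w + y |w|²`. -/
lemma cbfKernel_eq_cone {w : ℂ} (hw : w ∈ slitPlane) (y : I) :
    cbfKernel w y =
      (((y : ℝ) * Complex.normSq w / Complex.normSq (1 - (y : ℝ) + (y : ℝ) * w) : ℝ) : ℂ) +
      (((1 - (y : ℝ)) / Complex.normSq (1 - (y : ℝ) + (y : ℝ) * w) : ℝ) : ℂ) * w := by
  set D : ℂ := 1 - (y : ℝ) + (y : ℝ) * w with hD
  have hne : D ≠ 0 := cbfDenom_ne_zero hw y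
  have hconj : (starRingEnd ℂ) D = 1 - (y : ℝ) + (y : ℝ) * (starRingEnd ℂ) w := by
    simp [hD, Complex.conj_ofReal]
  have hN : ((Complex.normSq D : ℝ) : ℂ) = (starRingEnd ℂ) D * D :=
    Complex.normSq_eq_conj_mul_self
  have hne' : (starRingEnd ℂ) D ≠ 0 := by simpa using hne
  have h : cbfKernel w y = (starRingEnd ℂ) D * w / Complex.normSq D := by
    rw [hN, mul_div_mul_left _ _ hne', cbfKernel]
  rw [h, hconj]
  push_cast
  rw [Complex.normSq_eq_conj_mul_self (z := w)]
  ring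

lemma isConeFun_cbfTransform (ρ : Measure I) [IsFiniteMeasure ρ] :
    IsConeFun (cbfTransform ρ) := by
  refine ⟨differentiableOn_cbfTransform ρ, fun w hw ↦ ?_⟩
  have hpos (y : I) : 0 < Complex.normSq (1 - (y : ℝ) + (y : ℝ) * w) :=
    Complex.normSq_pos.2 (cbfDenom_ne_zero hw y)
  have hc : Continuous fun y : I ↦ Complex.normSq (1 - (y : ℝ) + (y : ℝ) * w) :=
    Complex.continuous_normSq.comp (by fun_prop)
  refine ⟨∫ y : I, (y : ℝ) * Complex.normSq w / Complex.normSq (1 - (y : ℝ) + (y : ℝ) * w) ∂ρ,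
    ∫ y : I, (1 - (y : ℝ)) / Complex.normSq (1 - (y : ℝ) + (y : ℝ) * w) ∂ρ,
    integral_nonneg fun y ↦ ?_, integral_nonneg fun y ↦ ?_, ?_⟩
  · exact div_nonneg (mul_nonneg y.2.1 (Complex.normSq_nonneg _)) (hpos y).le
  · exact div_nonneg (sub_nonneg.2 y.2.2) (hpos y).le
  · simp_rw [cbfTransform, cbfKernel_eq_cone hw]
    have i1 : Integrable (fun y : I ↦
        (y : ℝ) * Complex.normSq w / Complex.normSq (1 - (y : ℝ) + (y : ℝ) * w)) ρ :=
      integrable_of_continuous (Continuous.div (by fun_prop) hc fun y ↦ (hpos y).ne')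
    have i2 : Integrable (fun y : I ↦
        (1 - (y : ℝ)) / Complex.normSq (1 - (y : ℝ) + (y : ℝ) * w)) ρ :=
      integrable_of_continuous (Continuous.div (by fun_prop) hc fun y ↦ (hpos y).ne')
    rw [← integral_complex_ofReal, ← integral_complex_ofReal, ← integral_mul_const]
    exact integral_add i1.ofReal (i2.ofReal.mul_const w)

/-- Finite measures on the unit interval with bounded masses converge along an ultrafilter. -/
lemma exists_tendsto_integral {ρ : ℕ → Measure I} [∀ n, IsFiniteMeasure (ρ n)] {C : ℝ}
    (hC : ∀ n, (ρ n).real univ ≤ C) :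
    ∃ ρ' : Measure I, IsFiniteMeasure ρ' ∧ ∀ f : C(I, ℂ),
      Tendsto (fun n ↦ ∫ y, f y ∂(ρ n)) (hyperfilter ℕ) (𝓝 (∫ y, f y ∂ρ')) := by
  have hcomp := isCompact_setOfPred_finiteMeasure_le_of_compactSpace I (Real.toNNReal C)
  let r : ℕ → FiniteMeasure I := fun n ↦ ⟨ρ n, inferInstance⟩
  have hr (n : ℕ) : r n ∈ {μ : FiniteMeasure I | μ.mass ≤ Real.toNNReal C} := by
    change (r n).mass ≤ _
    rw [← NNReal.coe_le_coe]
    exact (hC n).trans (Real.le_coe_toNNReal C)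
  obtain ⟨ρ', -, h⟩ := hcomp.ultrafilter_le_nhds ((hyperfilter ℕ).map r)
    (by rw [Ultrafilter.coe_map, le_principal_iff]; exact Filter.mem_map.2 (Filter.univ_mem' hr))
  refine ⟨ρ', inferInstance, fun f ↦ ?_⟩
  have h' : Tendsto r (hyperfilter ℕ) (𝓝 ρ') := h
  rw [FiniteMeasure.tendsto_iff_forall_integral_rclike_tendsto ℂ] at h'
  exact h' (BoundedContinuousFunction.mkOfCompact f)

/-- The evaluation points may move with `n`: the kernels at `v n` converge uniformly on the interval
to the kernel at `w`, and bounded masses turn this into an error tending to `0`. The argument with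
convolution powers needs moving points. -/
lemma exists_tendsto_cbfTransform {ρ : ℕ → Measure I} [∀ n, IsFiniteMeasure (ρ n)] {C : ℝ}
    (hC : ∀ n, (ρ n).real univ ≤ C) :
    ∃ ρ' : Measure I, IsFiniteMeasure ρ' ∧ ∀ (v : ℕ → ℂ) (w : ℂ), (∀ n, v n ∈ slitPlane) →
      w ∈ slitPlane → Tendsto v atTop (𝓝 w) →
      Tendsto (fun n ↦ cbfTransform (ρ n) (v n)) (hyperfilter ℕ) (𝓝 (cbfTransform ρ' w)) := by
  obtain ⟨ρ', hρ', h⟩ := exists_tendsto_integral hC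
  refine ⟨ρ', hρ', fun v w hv hw hvw ↦ ?_⟩
  have h1 := h (cbfKernelMap ⟨w, hw⟩)
  have h2 : Tendsto (fun n ↦ cbfKernelMap ⟨v n, hv n⟩) atTop (𝓝 (cbfKernelMap ⟨w, hw⟩)) :=
    (cbfKernelMap.continuous.tendsto _).comp (tendsto_subtype_rng.2 hvw)
  have h3 : Tendsto (fun n ↦ cbfTransform (ρ n) (v n) - ∫ y, cbfKernelMap ⟨w, hw⟩ y ∂(ρ n))
      atTop (𝓝 0) := by
    rw [tendsto_iff_dist_tendsto_zero] at h2
    refine squeeze_zero_norm (a := fun n ↦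
      dist (cbfKernelMap ⟨v n, hv n⟩) (cbfKernelMap ⟨w, hw⟩) * C) (fun n ↦ ?_)
      (by simpa using h2.mul_const C)
    rw [cbfTransform, ← integral_sub (integrable_cbfKernel (hv n))
      (integrable_of_continuous (ContinuousMap.continuous _))]
    refine (norm_integral_le_of_norm_le_const (C := dist (cbfKernelMap ⟨v n, hv n⟩)
      (cbfKernelMap ⟨w, hw⟩)) (.of_forall fun y ↦ ?_)).trans
      (mul_le_mul_of_nonneg_left (hC n) dist_nonneg)
    rw [← dist_eq_norm]
    exact ContinuousMap.dist_apply_le_dist (f := cbfKernelMap ⟨v n, hv n⟩) y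
  have h4 := (h3.mono_left Nat.hyperfilter_le_atTop).add h1
  simp only [sub_add_cancel, zero_add] at h4
  exact h4

/-- Limits of functions represented with bounded masses are represented. -/
lemma exists_cbfTransform_eq_of_tendsto {ρ : ℕ → Measure I} [∀ n, IsFiniteMeasure (ρ n)] {C : ℝ}
    (hC : ∀ n, (ρ n).real univ ≤ C) :
    ∃ ρ' : Measure I, IsFiniteMeasure ρ' ∧ ∀ (v : ℕ → ℂ) (w L : ℂ), (∀ n, v n ∈ slitPlane) →
      w ∈ slitPlane → Tendsto v atTop (𝓝 w) →
      Tendsto (fun n ↦ cbfTransform (ρ n) (v n)) atTop (𝓝 L) → cbfTransform ρ' w = L := by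
  obtain ⟨ρ', hρ', h⟩ := exists_tendsto_cbfTransform hC
  exact ⟨ρ', hρ', fun v w L hv hw hvw hL ↦
    tendsto_nhds_unique (h v w hv hw hvw) (hL.mono_left Nat.hyperfilter_le_atTop)⟩

end FreeRegular

/-! ### Herglotz representation of cone functions. -/

namespace FreeRegular

open Complex (slitPlane)
open unitInterval

lemma eqOn_slitPlane_of_eqOn_pos {f g : ℂ → ℂ} (hf : DifferentiableOn ℂ f slitPlane)
    (hg : DifferentiableOn ℂ g slitPlane) (h : ∀ x : ℝ, 0 < x → f x = g x) :
    EqOn f g slitPlane := by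
  have hc : IsPreconnected slitPlane :=
    (Complex.starConvex_one_slitPlane.isPathConnected Complex.one_mem_slitPlane).isConnected
      |>.isPreconnected
  refine (hf.analyticOnNhd Complex.isOpen_slitPlane).eqOn_of_preconnected_of_frequently_eq
    (hg.analyticOnNhd Complex.isOpen_slitPlane) hc (z₀ := 1) (by simp) ?_
  have h1 : Tendsto (fun n : ℕ ↦ ((1 + 1 / ((n : ℝ) + 1) : ℝ) : ℂ)) atTop (𝓝[≠] 1) := by
    refine tendsto_nhdsWithin_iff.2 ⟨?_, .of_forall fun n ↦ ?_⟩
    · have := (tendsto_one_div_add_atTop_nhds_zero_nat (𝕜 := ℝ)).const_add 1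
      rw [add_zero] at this
      exact_mod_cast (Complex.continuous_ofReal.tendsto 1).comp this
    · simp only [mem_compl_iff, mem_singleton_iff]
      rw [Complex.ofReal_eq_one]
      have : (0 : ℝ) < 1 / ((n : ℝ) + 1) := by positivity
      linarith
  exact h1.frequently (.of_forall fun n ↦ h _ (by positivity))

lemma sq_mem_slitPlane {q : ℂ} (hq : 0 < q.re) : q ^ 2 ∈ slitPlane := by
  rw [Complex.mem_slitPlane_iff]
  by_cases h : q.im = 0
  · left
    simp [sq, h]
    positivity
  · right
    intro h'
    have : q.re * q.im = 0 := by
      simp only [sq, Complex.mul_im] at h'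
      linarith
    simp_all

/-- The Cayley transform of the unit disc onto the right half-plane. -/
noncomputable def discToHalfPlane (u : ℂ) : ℂ := (1 + u) / (1 - u)

lemma one_sub_ne_zero_of_norm_lt {u : ℂ} (hu : ‖u‖ < 1) : 1 - u ≠ 0 := by
  intro h
  rw [← sub_eq_zero.1 h] at hu
  simp at hu

lemma discToHalfPlane_re_pos {u : ℂ} (hu : ‖u‖ < 1) : 0 < (discToHalfPlane u).re := by
  have h1 : 0 < Complex.normSq (1 - u) := Complex.normSq_pos.2 (one_sub_ne_zero_of_norm_lt hu)
  have h2 : Complex.normSq u < 1 := by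
    rw [Complex.normSq_eq_norm_sq]
    nlinarith [norm_nonneg u]
  rw [discToHalfPlane, Complex.div_re, ← add_div]
  refine div_pos ?_ h1
  rw [Complex.normSq_apply] at h2
  simp
  nlinarith

lemma differentiableOn_discToHalfPlane :
    DifferentiableOn ℂ discToHalfPlane (Metric.ball 0 1) := by
  intro u hu
  have := one_sub_ne_zero_of_norm_lt (by simpa using hu)
  unfold discToHalfPlane
  exact (DifferentiableAt.div (by fun_prop) (by fun_prop) this).differentiableWithinAt

/-- The function with nonnegative real part on the unit disc attached to a function on the slit
plane. -/
noncomputable def discFun (f : ℂ → ℂ) (u : ℂ) : ℂ :=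
  f (discToHalfPlane u ^ 2) / discToHalfPlane u

lemma IsConeFun.differentiableOn_discFun {f : ℂ → ℂ} (hf : IsConeFun f) :
    DifferentiableOn ℂ (discFun f) (Metric.ball 0 1) := by
  refine DifferentiableOn.div (hf.differentiableOn.comp
    (differentiableOn_discToHalfPlane.pow 2) fun u hu ↦ ?_) differentiableOn_discToHalfPlane
    fun u hu h ↦ ?_
  · exact sq_mem_slitPlane (discToHalfPlane_re_pos (by simpa using hu))
  · have := discToHalfPlane_re_pos (u := u) (by simpa using hu)
    simp [h] at this

/-- If `f (q²) = a + b q²`, then `f (q²) / q = a / q + b q`, and both `1 / q` and `q` lie in the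
right half-plane. This is how the cone condition becomes positivity. -/
lemma IsConeFun.discFun_re_nonneg {f : ℂ → ℂ} (hf : IsConeFun f) {u : ℂ} (hu : ‖u‖ < 1) :
    0 ≤ (discFun f u).re := by
  have hq := discToHalfPlane_re_pos hu
  have hq0 : discToHalfPlane u ≠ 0 := fun h ↦ by simp [h] at hq
  obtain ⟨a, b, ha, hb, h⟩ := hf.cone _ (sq_mem_slitPlane hq)
  have : discFun f u = a * (discToHalfPlane u)⁻¹ + b * discToHalfPlane u := by
    rw [discFun, h]
    field_simp
  rw [this, Complex.add_re, Complex.re_ofReal_mul, Complex.re_ofReal_mul, Complex.inv_re]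
  have := Complex.normSq_nonneg (discToHalfPlane u)
  exact add_nonneg (mul_nonneg ha (div_nonneg hq.le this)) (mul_nonneg hb hq.le)

/-- The point of the unit interval which is the image of the angle `θ`. -/
noncomputable def angleToUnit (θ : ℝ) : I :=
  ⟨(1 - Real.cos θ) / 2, by constructor <;> linarith [Real.cos_le_one θ, Real.neg_one_le_cos θ]⟩

lemma continuous_angleToUnit : Continuous angleToUnit := by
  unfold angleToUnit
  fun_prop

/-- At a real point the Poisson kernel depends on the angle only through its cosine: `|e^{iθ} - u|²
= 1 - 2 u cos θ + u²`, which is `(1 - u)² + 4 u y` when `cos θ = 1 - 2 y`. -/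
lemma poisson_kernel_eq {R u θ : ℝ} (hR : 0 < R) :
    (‖circleMap 0 R θ - 0‖ ^ 2 - ‖((R * u : ℝ) : ℂ) - 0‖ ^ 2) /
      ‖(circleMap 0 R θ - 0) - (((R * u : ℝ) : ℂ) - 0)‖ ^ 2 =
    (1 - u ^ 2) / ((1 - u) ^ 2 + 4 * u * angleToUnit θ) := by
  have h1 : ‖circleMap 0 R θ - 0‖ ^ 2 = R ^ 2 := by simp [abs_of_pos hR]
  have h2 : ‖((R * u : ℝ) : ℂ) - 0‖ ^ 2 = R ^ 2 * u ^ 2 := by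
    rw [sub_zero, Complex.norm_real, Real.norm_eq_abs, sq_abs]; ring
  have h3 : ‖(circleMap 0 R θ - 0) - (((R * u : ℝ) : ℂ) - 0)‖ ^ 2 =
      R ^ 2 * ((1 - u) ^ 2 + 4 * u * angleToUnit θ) := by
    rw [← Complex.normSq_eq_norm_sq, Complex.normSq_apply]
    simp [circleMap, Complex.exp_ofReal_mul_I_re, Complex.exp_ofReal_mul_I_im, angleToUnit]
    linear_combination R ^ 2 * Real.sin_sq_add_cos_sq θ
  rw [h1, h2, h3, show R ^ 2 - R ^ 2 * u ^ 2 = R ^ 2 * (1 - u ^ 2) by ring]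
  exact mul_div_mul_left _ _ (by positivity)

/-- Poisson's formula on a circle of radius `R < 1`, where the function is continuous up to the
boundary. The nonnegative boundary density is pushed forward from the circle to the unit interval.
-/
lemma IsConeFun.exists_poisson {f : ℂ → ℂ} (hf : IsConeFun f) {R : ℝ} (hR : 0 < R) (hR1 : R < 1) :
    ∃ ρ : Measure I, IsFiniteMeasure ρ ∧ ∀ u : ℝ, |u| < 1 →
      (discFun f (R * u : ℝ)).re = ∫ y : I, (1 - u ^ 2) / ((1 - u) ^ 2 + 4 * u * y) ∂ρ := by
  have hcirc (θ : ℝ) : ‖circleMap 0 R θ‖ < 1 := by simpa [abs_of_pos hR]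
  have hd : ContinuousOn (discFun f) (Metric.ball 0 1) := hf.differentiableOn_discFun.continuousOn
  have hc : Continuous fun θ ↦ discFun f (circleMap 0 R θ) :=
    hd.comp_continuous (continuous_circleMap 0 R) fun θ ↦ by simpa using hcirc θ
  set d : ℝ → ℝ := fun θ ↦ (2 * Real.pi)⁻¹ * (discFun f (circleMap 0 R θ)).re with hd_def
  have hdc : Continuous d := continuous_const.mul (Complex.continuous_re.comp hc)
  have hd0 (θ : ℝ) : 0 ≤ d θ := mul_nonneg (by positivity) (hf.discFun_re_nonneg (hcirc θ))
  set m : Measure ℝ := (volume.restrict (Ioc 0 (2 * Real.pi))).withDensity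
    fun θ ↦ ENNReal.ofReal (d θ) with hm
  have hint : Integrable d (volume.restrict (Ioc 0 (2 * Real.pi))) :=
    (hdc.integrableOn_Icc).mono_set Ioc_subset_Icc_self
  have : IsFiniteMeasure m := isFiniteMeasure_withDensity_ofReal hint.2
  refine ⟨m.map angleToUnit, inferInstance, fun u hu ↦ ?_⟩
  have hball : ((R * u : ℝ) : ℂ) ∈ Metric.ball 0 R := by
    simp [abs_of_pos hR]
    nlinarith
  have hdiff : DiffContOnCl ℂ (discFun f) (Metric.ball 0 R) :=
    (hf.differentiableOn_discFun.mono (Metric.closedBall_subset_ball hR1)).diffContOnCl_ball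
      subset_rfl
  have key := hdiff.circleAverage_poissonKernel_smul' hball
  have hku : Continuous fun θ ↦ (1 - u ^ 2) / ((1 - u) ^ 2 + 4 * u * angleToUnit θ) := by
    refine Continuous.div (by fun_prop)
      (by have := continuous_angleToUnit; fun_prop) fun θ ↦ ?_
    have h0 := (angleToUnit θ).2.1
    have h1 := (angleToUnit θ).2.2
    rw [abs_lt] at hu
    rcases le_or_gt 0 u with h | h
    · nlinarith [mul_nonneg h h0]
    · nlinarith [mul_nonneg (neg_nonneg.2 h.le) (sub_nonneg.2 h1)]
  rw [Real.circleAverage_def] at key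
  simp_rw [poisson_kernel_eq hR] at key
  rw [← key, intervalIntegral.integral_of_le (by positivity),
    integral_map continuous_angleToUnit.aemeasurable, hm,
    integral_withDensity_eq_integral_toReal_smul (by fun_prop) (by simp), Complex.smul_re]
  · have hI : Integrable (fun θ ↦ ((1 - u ^ 2) / ((1 - u) ^ 2 + 4 * u * angleToUnit θ)) •
        discFun f (circleMap 0 R θ)) (volume.restrict (Ioc 0 (2 * Real.pi))) :=
      ((hku.smul hc).integrableOn_Icc).mono_set Ioc_subset_Icc_self
    have := Complex.reCLM.integral_comp_comm hI
    simp only [Complex.reCLM_apply] at this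
    rw [← this, smul_eq_mul, ← integral_const_mul]
    refine integral_congr_ae (.of_forall fun θ ↦ ?_)
    simp only [ENNReal.toReal_ofReal (hd0 θ)]
    simp only [smul_eq_mul, hd_def, Complex.real_smul, Complex.re_ofReal_mul]
    ring
  · have : Measurable fun y : I ↦ (1 - u ^ 2) / ((1 - u) ^ 2 + 4 * u * (y : ℝ)) := by fun_prop
    exact this.aestronglyMeasurable

lemma discToHalfPlane_ofReal (u : ℝ) :
    discToHalfPlane u = (((1 + u) / (1 - u) : ℝ) : ℂ) := by simp [discToHalfPlane]

/-- Functions in the cone class have an integral representation. -/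
theorem IsConeFun.exists_eqOn_cbfTransform {f : ℂ → ℂ} (hf : IsConeFun f) :
    ∃ ρ : Measure I, IsFiniteMeasure ρ ∧ EqOn f (cbfTransform ρ) slitPlane := by
  set R : ℕ → ℝ := fun n ↦ 1 - 1 / ((n : ℝ) + 2) with hRdef
  have hR0 (n : ℕ) : 0 < R n := by
    have : 1 / ((n : ℝ) + 2) < 1 := by
      rw [div_lt_one (by positivity)]
      have : (0 : ℝ) ≤ n := n.cast_nonneg
      linarith
    simp only [hRdef]; linarith
  have hR1 (n : ℕ) : R n < 1 := by
    have : 0 < 1 / ((n : ℝ) + 2) := by positivity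
    simp only [hRdef]; linarith
  have hRt : Tendsto R atTop (𝓝 1) := by
    have h1 : Tendsto (fun n : ℕ ↦ (n : ℝ) + 2) atTop atTop :=
      tendsto_atTop_add_const_right _ _ tendsto_natCast_atTop_atTop
    simpa [hRdef] using (h1.const_div_atTop 1).const_sub 1
  choose ρ hρ hP using fun n ↦ hf.exists_poisson (hR0 n) (hR1 n)
  -- With `s = (1 + u) / (1 - u)`, the kernel at `s²` is `s` times the Poisson kernel at `u`,
  -- because `(1 - u)² + 4 u y = (1 - u)² (1 - y + y s²)`.
  have hq (u : ℝ) (hu : |u| < 1) (n : ℕ) :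
      cbfTransform (ρ n) (((1 + u) / (1 - u) : ℝ) ^ 2 : ℝ) =
        (((1 + u) / (1 - u) * (discFun f (R n * u : ℝ)).re : ℝ) : ℂ) := by
    rw [cbfTransform_ofReal, hP n u hu, ← integral_const_mul]
    congr 1
    refine integral_congr_ae (.of_forall fun y ↦ ?_)
    simp only
    rw [abs_lt] at hu
    have h1 : 0 < 1 - u := by linarith
    have h2 : 0 < 1 + u := by linarith
    have h3 := cbfDenom_pos (x := ((1 + u) / (1 - u)) ^ 2) (by positivity) y
    have h4 : (1 - u) ^ 2 + 4 * u * y = (1 - u) ^ 2 * (1 - y + y * ((1 + u) / (1 - u)) ^ 2) := by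
      field_simp
      ring
    rw [h4]
    field_simp
    ring
  -- At the centre `u = 0` the Poisson kernel is `1`, so the mass is the same for every radius.
  have hmass (n : ℕ) : (ρ n).real univ ≤ (f 1).re := by
    have := hP n 0 (by simp)
    simp [discFun, discToHalfPlane] at this
    exact this.ge
  obtain ⟨ρ', hρ', hlim⟩ := exists_cbfTransform_eq_of_tendsto hmass
  refine ⟨ρ', hρ', eqOn_slitPlane_of_eqOn_pos hf.differentiableOn
    (differentiableOn_cbfTransform ρ') fun x hx ↦ ?_⟩
  set s := Real.sqrt x with hs
  have hs0 : 0 < s := Real.sqrt_pos.2 hx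
  set u : ℝ := (s - 1) / (s + 1) with hu_def
  have hu : |u| < 1 := by
    rw [hu_def, abs_div, abs_of_pos (by linarith : 0 < s + 1), div_lt_one (by linarith), abs_lt]
    constructor <;> linarith
  have hus : (1 + u) / (1 - u) = s := by
    rw [hu_def]
    field_simp
    ring
  have hsx : s ^ 2 = x := Real.sq_sqrt hx.le
  have hx' : (x : ℂ) ∈ slitPlane := ofReal_mem_slitPlane' hx
  refine (hlim (fun _ ↦ x) x (f x) (fun _ ↦ hx') hx' tendsto_const_nhds ?_).symm
  have hfu : discFun f u = f x / s := by
    rw [discFun, discToHalfPlane_ofReal, hus]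
    norm_cast
    rw [hsx]
  have hcont : Tendsto (fun n ↦ discFun f (R n * u : ℝ)) atTop (𝓝 (discFun f u)) := by
    have h1 : ContinuousAt (discFun f) u :=
      (hf.differentiableOn_discFun.differentiableAt
        (Metric.isOpen_ball.mem_nhds (by simpa using hu))).continuousAt
    refine h1.tendsto.comp ?_
    have := (Complex.continuous_ofReal.tendsto _).comp (hRt.mul_const u)
    rwa [one_mul] at this
  have h5 : Tendsto (fun n ↦ ((s * (discFun f (R n * u : ℝ)).re : ℝ) : ℂ)) atTop
      (𝓝 ((s * (discFun f u).re : ℝ) : ℂ)) :=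
    (Complex.continuous_ofReal.tendsto _).comp
      (((Complex.continuous_re.tendsto _).comp hcont).const_mul s)
  -- The cone coefficients are real, so `f` is real on the positive axis and no information is lost
  -- in the real part.
  have h6 : ((s * (discFun f u).re : ℝ) : ℂ) = f x := by
    obtain ⟨a, b, -, -, h⟩ := hf.cone x hx'
    rw [hfu, h]
    have : ((a : ℂ) + b * x) / s = (((a + b * x) / s : ℝ) : ℂ) := by push_cast; ring
    rw [this, Complex.ofReal_re, mul_div_cancel₀ _ hs0.ne']
    push_cast; ring
  rw [h6] at h5
  refine h5.congr fun n ↦ ?_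
  have := hq u hu n
  rw [hus, hsx] at this
  exact this.symm

end FreeRegular

namespace FreeRegular

open Complex (slitPlane)

/-! ### Analytic properties of the Cauchy transform -/

lemma abs_im_le_norm_sub_ofReal (z : ℂ) (x : ℝ) : |z.im| ≤ ‖z - x‖ := by
  simpa using Complex.abs_im_le_norm (z - x)

lemma sub_ofReal_ne_zero {z : ℂ} (hz : z.im ≠ 0) (x : ℝ) : z - x ≠ 0 := fun h ↦ by
  have := abs_im_le_norm_sub_ofReal z x
  rw [h, norm_zero] at this
  exact hz (abs_nonpos_iff.1 this)

lemma continuous_inv_sub_ofReal {z : ℂ} (hz : z.im ≠ 0) : Continuous fun x : ℝ ↦ (z - x)⁻¹ :=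
  Continuous.inv₀ (by fun_prop) (sub_ofReal_ne_zero hz)

lemma norm_inv_sub_ofReal_le {z : ℂ} {c : ℝ} (hc : 0 < c) (hz : c ≤ |z.im|) (x : ℝ) :
    ‖(z - x)⁻¹‖ ≤ c⁻¹ := by
  rw [norm_inv]
  exact inv_anti₀ hc (hz.trans (abs_im_le_norm_sub_ofReal z x))

lemma integrable_inv_sub_ofReal_pow {μ : Measure ℝ} [IsFiniteMeasure μ] {z : ℂ} (hz : z.im ≠ 0)
    (n : ℕ) : Integrable (fun x : ℝ ↦ (z - x)⁻¹ ^ n) μ := by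
  refine Integrable.of_bound ((continuous_inv_sub_ofReal hz).pow n).aestronglyMeasurable
    (|z.im|⁻¹ ^ n) (.of_forall fun x ↦ ?_)
  rw [norm_pow]
  gcongr
  exact norm_inv_sub_ofReal_le (abs_pos.2 hz) le_rfl x

lemma hasDerivAt_integral_inv_sub_ofReal_pow {μ : Measure ℝ} [IsFiniteMeasure μ] {z₀ : ℂ}
    (hz₀ : z₀.im ≠ 0) (n : ℕ) :
    HasDerivAt (fun z : ℂ ↦ ∫ x : ℝ, (z - x)⁻¹ ^ n ∂μ)
      (-(n : ℂ) * ∫ x : ℝ, (z₀ - x)⁻¹ ^ (n + 1) ∂μ) z₀ := by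
  have hpos : 0 < |z₀.im| / 2 := by positivity
  have hball : ∀ z ∈ Metric.ball z₀ (|z₀.im| / 2), |z₀.im| / 2 ≤ |z.im| := fun z hz ↦ by
    have h1 : |z.im - z₀.im| ≤ ‖z - z₀‖ := by simpa using Complex.abs_im_le_norm (z - z₀)
    rw [Metric.mem_ball, dist_eq_norm] at hz
    have h2 := abs_sub_abs_le_abs_sub z₀.im z.im
    rw [abs_sub_comm] at h2
    linarith
  have hne : ∀ z ∈ Metric.ball z₀ (|z₀.im| / 2), z.im ≠ 0 := fun z hz ↦
    abs_pos.1 (hpos.trans_le (hball z hz))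
  rw [← integral_const_mul]
  refine (hasDerivAt_integral_of_dominated_loc_of_deriv_le (μ := μ)
    (F := fun (z : ℂ) (x : ℝ) ↦ (z - x)⁻¹ ^ n)
    (F' := fun (z : ℂ) (x : ℝ) ↦ -(n : ℂ) * (z - x)⁻¹ ^ (n + 1))
    (bound := fun _ ↦ n * (|z₀.im| / 2)⁻¹ ^ (n + 1))
    (Metric.ball_mem_nhds z₀ hpos) ?_ (integrable_inv_sub_ofReal_pow hz₀ n)
    ?_ ?_ (integrable_const _) ?_).2
  · filter_upwards [Metric.ball_mem_nhds z₀ hpos] with z hz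
    exact ((continuous_inv_sub_ofReal (hne z hz)).pow n).aestronglyMeasurable
  · exact (continuous_const.mul ((continuous_inv_sub_ofReal hz₀).pow _)).aestronglyMeasurable
  · refine .of_forall fun x z hz ↦ ?_
    rw [norm_mul, norm_neg, norm_pow, Complex.norm_natCast]
    gcongr
    exact norm_inv_sub_ofReal_le hpos (hball z hz) x
  · refine .of_forall fun x z hz ↦ ?_
    have h0 := sub_ofReal_ne_zero (hne z hz) x
    have h1 := (((hasDerivAt_id z).sub_const (x : ℂ)).inv h0).pow n
    refine h1.congr_deriv ?_
    rcases n with _ | n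
    · simp
    · have h2 : -1 / (z - (x : ℂ)) ^ 2 = -((z - (x : ℂ))⁻¹ * (z - (x : ℂ))⁻¹) := by field_simp
      simp only [id, Pi.inv_apply, Nat.add_sub_cancel, h2]
      ring

lemma cauchyTransform_eq (μ : ProbabilityMeasure ℝ) (z : ℂ) :
    cauchyTransform μ z = ∫ x : ℝ, (z - x)⁻¹ ^ 1 ∂(μ : Measure ℝ) := by
  simp [cauchyTransform]

lemma differentiableAt_cauchyTransform (μ : ProbabilityMeasure ℝ) {z : ℂ} (hz : z.im ≠ 0) :
    DifferentiableAt ℂ (cauchyTransform μ) z := by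
  have : cauchyTransform μ = fun z : ℂ ↦ ∫ x : ℝ, (z - x)⁻¹ ^ 1 ∂(μ : Measure ℝ) :=
    funext (cauchyTransform_eq μ)
  rw [this]
  exact (hasDerivAt_integral_inv_sub_ofReal_pow hz 1).differentiableAt

/-- The open upper half-plane. -/
def upperHalf : Set ℂ := {z | 0 < z.im}

lemma isOpen_upperHalf : IsOpen upperHalf := isOpen_lt continuous_const Complex.continuous_im

lemma convex_upperHalf : Convex ℝ upperHalf := convex_halfSpace_im_gt 0

lemma analyticOnNhd_cauchyTransform (μ : ProbabilityMeasure ℝ) :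
    AnalyticOnNhd ℂ (cauchyTransform μ) upperHalf :=
  DifferentiableOn.analyticOnNhd (fun _ hz ↦
    (differentiableAt_cauchyTransform μ (ne_of_gt hz)).differentiableWithinAt) isOpen_upperHalf

lemma integral_pos_of_forall_pos {α : Type*} [MeasurableSpace α] {μ : Measure α} [NeZero μ]
    {g : α → ℝ} (hg : Integrable g μ) (h : ∀ᵐ x ∂μ, 0 < g x) : 0 < ∫ x, g x ∂μ := by
  rw [integral_pos_iff_support_of_nonneg_ae (h.mono fun x hx ↦ hx.le) hg]
  have : (Function.support g) =ᵐ[μ] univ := by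
    filter_upwards [h] with x hx
    exact eq_iff_iff.2 ⟨fun _ ↦ trivial, fun _ ↦ hx.ne'⟩
  rw [measure_congr this]
  exact NeZero.pos _

/-! ### Measures on the positive half-axis -/

/-- Jensen's inequality, from the nonnegativity of the variance of `‖g‖`. -/
lemma normSq_integral_le {α : Type*} [MeasurableSpace α] {μ : Measure α} [IsProbabilityMeasure μ]
    {g : α → ℂ} (hg : Integrable g μ) (hg2 : Integrable (fun x ↦ Complex.normSq (g x)) μ) :
    Complex.normSq (∫ x, g x ∂μ) ≤ ∫ x, Complex.normSq (g x) ∂μ := by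
  set m := ∫ x, ‖g x‖ ∂μ with hm
  have h1 : ‖∫ x, g x ∂μ‖ ≤ m := norm_integral_le_integral_norm g
  have h2 : 0 ≤ ∫ x, (Complex.normSq (g x) - 2 * m * ‖g x‖ + m ^ 2) ∂μ := by
    refine integral_nonneg fun x ↦ ?_
    simp only [Pi.zero_apply]
    rw [Complex.normSq_eq_norm_sq]
    nlinarith [sq_nonneg (‖g x‖ - m)]
  have h4 : ∫ x, (Complex.normSq (g x) - 2 * m * ‖g x‖ + m ^ 2) ∂μ =
      ∫ x, (Complex.normSq (g x) - 2 * m * ‖g x‖) ∂μ + ∫ _, m ^ 2 ∂μ :=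
    integral_add (hg2.sub (hg.norm.const_mul _)) (integrable_const _)
  have h5 : ∫ x, (Complex.normSq (g x) - 2 * m * ‖g x‖) ∂μ =
      ∫ x, Complex.normSq (g x) ∂μ - ∫ x, 2 * m * ‖g x‖ ∂μ :=
    integral_sub hg2 (hg.norm.const_mul _)
  rw [h4, h5, integral_const_mul, ← hm] at h2
  simp only [integral_const, probReal_univ, one_smul] at h2
  rw [Complex.normSq_eq_norm_sq]
  have h3 := pow_le_pow_left₀ (norm_nonneg _) h1 2
  nlinarith

/-- If `w + x` were small with `x ≥ 0`, the point `-x` of the removed ray would lie in a ball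
contained in the slit plane. The bound is uniform in `w` and `x`, as needed for domination. -/
lemma exists_le_norm_add_ofReal {w₀ : ℂ} (hw₀ : w₀ ∈ slitPlane) :
    ∃ ε > 0, Metric.ball w₀ ε ⊆ slitPlane ∧
      ∀ w ∈ Metric.ball w₀ ε, ∀ x : ℝ, 0 ≤ x → ε ≤ ‖w + x‖ := by
  obtain ⟨ε, hε, hball⟩ := Metric.isOpen_iff.1 Complex.isOpen_slitPlane w₀ hw₀
  refine ⟨ε / 2, half_pos hε, (Metric.ball_subset_ball (half_le_self hε.le)).trans hball,
    fun w hw x hx ↦ ?_⟩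
  by_contra! h
  have : (-x : ℂ) ∈ Metric.ball w₀ ε := by
    rw [Metric.mem_ball, dist_eq_norm] at *
    calc ‖-x - w₀‖ = ‖(w - w₀) - (w + x)‖ := by congr 1; ring
      _ ≤ ‖w - w₀‖ + ‖w + x‖ := norm_sub_le _ _
      _ < ε := by linarith
  have := hball this
  rw [Complex.mem_slitPlane_iff] at this
  simp at this
  linarith

lemma add_ofReal_ne_zero {w : ℂ} (hw : w ∈ slitPlane) {x : ℝ} (hx : 0 ≤ x) : w + x ≠ 0 := by
  obtain ⟨ε, hε, -, h⟩ := exists_le_norm_add_ofReal hw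
  exact norm_pos_iff.1 (hε.trans_le (h w (Metric.mem_ball_self hε) x hx))

lemma integrable_inv_add_ofReal {μ : Measure ℝ} [IsFiniteMeasure μ] (hμ : ∀ᵐ x ∂μ, 0 ≤ x) {w : ℂ}
    (hw : w ∈ slitPlane) : Integrable (fun x : ℝ ↦ (w + x)⁻¹) μ := by
  obtain ⟨ε, hε, -, h⟩ := exists_le_norm_add_ofReal hw
  refine Integrable.of_bound (by fun_prop) ε⁻¹ (hμ.mono fun x hx ↦ ?_)
  rw [norm_inv]
  exact inv_anti₀ hε (h w (Metric.mem_ball_self hε) x hx)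

lemma differentiableOn_integral_inv_add_ofReal {μ : Measure ℝ} [IsFiniteMeasure μ]
    (hμ : ∀ᵐ x ∂μ, 0 ≤ x) :
    DifferentiableOn ℂ (fun w : ℂ ↦ ∫ x : ℝ, (w + x)⁻¹ ∂μ) slitPlane := by
  intro w₀ hw₀
  obtain ⟨ε, hε, hsub, h⟩ := exists_le_norm_add_ofReal hw₀
  refine (hasDerivAt_integral_of_dominated_loc_of_deriv_le (μ := μ)
    (F := fun (w : ℂ) (x : ℝ) ↦ (w + x)⁻¹) (F' := fun (w : ℂ) (x : ℝ) ↦ -1 / (w + x) ^ 2)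
    (bound := fun _ ↦ 1 / ε ^ 2)
    (Metric.ball_mem_nhds w₀ hε) (.of_forall fun w ↦ by fun_prop)
    (integrable_inv_add_ofReal hμ hw₀)
    (Measurable.aestronglyMeasurable (by fun_prop)) ?_ (integrable_const _)
    ?_).2.differentiableAt.differentiableWithinAt
  · filter_upwards [hμ] with x hx w hw
    rw [norm_div, norm_neg, norm_one, norm_pow]
    gcongr
    exact h w hw x hx
  · filter_upwards [hμ] with x hx w hw
    have h1 := ((hasDerivAt_id w).add_const (x : ℂ)).inv (add_ofReal_ne_zero (hsub hw) hx)
    exact h1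

/-- Integrate `(w + x)⁻¹ = |w + x|⁻² (conj w + x)`: `A` and `B` are the integrals of `|w + x|⁻²` and
`x |w + x|⁻²`, and the bound by `A` is Jensen's inequality. -/
lemma integral_inv_add_ofReal_eq {μ : Measure ℝ} [IsProbabilityMeasure μ] (hμ : ∀ᵐ x ∂μ, 0 ≤ x)
    {w : ℂ} (hw : w ∈ slitPlane) :
    ∃ A B : ℝ, 0 < A ∧ 0 ≤ B ∧ Complex.normSq (∫ x : ℝ, (w + x)⁻¹ ∂μ) ≤ A ∧
      ∫ x : ℝ, (w + x)⁻¹ ∂μ = A * (starRingEnd ℂ) w + B := by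
  obtain ⟨ε, hε, -, hle⟩ := exists_le_norm_add_ofReal hw
  have hle' (x : ℝ) (hx : 0 ≤ x) := hle w (Metric.mem_ball_self hε) x hx
  have hi := integrable_inv_add_ofReal hμ hw
  have hA : Integrable (fun x : ℝ ↦ Complex.normSq (w + x)⁻¹) μ := by
    refine Integrable.of_bound (Complex.continuous_normSq.measurable.comp
      (by fun_prop)).aestronglyMeasurable (ε⁻¹ ^ 2) (hμ.mono fun x hx ↦ ?_)
    rw [Complex.normSq_eq_norm_sq, Real.norm_of_nonneg (by positivity), norm_inv]
    gcongr
    exact hle' x hx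
  have hE (x : ℝ) (hx : 0 ≤ x) : (w + x)⁻¹ = (Complex.normSq (w + x)⁻¹ : ℝ) * (starRingEnd ℂ) w +
      ((x * Complex.normSq (w + x)⁻¹ : ℝ) : ℂ) := by
    have h0 := add_ofReal_ne_zero hw hx
    have h1 : (w + x)⁻¹ = (Complex.normSq (w + x)⁻¹ : ℝ) * (starRingEnd ℂ) (w + x) := by
      rw [Complex.normSq_eq_conj_mul_self (z := (w + x)⁻¹), map_inv₀]
      have h2 : (starRingEnd ℂ) (w + x) ≠ 0 := by
        rw [Ne, map_eq_zero]
        exact h0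
      field_simp
    conv_lhs => rw [h1]
    rw [map_add, Complex.conj_ofReal]
    push_cast
    ring
  have hB : Integrable (fun x : ℝ ↦ x * Complex.normSq (w + x)⁻¹) μ := by
    -- The integrand of `B` is integrable as a difference of two integrable functions.
    have h3 : Integrable (fun x : ℝ ↦ (w + x)⁻¹ -
        (Complex.normSq (w + x)⁻¹ : ℝ) * (starRingEnd ℂ) w) μ := hi.sub (hA.ofReal.mul_const _)
    refine (Complex.reCLM.integrable_comp h3).congr (hμ.mono fun x hx ↦ ?_)
    simp only [Complex.reCLM_apply]
    nth_rewrite 1 [hE x hx]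
    rw [add_sub_cancel_left, Complex.ofReal_re]
  refine ⟨_, ∫ x : ℝ, x * Complex.normSq (w + x)⁻¹ ∂μ, ?_, ?_, normSq_integral_le hi hA, ?_⟩
  · refine integral_pos_of_forall_pos hA (hμ.mono fun x hx ↦ ?_)
    exact Complex.normSq_pos.2 (inv_ne_zero (add_ofReal_ne_zero hw hx))
  · exact integral_nonneg_of_ae (hμ.mono fun x hx ↦ mul_nonneg hx (Complex.normSq_nonneg _))
  · rw [← integral_complex_ofReal, ← integral_complex_ofReal, ← integral_mul_const,
      ← integral_add (hA.ofReal.mul_const _) hB.ofReal]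
    exact integral_congr_ae (hμ.mono fun x hx ↦ hE x hx)

lemma neg_reciprocalCauchy_neg (χ : ProbabilityMeasure ℝ) (w : ℂ) :
    -reciprocalCauchy χ (-w) = (∫ x : ℝ, (w + x)⁻¹ ∂(χ : Measure ℝ))⁻¹ := by
  rw [reciprocalCauchy, cauchyTransform, one_div, ← inv_neg, ← integral_neg]
  congr 2
  ext x
  rw [one_div, ← inv_neg]
  congr 1
  ring

/-- With `S = A conj w + B`, one has `1 / S = (A w + B) / |S|²`. Subtracting `w` leaves the
coefficient `A / |S|² - 1`, which is nonnegative exactly by the Jensen bound `|S|² ≤ A`. -/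
theorem isConeFun_neg_reciprocalCauchy_neg_sub {χ : ProbabilityMeasure ℝ}
    (h : (χ : Measure ℝ) (Iio 0) = 0) :
    IsConeFun fun w ↦ -reciprocalCauchy χ (-w) - w := by
  have hμ : ∀ᵐ x ∂(χ : Measure ℝ), 0 ≤ x := by
    rw [ae_iff]
    convert h using 2
    ext x
    simp
  have key (w : ℂ) (hw : w ∈ slitPlane) := integral_inv_add_ofReal_eq hμ hw
  have hne (w : ℂ) (hw : w ∈ slitPlane) : ∫ x : ℝ, (w + x)⁻¹ ∂(χ : Measure ℝ) ≠ 0 := by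
    obtain ⟨A, B, hA, hB, -, h⟩ := key w hw
    rw [h, add_comm]
    refine Complex.slitPlane_ne_zero (add_mul_mem_slitPlane hB hA.le (by linarith) ?_)
    rw [Complex.mem_slitPlane_iff] at hw ⊢
    simpa using hw
  simp_rw [neg_reciprocalCauchy_neg]
  refine ⟨((differentiableOn_integral_inv_add_ofReal hμ).inv hne).sub differentiableOn_id,
    fun w hw ↦ ?_⟩
  obtain ⟨A, B, hA, hB, hle, h⟩ := key w hw
  set S := ∫ x : ℝ, (w + x)⁻¹ ∂(χ : Measure ℝ) with hS
  have hS0 : 0 < Complex.normSq S := Complex.normSq_pos.2 (hne w hw)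
  refine ⟨B / Complex.normSq S, A / Complex.normSq S - 1, by positivity, ?_, ?_⟩
  · rw [sub_nonneg, one_le_div hS0]
    exact hle
  · rw [Complex.inv_def, h]
    simp only [map_add, map_mul, Complex.conj_ofReal, Complex.conj_conj]
    push_cast
    ring

end FreeRegular

namespace FreeRegular

/-! ### Truncated cones -/

lemma truncatedCone_mono {α α' M M' : ℝ} (hα : α' ≤ α) (hM : M ≤ M') (hM' : 0 ≤ M') :
    truncatedCone α' M' ⊆ truncatedCone α M := fun _ hz ↦
  ⟨hz.1.trans_le (mul_le_mul_of_nonneg_right hα (hM'.trans hz.2.le)), hM.trans_lt hz.2⟩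

lemma isOpen_truncatedCone (α M : ℝ) : IsOpen (truncatedCone α M) := by
  have h1 : IsOpen {z : ℂ | |z.re| < α * z.im} := isOpen_lt (by fun_prop) (by fun_prop)
  have h2 : IsOpen {z : ℂ | M < z.im} := isOpen_lt (by fun_prop) (by fun_prop)
  exact h1.inter h2

lemma convex_truncatedCone (α M : ℝ) : Convex ℝ (truncatedCone α M) := by
  rintro z ⟨hz1, hz2⟩ w ⟨hw1, hw2⟩ a b ha hb hab
  simp only [truncatedCone, mem_ofPred_eq, Complex.add_re, Complex.real_smul, Complex.re_ofReal_mul,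
    Complex.add_im, Complex.im_ofReal_mul]
  constructor
  · rcases ha.eq_or_lt with rfl | ha
    · obtain rfl : b = 1 := by linarith
      simpa using hw1
    · calc |a * z.re + b * w.re| ≤ |a * z.re| + |b * w.re| := abs_add_le _ _
        _ = a * |z.re| + b * |w.re| := by rw [abs_mul, abs_mul, abs_of_pos ha, abs_of_nonneg hb]
        _ < α * (a * z.im + b * w.im) := by nlinarith
  · rcases ha.eq_or_lt with rfl | ha
    · obtain rfl : b = 1 := by linarith
      simpa using hw2
    · obtain rfl : b = 1 - a := by linarith
      nlinarith

lemma im_pos_of_mem_truncatedCone {α M : ℝ} (hM : 0 ≤ M) {z : ℂ} (hz : z ∈ truncatedCone α M) :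
    0 < z.im := hM.trans_lt hz.2

lemma norm_le_of_mem_truncatedCone {α M : ℝ} (hM : 0 ≤ M) {z : ℂ} (hz : z ∈ truncatedCone α M) :
    ‖z‖ ≤ (1 + α) * z.im := by
  have h1 := Complex.norm_le_abs_re_add_abs_im z
  rw [abs_of_pos (im_pos_of_mem_truncatedCone hM hz)] at h1
  have := hz.1
  linarith

lemma mul_I_mem_truncatedCone {α M r : ℝ} (hα : 0 < α) (hM : 0 ≤ M) (hr : M < r) :
    (r : ℂ) * Complex.I ∈ truncatedCone α M := by
  simp only [truncatedCone, mem_ofPred_eq, Complex.re_ofReal_mul, Complex.I_re, mul_zero, abs_zero,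
    Complex.im_ofReal_mul, Complex.I_im, mul_one]
  exact ⟨mul_pos hα (hM.trans_lt hr), hr⟩

/-- The filter of neighbourhoods of infinity in a truncated cone. -/
noncomputable def coneFilter (α M : ℝ) : Filter ℂ := Bornology.cobounded ℂ ⊓ 𝓟 (truncatedCone α M)

instance (α M : ℝ) : (coneFilter α M).IsCountablyGenerated := by
  unfold coneFilter
  rw [← comap_norm_atTop]
  infer_instance

lemma exists_forall_mem_truncatedCone {α M : ℝ} {p : ℂ → Prop} (h : ∀ᶠ z in coneFilter α M, p z) :
    ∃ R : ℝ, ∀ M', R ≤ M' → ∀ z ∈ truncatedCone α M', p z := by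
  rw [coneFilter, ← comap_norm_atTop, eventually_inf_principal, eventually_comap] at h
  obtain ⟨R, hR⟩ := eventually_atTop.1 h
  refine ⟨max R (max M 0), fun M' hM' z hz ↦ ?_⟩
  have h1 : R ≤ M' := (le_max_left _ _).trans hM'
  have h2 : M ≤ M' := (le_max_left _ _).trans ((le_max_right _ _).trans hM')
  have h3 : 0 ≤ M' := (le_max_right _ _).trans ((le_max_right _ _).trans hM')
  refine hR ‖z‖ ?_ z rfl (truncatedCone_mono le_rfl h2 h3 hz)
  have := Complex.abs_im_le_norm z
  have := le_abs_self z.im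
  linarith [hz.2]

lemma eventually_mem_truncatedCone (α M : ℝ) : ∀ᶠ z in coneFilter α M, z ∈ truncatedCone α M :=
  mem_inf_of_right (mem_principal_self _)

lemma tendsto_norm_coneFilter (α M : ℝ) : Tendsto (fun z : ℂ ↦ ‖z‖) (coneFilter α M) atTop :=
  tendsto_norm_cobounded_atTop.mono_left inf_le_left

/-! ### Uniqueness of the Voiculescu transform -/

/-- In the cone `Im z ≥ |z| / (1 + α)`, so `z` has distance at least `2 c |z|` from the real line;
replacing `z` by `ψ z` costs at most `c |z|` far out. -/
lemma eventually_le_norm_sub {α M : ℝ} (hα : 0 < α) (hM : 0 ≤ M) {ψ : ℂ → ℂ}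
    (hψ : Tendsto (fun z ↦ ψ z / z) (coneFilter α M) (𝓝 1)) :
    ∃ c > 0, ∀ᶠ z in coneFilter α M, ∀ x : ℝ,
      0 < ‖z‖ ∧ c * ‖z‖ ≤ ‖ψ z - x‖ ∧ ‖ψ z‖ ≤ 2 * ‖z‖ := by
  set c : ℝ := 1 / (2 * (1 + α)) with hc
  have hc0 : 0 < c := by positivity
  have hc1 : c < 1 := by
    rw [hc, div_lt_one (by positivity)]
    linarith
  refine ⟨c, hc0, ?_⟩
  filter_upwards [hψ.eventually (Metric.ball_mem_nhds 1 hc0), eventually_mem_truncatedCone α M]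
    with z hz hzc x
  have him := im_pos_of_mem_truncatedCone hM hzc
  have hz0 : z ≠ 0 := fun h ↦ by simp [h] at him
  have hzn : 0 < ‖z‖ := norm_pos_iff.2 hz0
  have h1 : ‖ψ z - z‖ ≤ c * ‖z‖ := by
    rw [dist_eq_norm] at hz
    have : ψ z - z = (ψ z / z - 1) * z := by field_simp
    rw [this, norm_mul]
    gcongr
  have h2 : 2 * c * ‖z‖ ≤ ‖z - x‖ := by
    have h3 := abs_im_le_norm_sub_ofReal z x
    rw [abs_of_pos him] at h3
    have h4 := norm_le_of_mem_truncatedCone hM hzc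
    have h5 : 2 * c * ‖z‖ ≤ z.im := by
      rw [hc]
      field_simp
      linarith
    linarith
  refine ⟨hzn, ?_, ?_⟩
  · have := norm_sub_le (ψ z - x) (ψ z - z)
    rw [show ψ z - x - (ψ z - z) = z - x by ring] at this
    linarith
  · have := norm_add_le (ψ z - z) z
    rw [sub_add_cancel] at this
    nlinarith

lemma tendsto_div_sub_ofReal {α M : ℝ} (hα : 0 < α) (hM : 0 ≤ M) {ψ : ℂ → ℂ}
    (hψ : Tendsto (fun z ↦ ψ z / z) (coneFilter α M) (𝓝 1)) (x : ℝ) :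
    Tendsto (fun z ↦ ψ z / (ψ z - x)) (coneFilter α M) (𝓝 1) := by
  obtain ⟨c, hc, h⟩ := eventually_le_norm_sub hα hM hψ
  rw [tendsto_iff_norm_sub_tendsto_zero]
  refine squeeze_zero' (.of_forall fun _ ↦ norm_nonneg _) (g := fun z ↦ |x| / c / ‖z‖) ?_
    ((tendsto_norm_coneFilter α M).const_div_atTop _)
  filter_upwards [h] with z hz
  obtain ⟨hz0, h1, -⟩ := hz x
  have hpos : 0 < ‖ψ z - x‖ := (by positivity : 0 < c * ‖z‖).trans_le h1
  have hne : ψ z - x ≠ 0 := norm_pos_iff.1 hpos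
  have : ψ z / (ψ z - x) - 1 = x / (ψ z - x) := by field_simp; ring
  rw [this, norm_div, Complex.norm_real, Real.norm_eq_abs, div_div]
  gcongr

lemma tendsto_integral_div_mul_div {μ : Measure ℝ} [IsProbabilityMeasure μ] {α M : ℝ} (hα : 0 < α)
    (hM : 0 ≤ M) {ψ₁ ψ₂ : ℂ → ℂ} (h₁ : Tendsto (fun z ↦ ψ₁ z / z) (coneFilter α M) (𝓝 1))
    (h₂ : Tendsto (fun z ↦ ψ₂ z / z) (coneFilter α M) (𝓝 1)) :
    Tendsto (fun z ↦ ∫ x : ℝ, ψ₁ z / (ψ₁ z - x) * (ψ₂ z / (ψ₂ z - x)) ∂μ) (coneFilter α M)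
      (𝓝 1) := by
  obtain ⟨c₁, hc₁, e₁⟩ := eventually_le_norm_sub hα hM h₁
  obtain ⟨c₂, hc₂, e₂⟩ := eventually_le_norm_sub hα hM h₂
  have hb {ψ : ℂ → ℂ} {c : ℝ} (hc : 0 < c) {z : ℂ} {x : ℝ}
      (h : 0 < ‖z‖ ∧ c * ‖z‖ ≤ ‖ψ z - x‖ ∧ ‖ψ z‖ ≤ 2 * ‖z‖) : ‖ψ z / (ψ z - x)‖ ≤ 2 / c := by
    obtain ⟨h0, h1, h2⟩ := h
    rw [norm_div]
    calc ‖ψ z‖ / ‖ψ z - x‖ ≤ (2 * ‖z‖) / (c * ‖z‖) := by gcongr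
      _ = 2 / c := by field_simp
  have := tendsto_integral_filter_of_dominated_convergence (μ := μ) (l := coneFilter α M)
    (F := fun z x ↦ ψ₁ z / (ψ₁ z - (x : ℝ)) * (ψ₂ z / (ψ₂ z - (x : ℝ)))) (f := fun _ ↦ (1 : ℂ))
    (fun _ ↦ 2 / c₁ * (2 / c₂))
    (.of_forall fun z ↦ Measurable.aestronglyMeasurable (by fun_prop)) ?_ (integrable_const _) ?_
  · simpa using this
  · filter_upwards [e₁, e₂] with z hz₁ hz₂
    refine .of_forall fun x ↦ ?_
    rw [norm_mul]
    exact mul_le_mul (hb hc₁ (hz₁ x)) (hb hc₂ (hz₂ x)) (norm_nonneg _) (by positivity)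
  · refine .of_forall fun x ↦ ?_
    simpa using (tendsto_div_sub_ofReal hα hM h₁ x).mul (tendsto_div_sub_ofReal hα hM h₂ x)

lemma IsVoiculescuTransform.congr {μ : ProbabilityMeasure ℝ} {φ φ' : ℂ → ℂ}
    (h : IsVoiculescuTransform μ φ) {α M : ℝ} (hα : 0 < α) (he : EqOn φ φ' (truncatedCone α M)) :
    IsVoiculescuTransform μ φ' := by
  obtain ⟨α₁, M₁, hα₁, hM₁, han, hinv, ht⟩ := h
  have hM' : 0 < max M M₁ := hM₁.trans_le (le_max_right _ _)
  have hs : truncatedCone (min α α₁) (max M M₁) ⊆ truncatedCone α M :=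
    truncatedCone_mono (min_le_left _ _) (le_max_left _ _) hM'.le
  have hs₁ : truncatedCone (min α α₁) (max M M₁) ⊆ truncatedCone α₁ M₁ :=
    truncatedCone_mono (min_le_right _ _) (le_max_right _ _) hM'.le
  refine ⟨min α α₁, max M M₁, lt_min hα hα₁, hM', ?_, fun z hz ↦ ?_, ?_⟩
  · exact (han.mono hs₁).congr (isOpen_truncatedCone _ _) (he.mono hs)
  · rw [← he (hs hz)]
    exact hinv z (hs₁ hz)
  · refine (ht.mono_left (inf_le_inf_left _ (principal_mono.2 hs₁))).congr' ?_
    filter_upwards [eventually_mem_truncatedCone (min α α₁) (max M M₁)] with z hz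
    rw [he (hs hz)]

lemma cauchyTransform_of_reciprocalCauchy_eq {μ : ProbabilityMeasure ℝ} {w z : ℂ}
    (h : reciprocalCauchy μ w = z) : cauchyTransform μ w = z⁻¹ := by
  rw [← h, reciprocalCauchy, one_div, inv_inv]

/-- Partial fractions: `1 / (a - x) - 1 / (b - x) = (b - a) / ((a - x) (b - x))`, and the left side
integrates to `0`. -/
lemma div_mul_div_integral {μ : ProbabilityMeasure ℝ} {a b : ℂ} (ha : a.im ≠ 0) (hb : b.im ≠ 0)
    (h : cauchyTransform μ a = cauchyTransform μ b) (hab : a ≠ b) :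
    ∫ x : ℝ, a / (a - x) * (b / (b - x)) ∂(μ : Measure ℝ) = 0 := by
  have ia : Integrable (fun x : ℝ ↦ (a - x)⁻¹ ^ 1) (μ : Measure ℝ) :=
    integrable_inv_sub_ofReal_pow ha 1
  have ib : Integrable (fun x : ℝ ↦ (b - x)⁻¹ ^ 1) (μ : Measure ℝ) :=
    integrable_inv_sub_ofReal_pow hb 1
  have hsub : b - a ≠ 0 := sub_ne_zero.2 hab.symm
  have e (x : ℝ) : a / (a - x) * (b / (b - x)) =
      a * b / (b - a) * ((a - x)⁻¹ ^ 1 - (b - x)⁻¹ ^ 1) := by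
    have h1 := sub_ofReal_ne_zero ha x
    have h2 := sub_ofReal_ne_zero hb x
    field_simp
    ring
  simp_rw [e]
  rw [integral_const_mul, integral_sub ia ib, ← cauchyTransform_eq, ← cauchyTransform_eq, h,
    sub_self, mul_zero]

/-- Two distinct preimages `a`, `b` of `z` under `F_μ` would make the integral of `a / (a - x) * (b
/ (b - x))` vanish. When both are asymptotic to `z`, that integral tends to `1`, so far out in the
cone the branches coincide. -/
lemma IsVoiculescuTransform.exists_eqOn {μ : ProbabilityMeasure ℝ} {φ₁ φ₂ : ℂ → ℂ}
    (h₁ : IsVoiculescuTransform μ φ₁) (h₂ : IsVoiculescuTransform μ φ₂) :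
    ∃ α M : ℝ, 0 < α ∧ 0 < M ∧ EqOn φ₁ φ₂ (truncatedCone α M) := by
  obtain ⟨α₁, M₁, hα₁, hM₁, -, hinv₁, ht₁⟩ := h₁
  obtain ⟨α₂, M₂, hα₂, hM₂, -, hinv₂, ht₂⟩ := h₂
  set α := min α₁ α₂ with hα
  set M := max M₁ M₂ with hM
  have hα0 : 0 < α := lt_min hα₁ hα₂
  have hM0 : 0 < M := hM₁.trans_le (le_max_left _ _)
  have hs₁ : truncatedCone α M ⊆ truncatedCone α₁ M₁ :=
    truncatedCone_mono (min_le_left _ _) (le_max_left _ _) hM0.le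
  have hs₂ : truncatedCone α M ⊆ truncatedCone α₂ M₂ :=
    truncatedCone_mono (min_le_right _ _) (le_max_right _ _) hM0.le
  have hlim := tendsto_integral_div_mul_div (μ := (μ : Measure ℝ)) hα0 hM0.le
    (ht₁.mono_left (inf_le_inf_left _ (principal_mono.2 hs₁)))
    (ht₂.mono_left (inf_le_inf_left _ (principal_mono.2 hs₂)))
  have hev : ∀ᶠ z in coneFilter α M, φ₁ z = φ₂ z := by
    filter_upwards [hlim.eventually_ne one_ne_zero, eventually_mem_truncatedCone α M] with z hz hzc
    by_contra hne
    obtain ⟨him₁, hF₁⟩ := hinv₁ z (hs₁ hzc)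
    obtain ⟨him₂, hF₂⟩ := hinv₂ z (hs₂ hzc)
    refine hz (div_mul_div_integral him₁.ne' him₂.ne' ?_ fun h ↦ hne (add_left_cancel h))
    rw [cauchyTransform_of_reciprocalCauchy_eq hF₁, cauchyTransform_of_reciprocalCauchy_eq hF₂]
  obtain ⟨R, hR⟩ := exists_forall_mem_truncatedCone hev
  exact ⟨α, max R 1, hα0, by positivity, hR _ (le_max_left _ _)⟩

/-! ### The Cauchy transform determines the measure -/

/-- Both Cauchy transforms equal `z⁻¹` at `z + φ z`. These points accumulate without repetition,
since `z` is recovered from `z + φ z`, and the identity theorem applies. -/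
lemma cauchyTransform_eqOn_of_isVoiculescuTransform {μ ν : ProbabilityMeasure ℝ} {φ : ℂ → ℂ}
    (hμ : IsVoiculescuTransform μ φ) (hν : IsVoiculescuTransform ν φ) :
    EqOn (cauchyTransform μ) (cauchyTransform ν) upperHalf := by
  obtain ⟨α₁, M₁, hα₁, hM₁, han, hinv₁, -⟩ := hμ
  obtain ⟨α₂, M₂, hα₂, hM₂, -, hinv₂, -⟩ := hν
  set M := max M₁ M₂ with hM
  have hM0 : 0 < M := hM₁.trans_le (le_max_left _ _)
  have hα0 : 0 < min α₁ α₂ := lt_min hα₁ hα₂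
  have hs₁ : truncatedCone (min α₁ α₂) M ⊆ truncatedCone α₁ M₁ :=
    truncatedCone_mono (min_le_left _ _) (le_max_left _ _) hM0.le
  have hs₂ : truncatedCone (min α₁ α₂) M ⊆ truncatedCone α₂ M₂ :=
    truncatedCone_mono (min_le_right _ _) (le_max_right _ _) hM0.le
  set z₀ : ℂ := ((M + 1 : ℝ) : ℂ) * Complex.I with hz₀
  have hz₀m : z₀ ∈ truncatedCone (min α₁ α₂) M :=
    mul_I_mem_truncatedCone hα0 hM0.le (by linarith)
  refine (analyticOnNhd_cauchyTransform μ).eqOn_of_preconnected_of_frequently_eq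
    (analyticOnNhd_cauchyTransform ν) convex_upperHalf.isPreconnected
    (z₀ := z₀ + φ z₀) (hinv₁ z₀ (hs₁ hz₀m)).1 ?_
  have hnhds : truncatedCone (min α₁ α₂) M ∈ 𝓝 z₀ :=
    (isOpen_truncatedCone _ _).mem_nhds hz₀m
  have ht : Tendsto (fun z ↦ z + φ z) (𝓝[≠] z₀) (𝓝[≠] (z₀ + φ z₀)) := by
    refine tendsto_nhdsWithin_iff.2 ⟨?_, ?_⟩
    · exact ((continuousAt_id.add (han z₀ (hs₁ hz₀m)).continuousAt).tendsto).mono_left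
        nhdsWithin_le_nhds
    · filter_upwards [self_mem_nhdsWithin, mem_nhdsWithin_of_mem_nhds hnhds] with z hz hzc h
      have h1 := (hinv₁ z (hs₁ hzc)).2
      have h2 := (hinv₁ z₀ (hs₁ hz₀m)).2
      rw [mem_singleton_iff.1 h, h2] at h1
      exact hz h1.symm
  refine ht.frequently (Eventually.frequently ?_)
  filter_upwards [mem_nhdsWithin_of_mem_nhds hnhds] with z hzc
  rw [cauchyTransform_of_reciprocalCauchy_eq (hinv₁ z (hs₁ hzc)).2,
    cauchyTransform_of_reciprocalCauchy_eq (hinv₂ z (hs₂ hzc)).2]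

lemma integral_inv_pow_eq {μ ν : ProbabilityMeasure ℝ}
    (h : EqOn (cauchyTransform μ) (cauchyTransform ν) upperHalf) (n : ℕ) :
    ∀ z ∈ upperHalf, ∫ x : ℝ, (z - x)⁻¹ ^ n ∂(μ : Measure ℝ) =
      ∫ x : ℝ, (z - x)⁻¹ ^ n ∂(ν : Measure ℝ) := by
  rcases n with _ | n
  · simp
  induction n with
  | zero => intro z hz; simpa [cauchyTransform_eq] using h hz
  | succ n ih =>
    intro z hz
    have hz' : z.im ≠ 0 := ne_of_gt hz
    have h1 := hasDerivAt_integral_inv_sub_ofReal_pow (μ := (μ : Measure ℝ)) hz' (n + 1)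
    have h2 := hasDerivAt_integral_inv_sub_ofReal_pow (μ := (ν : Measure ℝ)) hz' (n + 1)
    have h3 := h1.congr_of_eventuallyEq (f₁ := fun z : ℂ ↦
      ∫ x : ℝ, (z - x)⁻¹ ^ (n + 1) ∂(ν : Measure ℝ)) (by
        filter_upwards [isOpen_upperHalf.mem_nhds hz] with w hw using (ih w hw).symm)
    have h4 := h3.unique h2
    have h5 : -((n + 1 : ℕ) : ℂ) ≠ 0 := neg_ne_zero.2 (Nat.cast_ne_zero.2 n.succ_ne_zero)
    exact mul_left_cancel₀ h5 h4

/-- The Cayley transform of the real line, as a bounded continuous function. -/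
noncomputable def cayley : BoundedContinuousFunction ℝ ℂ :=
  BoundedContinuousFunction.ofNormedAddCommGroup
    (fun x : ℝ ↦ 1 - 2 * Complex.I * (Complex.I - x)⁻¹)
    (by have := continuous_inv_sub_ofReal (z := Complex.I) (by simp); fun_prop) (1 + 2 * 1) (by
      intro x
      refine (norm_sub_le _ _).trans ?_
      have := norm_inv_sub_ofReal_le (z := Complex.I) one_pos (by simp) x
      simp only [norm_mul, norm_one, Complex.norm_I, Complex.norm_ofNat, inv_one] at this ⊢
      linarith)

lemma cayley_apply (x : ℝ) : cayley x = 1 - 2 * Complex.I * (Complex.I - x)⁻¹ := rfl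

lemma cayley_mul_star : cayley * star cayley = 1 := by
  ext x
  have h1 : Complex.I - x ≠ 0 := sub_ofReal_ne_zero (by simp) x
  have h2 : -Complex.I - x ≠ 0 := sub_ofReal_ne_zero (by simp) x
  simp only [BoundedContinuousFunction.mul_apply, BoundedContinuousFunction.star_apply,
    cayley_apply, BoundedContinuousFunction.coe_one, Pi.one_apply]
  simp
  field_simp
  ring_nf

/-- A power of the Cayley transform is a polynomial in `(i - x)⁻¹`, whose powers have integrals
fixed by the derivatives of the Cauchy transform at `i`. -/
lemma integral_cayley_pow_eq {μ ν : ProbabilityMeasure ℝ}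
    (h : EqOn (cauchyTransform μ) (cauchyTransform ν) upperHalf) (n : ℕ) :
    ∫ x : ℝ, cayley x ^ n ∂(μ : Measure ℝ) = ∫ x : ℝ, cayley x ^ n ∂(ν : Measure ℝ) := by
  have hI : Complex.I ∈ upperHalf := by simp [upperHalf]
  have key (χ : ProbabilityMeasure ℝ) : ∫ x : ℝ, cayley x ^ n ∂(χ : Measure ℝ) =
      ∑ m ∈ Finset.range (n + 1), ∫ x : ℝ, (1 * (-(2 * Complex.I)) ^ (n - m) * (n.choose m)) *
        (Complex.I - x)⁻¹ ^ (n - m) ∂(χ : Measure ℝ) := by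
    rw [← integral_finsetSum _ fun m _ ↦
      (integrable_inv_sub_ofReal_pow (ne_of_gt hI) _).const_mul _]
    congr 1
    ext x
    rw [cayley_apply, sub_eq_add_neg, add_pow]
    refine Finset.sum_congr rfl fun m _ ↦ ?_
    rw [← neg_mul, mul_pow, one_pow]
    ring
  rw [key, key]
  refine Finset.sum_congr rfl fun m _ ↦ ?_
  rw [integral_const_mul, integral_const_mul, integral_inv_pow_eq h _ _ hI]

/-- On the real line the Cayley transform is unimodular, so its conjugate is its inverse and mixed
words collapse to pure powers. -/
lemma mem_closure_cayley {g : BoundedContinuousFunction ℝ ℂ}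
    (hg : g ∈ Submonoid.closure ({cayley, star cayley} : Set (BoundedContinuousFunction ℝ ℂ))) :
    ∃ n : ℕ, g = cayley ^ n ∨ g = star cayley ^ n := by
  induction hg using Submonoid.closure_induction_left with
  | one => exact ⟨0, by simp⟩
  | mul_left x hx y _ ih =>
    obtain ⟨n, h⟩ := ih
    have h1 : star cayley * cayley = 1 := by rw [mul_comm, cayley_mul_star]
    rcases hx with rfl | hx
    · rcases h with rfl | rfl
      · exact ⟨n + 1, .inl (pow_succ' _ _).symm⟩
      · rcases n with _ | n
        · exact ⟨1, .inl (by simp)⟩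
        · exact ⟨n, .inr (by rw [pow_succ', ← mul_assoc, cayley_mul_star, one_mul])⟩
    · rw [mem_singleton_iff] at hx
      subst hx
      rcases h with rfl | rfl
      · rcases n with _ | n
        · exact ⟨1, .inr (by simp)⟩
        · exact ⟨n, .inl (by rw [pow_succ', ← mul_assoc, h1, one_mul])⟩
      · exact ⟨n + 1, .inr (pow_succ' _ _).symm⟩

/-- The star algebra generated by the Cayley transform separates points, and it is spanned by powers
and conjugate powers, whose integrals agree. A Stone–Weierstrass criterion then identifies the
measures. -/
lemma eq_of_cauchyTransform_eqOn {μ ν : ProbabilityMeasure ℝ}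
    (h : EqOn (cauchyTransform μ) (cauchyTransform ν) upperHalf) : μ = ν := by
  suffices H : (μ : Measure ℝ) = (ν : Measure ℝ) from Subtype.ext H
  refine ext_of_forall_mem_subalgebra_integral_eq_of_polish (𝕜 := ℂ)
    (A := StarAlgebra.adjoin ℂ {cayley}) ?_ fun g hg ↦ ?_
  · intro x y hxy
    refine ⟨cayley, ⟨cayley.toContinuousMap, ⟨cayley, StarAlgebra.self_mem_adjoin_singleton ℂ _,
      rfl⟩, rfl⟩, fun he ↦ hxy ?_⟩
    have he' : cayley x = cayley y := he
    rw [cayley_apply, cayley_apply] at he'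
    have h1 := mul_left_cancel₀ (by simp) (sub_right_injective he')
    have h2 := sub_right_injective (inv_injective h1)
    exact_mod_cast h2
  · have hg' : g ∈ Submodule.span ℂ (Submonoid.closure
        ({cayley, star cayley} : Set (BoundedContinuousFunction ℝ ℂ)) :
          Set (BoundedContinuousFunction ℝ ℂ)) := by
      rw [← Algebra.adjoin_eq_span]
      have : g ∈ (StarAlgebra.adjoin ℂ {cayley}).toSubalgebra := hg
      rw [StarAlgebra.adjoin_toSubalgebra] at this
      convert this using 2
      simp only [Set.star_singleton, Set.singleton_union]
      rfl
    have hint (f : BoundedContinuousFunction ℝ ℂ) (χ : ProbabilityMeasure ℝ) :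
        Integrable f (χ : Measure ℝ) := f.integrable _
    clear hg
    induction hg' using Submodule.span_induction with
    | mem g hg =>
      obtain ⟨n, rfl | rfl⟩ := mem_closure_cayley hg
      · simpa using integral_cayley_pow_eq h n
      · have e (χ : ProbabilityMeasure ℝ) : ∫ x : ℝ, (star cayley ^ n :
            BoundedContinuousFunction ℝ ℂ) x ∂(χ : Measure ℝ) =
            (starRingEnd ℂ) (∫ x : ℝ, cayley x ^ n ∂(χ : Measure ℝ)) := by
          rw [← integral_conj]
          simp
        rw [e, e, integral_cayley_pow_eq h n]
    | zero => simp
    | add f g _ _ hf hg =>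
      simp only [BoundedContinuousFunction.coe_add, Pi.add_apply]
      rw [integral_add (hint f μ) (hint g μ), integral_add (hint f ν) (hint g ν), hf, hg]
    | smul c f _ hf =>
      simp only [BoundedContinuousFunction.coe_smul, integral_smul, hf]

lemma eq_of_isVoiculescuTransform {μ ν : ProbabilityMeasure ℝ} {φ : ℂ → ℂ}
    (hμ : IsVoiculescuTransform μ φ) (hν : IsVoiculescuTransform ν φ) : μ = ν :=
  eq_of_cauchyTransform_eqOn (cauchyTransform_eqOn_of_isVoiculescuTransform hμ hν)

end FreeRegular

namespace FreeRegular

open Complex (slitPlane)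
open unitInterval

/-! ### Growth of the transform at infinity -/

/-- A sector which contains the right half-plane and stays away from the negative half-axis. -/
def wideSector : Set ℂ := {w | -(3 / 4) * ‖w‖ ≤ w.re}

/-- With `c = b |w|`, the square of the right side is at least `a² + c² - (3/2) a c`, which exceeds
`(a + c)² / 8` by `(7/8) (a - c)²`; and `1/8 > 1/9`. -/
lemma le_norm_add_mul {a b : ℝ} (ha : 0 ≤ a) (hb : 0 ≤ b) {w : ℂ} (hw : w ∈ wideSector) :
    (1 / 3) * (a + b * ‖w‖) ≤ ‖(a : ℂ) + b * w‖ := by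
  have h1 : -(3 / 4) * ‖w‖ ≤ w.re := hw
  have h2 := Complex.sq_norm w
  rw [Complex.normSq_apply] at h2
  refine abs_le_of_sq_le_sq' ?_ (norm_nonneg _) |>.2
  rw [Complex.sq_norm, Complex.normSq_apply]
  simp only [Complex.add_re, Complex.ofReal_re, Complex.re_ofReal_mul, Complex.add_im,
    Complex.ofReal_im, Complex.im_ofReal_mul, zero_add]
  have h3 : (a + b * w.re) * (a + b * w.re) + b * w.im * (b * w.im) =
      a ^ 2 + 2 * (a * b) * w.re + (b * ‖w‖) ^ 2 := by
    rw [mul_pow, h2]; ring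
  rw [h3]
  nlinarith [mul_le_mul_of_nonneg_left h1 (mul_nonneg ha hb), sq_nonneg (a - b * ‖w‖),
    mul_nonneg (mul_nonneg ha hb) (norm_nonneg w)]

lemma le_norm_cbfDenom {w : ℂ} (hw : w ∈ wideSector) (y : I) :
    (1 / 3) * (1 - (y : ℝ) + y * ‖w‖) ≤ ‖(1 : ℂ) - (y : ℝ) + (y : ℝ) * w‖ := by
  simpa using le_norm_add_mul (sub_nonneg.2 y.2.2) y.2.1 hw

lemma one_le_cbfDenom {r : ℝ} (hr : 1 ≤ r) (y : I) : 1 ≤ 1 - (y : ℝ) + y * r := by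
  nlinarith [y.2.1]

lemma ofReal_mem_wideSector {r : ℝ} (hr : 0 ≤ r) : (r : ℂ) ∈ wideSector := by
  simp only [wideSector, mem_ofPred_eq, Complex.norm_real, Complex.ofReal_re, Real.norm_eq_abs,
    abs_of_nonneg hr]
  linarith

lemma wideSector_mem_slitPlane {w : ℂ} (hw : w ∈ wideSector) (h0 : w ≠ 0) : w ∈ slitPlane := by
  rw [Complex.mem_slitPlane_iff_not_le_zero]
  intro hle
  rw [Complex.le_def] at hle
  simp only [Complex.zero_re, Complex.zero_im] at hle
  have h1 : w = (w.re : ℂ) := Complex.ext rfl (by simp [hle.2])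
  have h2 : -(3 / 4) * ‖w‖ ≤ w.re := hw
  have h3 : 0 < ‖w‖ := norm_pos_iff.2 h0
  rw [h1, Complex.norm_real, Real.norm_eq_abs, abs_of_nonpos hle.1] at h2 h3
  rw [Complex.ofReal_re] at h2
  linarith

lemma cbfTransform_div (ρ : Measure I) {w : ℂ} (hw : w ≠ 0) :
    cbfTransform ρ w / w = ∫ y : I, (1 - (y : ℝ) + (y : ℝ) * w)⁻¹ ∂ρ := by
  rw [cbfTransform, ← integral_div]
  congr 1
  ext y
  rw [cbfKernel, div_div, mul_comm, ← div_div, div_self hw, one_div]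

/-- The ratio `cbfTransform ρ w / w` tends to the mass of `{0}` at infinity. -/
lemma tendsto_cbfTransform_div (ρ : Measure I) [IsFiniteMeasure ρ] :
    Tendsto (fun w ↦ cbfTransform ρ w / w) (Bornology.cobounded ℂ ⊓ 𝓟 wideSector)
      (𝓝 (ρ.real {0})) := by
  set l := Bornology.cobounded ℂ ⊓ 𝓟 wideSector with hl
  have hcg : l.IsCountablyGenerated := by
    rw [hl, ← comap_norm_atTop]
    infer_instance
  have hnorm : Tendsto (fun w : ℂ ↦ ‖w‖) l atTop :=
    tendsto_norm_cobounded_atTop.mono_left inf_le_left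
  have hsec : ∀ᶠ w in l, w ∈ wideSector := mem_inf_of_right (mem_principal_self _)
  have hone : ∀ᶠ w in l, 1 ≤ ‖w‖ := hnorm.eventually_ge_atTop 1
  have h1 : Tendsto (fun w : ℂ ↦ ∫ y : I, (1 - (y : ℝ) + (y : ℝ) * w)⁻¹ ∂ρ) l
      (𝓝 (∫ y : I, ({0} : Set I).indicator (fun _ ↦ (1 : ℂ)) y ∂ρ)) := by
    refine tendsto_integral_filter_of_dominated_convergence (fun _ ↦ 3)
      (.of_forall fun w ↦ Measurable.aestronglyMeasurable (by fun_prop)) ?_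
      (integrable_const _) (.of_forall fun y ↦ ?_)
    · filter_upwards [hsec, hone] with w hw hw1
      refine .of_forall fun y ↦ ?_
      rw [norm_inv]
      have := le_norm_cbfDenom hw y
      have := one_le_cbfDenom hw1 y
      exact inv_le_of_inv_le₀ (by norm_num) (by linarith)
    · by_cases hy : y = 0
      · subst hy
        simpa using tendsto_const_nhds
      · rw [indicator_of_notMem (by simpa using hy)]
        have hy0 : 0 < (y : ℝ) := lt_of_le_of_ne y.2.1 fun h ↦ hy (Subtype.ext h.symm)
        rw [tendsto_zero_iff_norm_tendsto_zero]
        refine squeeze_zero' (.of_forall fun _ ↦ norm_nonneg _) (g := fun w ↦ 3 / y / ‖w‖) ?_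
          (hnorm.const_div_atTop _)
        filter_upwards [hsec, hone] with w hw hw1
        rw [norm_inv, div_div, inv_eq_one_div, div_le_div_iff₀ ?_ (by positivity)]
        · have := le_norm_cbfDenom hw y
          have := y.2.2
          linarith
        · have := le_norm_cbfDenom hw y
          have := one_le_cbfDenom hw1 y
          linarith
  rw [integral_indicator_const _ (measurableSet_singleton _)] at h1
  refine (by simpa using h1 : Tendsto _ l (𝓝 (ρ.real {0} : ℂ))).congr' ?_
  filter_upwards [hone] with w hw
  exact (cbfTransform_div ρ (norm_pos_iff.1 (by linarith))).symm

/-- Controls the total mass by the value at a single non-real point. For `D = 1 - y + y w` the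
imaginary part of `(w - 1) / D` is `Im w / |D|²`, of constant sign in `y`, and `|D| ≤ 1 + |w|`. -/
lemma abs_im_mul_mass_le (ρ : Measure I) [IsFiniteMeasure ρ] {w : ℂ} (hw : w ∈ slitPlane) :
    |w.im| * ρ.real univ ≤ (1 + ‖w‖) ^ 2 * ‖cbfTransform ρ w - cbfTransform ρ w / w‖ := by
  have hw0 := Complex.slitPlane_ne_zero hw
  have hDc : Continuous fun y : I ↦ (1 : ℂ) - (y : ℝ) + (y : ℝ) * w := by fun_prop
  have hNpos (y : I) : 0 < Complex.normSq (1 - (y : ℝ) + (y : ℝ) * w) :=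
    Complex.normSq_pos.2 (cbfDenom_ne_zero hw y)
  have hNc : Continuous fun y : I ↦ (Complex.normSq (1 - (y : ℝ) + (y : ℝ) * w))⁻¹ :=
    (Complex.continuous_normSq.comp hDc).inv₀ fun y ↦ (hNpos y).ne'
  have i1 : Integrable (fun y : I ↦ (1 - (y : ℝ) + (y : ℝ) * w)⁻¹) ρ :=
    integrable_of_continuous (hDc.inv₀ (cbfDenom_ne_zero hw))
  have e1 : cbfTransform ρ w - cbfTransform ρ w / w =
      ∫ y : I, (cbfKernel w y - (1 - (y : ℝ) + (y : ℝ) * w)⁻¹) ∂ρ := by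
    rw [cbfTransform_div ρ hw0, integral_sub (integrable_cbfKernel hw) i1, cbfTransform]
  have e2 : (cbfTransform ρ w - cbfTransform ρ w / w).im =
      w.im * ∫ y : I, (Complex.normSq (1 - (y : ℝ) + (y : ℝ) * w))⁻¹ ∂ρ := by
    have := Complex.imCLM.integral_comp_comm ((integrable_cbfKernel hw).sub i1)
    simp only [Complex.imCLM_apply] at this
    rw [e1, ← integral_const_mul]
    refine this.symm.trans (integral_congr_ae (.of_forall fun y ↦ ?_))
    have h1 := (hNpos y).ne'
    simp only [Pi.sub_apply, cbfKernel, Complex.sub_im, Complex.div_im, Complex.inv_im]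
    field_simp
    simp
    ring
  have e3 : ((1 + ‖w‖) ^ 2)⁻¹ * ρ.real univ ≤
      ∫ y : I, (Complex.normSq (1 - (y : ℝ) + (y : ℝ) * w))⁻¹ ∂ρ := by
    have : ∫ _ : I, ((1 + ‖w‖) ^ 2)⁻¹ ∂ρ ≤
        ∫ y : I, (Complex.normSq (1 - (y : ℝ) + (y : ℝ) * w))⁻¹ ∂ρ := by
      refine integral_mono (integrable_const _) (integrable_of_continuous hNc) fun y ↦ ?_
      refine inv_anti₀ (hNpos y) ?_
      rw [Complex.normSq_eq_norm_sq]
      gcongr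
      refine (norm_add_le _ _).trans (add_le_add ?_ ?_)
      · have : (1 : ℂ) - (y : ℝ) = ((1 - y : ℝ) : ℂ) := by simp
        rw [this, Complex.norm_real, Real.norm_of_nonneg (sub_nonneg.2 y.2.2)]
        linarith [y.2.1]
      · rw [norm_mul, Complex.norm_real, Real.norm_of_nonneg y.2.1]
        exact mul_le_of_le_one_left (norm_nonneg _) y.2.2
    simpa [mul_comm] using this
  have h4 := Complex.abs_im_le_norm (cbfTransform ρ w - cbfTransform ρ w / w)
  rw [e2, abs_mul] at h4
  have h5 := (mul_le_mul_of_nonneg_left (e3.trans (le_abs_self _)) (abs_nonneg w.im)).trans h4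
  have h6 : 0 < (1 + ‖w‖) ^ 2 := by positivity
  calc |w.im| * ρ.real univ = (1 + ‖w‖) ^ 2 * (|w.im| * (((1 + ‖w‖) ^ 2)⁻¹ * ρ.real univ)) := by
        field_simp
    _ ≤ _ := mul_le_mul_of_nonneg_left h5 h6.le

/-! ### From convolution powers to the integral representation -/

lemma neg_mem_slitPlane_of_im_pos {z : ℂ} (hz : 0 < z.im) : -z ∈ slitPlane := by
  rw [Complex.mem_slitPlane_iff]
  right
  simpa using hz.ne'

lemma IsConeFun.const_mul {f : ℂ → ℂ} (hf : IsConeFun f) {c : ℝ} (hc : 0 ≤ c) :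
    IsConeFun fun w ↦ c * f w := by
  refine ⟨hf.differentiableOn.const_mul _, fun w hw ↦ ?_⟩
  obtain ⟨a, b, ha, hb, h⟩ := hf.cone w hw
  exact ⟨c * a, c * b, by positivity, by positivity, by rw [h]; push_cast; ring⟩

/-- The cone on which `φ` inverts `F_χ` may depend on `χ`. The identity theorem carries the relation
to any cone where `φ` is analytic and `z + φ z` stays in the upper half-plane, so one cone serves a
whole sequence of convolution powers. -/
lemma reciprocalCauchy_eqOn {χ : ProbabilityMeasure ℝ} {φ : ℂ → ℂ}
    (h : IsVoiculescuTransform χ φ) {α M : ℝ} (hα : 0 < α) (hM : 0 < M)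
    (han : AnalyticOnNhd ℂ φ (truncatedCone α M))
    (him : ∀ z ∈ truncatedCone α M, 0 < (z + φ z).im) :
    ∀ z ∈ truncatedCone α M, reciprocalCauchy χ (z + φ z) = z := by
  obtain ⟨α₁, M₁, hα₁, hM₁, -, hinv, -⟩ := h
  have hpsi : AnalyticOnNhd ℂ (fun z ↦ z + φ z) (truncatedCone α M) :=
    analyticOnNhd_id.add han
  have hmaps : MapsTo (fun z ↦ z + φ z) (truncatedCone α M) upperHalf := fun z hz ↦ him z hz
  have hL : AnalyticOnNhd ℂ (fun z ↦ cauchyTransform χ (z + φ z) * z) (truncatedCone α M) :=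
    ((analyticOnNhd_cauchyTransform χ).comp hpsi hmaps).mul analyticOnNhd_id
  set M' := max M M₁ with hM'
  have hM'0 : 0 < M' := hM.trans_le (le_max_left _ _)
  set z₀ : ℂ := ((M' + 1 : ℝ) : ℂ) * Complex.I with hz₀
  have hz₀m : z₀ ∈ truncatedCone (min α α₁) M' :=
    mul_I_mem_truncatedCone (lt_min hα hα₁) hM'0.le (by linarith)
  have hs : truncatedCone (min α α₁) M' ⊆ truncatedCone α M :=
    truncatedCone_mono (min_le_left _ _) (le_max_left _ _) hM'0.le
  have hs₁ : truncatedCone (min α α₁) M' ⊆ truncatedCone α₁ M₁ :=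
    truncatedCone_mono (min_le_right _ _) (le_max_right _ _) hM'0.le
  have key := hL.eqOn_of_preconnected_of_eventuallyEq
    (g := fun _ ↦ (1 : ℂ)) (fun z _ ↦ analyticAt_const) (convex_truncatedCone α M).isPreconnected
    (hs hz₀m) ?_
  · intro z hz
    have := key hz
    simp only at this
    rw [reciprocalCauchy]
    exact (eq_one_div_of_mul_eq_one_right this).symm
  · filter_upwards [(isOpen_truncatedCone _ _).mem_nhds hz₀m] with z hz
    have h1 := (hinv z (hs₁ hz)).2
    have h2 : z ≠ 0 := fun h ↦ by
      have := im_pos_of_mem_truncatedCone hM'0.le hz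
      simp [h] at this
    rw [cauchyTransform_of_reciprocalCauchy_eq h1, inv_mul_cancel₀ h2]

/-- If all convolution powers of `μ` live on the positive half-axis, the Voiculescu transform has
the integral representation of a complete Bernstein function. -/
theorem exists_cbfTransform_isVoiculescuTransform {μ : ProbabilityMeasure ℝ}
    (h : ∀ t : ℝ, 0 < t → ∃ χ, IsFreeConvPower μ t χ ∧ (χ : Measure ℝ) (Iio 0) = 0) :
    ∃ ρ : Measure I, IsFiniteMeasure ρ ∧ ρ {0} = 0 ∧
      IsVoiculescuTransform μ fun z ↦ cbfTransform ρ (-z) := by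
  obtain ⟨χ₁, ⟨φ, hφ, -⟩, -⟩ := h 1 one_pos
  obtain ⟨α, M, hα, hM, han, hinv, ht⟩ := id hφ
  set t : ℕ → ℝ := fun n ↦ 1 / ((n : ℝ) + 1) with htdef
  have ht0 (n : ℕ) : 0 < t n := by positivity
  have ht1 (n : ℕ) : t n ≤ 1 := by
    rw [htdef]
    simp only
    rw [div_le_one (by positivity)]
    linarith [(Nat.cast_nonneg n : (0 : ℝ) ≤ n)]
  have htt : Tendsto t atTop (𝓝 0) := tendsto_one_div_add_atTop_nhds_zero_nat
  have hχ (n : ℕ) : ∃ χ : ProbabilityMeasure ℝ, (χ : Measure ℝ) (Iio 0) = 0 ∧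
      ∀ z ∈ truncatedCone α M, 0 < (z + t n * φ z).im ∧
        reciprocalCauchy χ (z + t n * φ z) = z := by
    obtain ⟨χ, ⟨φ', hφ', hχ⟩, hχ0⟩ := h (t n) (ht0 n)
    obtain ⟨α', M', hα', -, he⟩ := hφ'.exists_eqOn hφ
    have hχφ : IsVoiculescuTransform χ fun z ↦ (t n : ℂ) * φ z :=
      hχ.congr (M := M') hα' fun z hz ↦ by simp only [he hz]
    -- For `t ≤ 1` the point `z + t φ z` is a convex combination of `z` and `z + φ z`.
    have him : ∀ z ∈ truncatedCone α M, 0 < (z + t n * φ z).im := fun z hz ↦ by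
      have h1 := (hinv z hz).1
      have h2 := im_pos_of_mem_truncatedCone hM.le hz
      simp only [Complex.add_im, Complex.im_ofReal_mul] at h1 ⊢
      nlinarith [ht0 n, ht1 n]
    exact ⟨χ, hχ0, fun z hz ↦ ⟨him z hz, reciprocalCauchy_eqOn hχφ hα hM
      (analyticOnNhd_const.mul han) him z hz⟩⟩
  choose χ hχ0 hχ using hχ
  choose ρ hρ hrep using fun n ↦ ((isConeFun_neg_reciprocalCauchy_neg_sub (hχ0 n)).const_mul
    (c := (n : ℝ) + 1) (by positivity)).exists_eqOn_cbfTransform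
  -- The cone function is `-F_χ(-w) - w`; at `w = -(z + t φ z)` it is `-z + (z + t φ z) = t φ z`,
  -- and the factor `n + 1 = 1 / t` leaves `φ z`.
  have hval (n : ℕ) (z : ℂ) (hz : z ∈ truncatedCone α M) :
      cbfTransform (ρ n) (-(z + t n * φ z)) = φ z := by
    rw [← hrep n (neg_mem_slitPlane_of_im_pos (hχ n z hz).1)]
    simp only [neg_neg]
    rw [(hχ n z hz).2]
    have : (n : ℂ) + 1 ≠ 0 := by exact_mod_cast n.succ_ne_zero
    simp only [htdef]
    push_cast
    field_simp
    ring
  have hlim (z : ℂ) : Tendsto (fun n ↦ -(z + t n * φ z)) atTop (𝓝 (-z)) := by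
    have := ((Complex.continuous_ofReal.tendsto _).comp htt).mul_const (φ z)
    have := (this.const_add z).neg
    simpa using this
  set z₀ : ℂ := ((M + 1 : ℝ) : ℂ) * Complex.I with hz₀
  have hz₀m : z₀ ∈ truncatedCone α M := mul_I_mem_truncatedCone hα hM.le (by linarith)
  have hz₀im : 0 < z₀.im := im_pos_of_mem_truncatedCone hM.le hz₀m
  have hz₀ne : z₀ ≠ 0 := fun h ↦ by simp [h] at hz₀im
  -- The values at the moving points all equal `φ z₀` and the points converge to the non-real `-z₀`,
  -- so the one-point mass estimate is uniform in `n`.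
  obtain ⟨C, hC⟩ : ∃ C, ∀ n, (ρ n).real univ ≤ C := by
    set w : ℕ → ℂ := fun n ↦ -(z₀ + t n * φ z₀) with hw
    have hb : Tendsto (fun n ↦ (1 + ‖w n‖) ^ 2 * ‖φ z₀ - φ z₀ / w n‖ / |(w n).im|) atTop
        (𝓝 ((1 + ‖-z₀‖) ^ 2 * ‖φ z₀ - φ z₀ / (-z₀)‖ / |(-z₀).im|)) := by
      have hl := hlim z₀
      refine Tendsto.div (((hl.norm.const_add 1).pow 2).mul
        (((tendsto_const_nhds.div hl (neg_ne_zero.2 hz₀ne)).const_sub _).norm))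
        ((Complex.continuous_im.tendsto _).comp hl).abs ?_
      simpa using hz₀im.ne'
    obtain ⟨C, hC⟩ := hb.bddAbove_range
    refine ⟨C, fun n ↦ le_trans ?_ (hC ⟨n, rfl⟩)⟩
    have him := (hχ n z₀ hz₀m).1
    have h1 := abs_im_mul_mass_le (ρ n) (neg_mem_slitPlane_of_im_pos him)
    rw [hval n z₀ hz₀m] at h1
    rw [le_div_iff₀ (by rw [abs_pos, hw, Complex.neg_im]; exact neg_ne_zero.2 him.ne'), mul_comm]
    exact h1
  obtain ⟨ρ', hρ', hρlim⟩ := exists_cbfTransform_eq_of_tendsto hC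
  have heq : ∀ z ∈ truncatedCone α M, cbfTransform ρ' (-z) = φ z := fun z hz ↦
    hρlim _ (-z) (φ z) (fun n ↦ neg_mem_slitPlane_of_im_pos (hχ n z hz).1)
      (neg_mem_slitPlane_of_im_pos (im_pos_of_mem_truncatedCone hM.le hz)) (hlim z)
      (tendsto_const_nhds.congr fun n ↦ (hval n z hz).symm)
  refine ⟨ρ', hρ', ?_, hφ.congr hα fun z hz ↦ (heq z hz).symm⟩
  -- Along the imaginary axis `φ z / z → 0`, whereas the ratio of the transform to its argument
  -- tends to the mass at `0`.
  have hI : Tendsto (fun n : ℕ ↦ ((M + 1 + n : ℝ) : ℂ) * Complex.I) atTop (coneFilter α M) := by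
    refine tendsto_inf.2 ⟨?_, tendsto_principal.2 (.of_forall fun n ↦
      mul_I_mem_truncatedCone hα hM.le (by linarith [(Nat.cast_nonneg n : (0 : ℝ) ≤ n)]))⟩
    rw [← tendsto_norm_atTop_iff_cobounded]
    have : Tendsto (fun n : ℕ ↦ M + 1 + (n : ℝ)) atTop atTop :=
      tendsto_atTop_add_const_left _ _ tendsto_natCast_atTop_atTop
    refine this.congr fun n ↦ ?_
    rw [norm_mul, Complex.norm_I, mul_one, Complex.norm_real, Real.norm_of_nonneg (by positivity)]
  have hIneg : Tendsto (fun n : ℕ ↦ -(((M + 1 + n : ℝ) : ℂ) * Complex.I)) atTop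
      (Bornology.cobounded ℂ ⊓ 𝓟 wideSector) := by
    refine tendsto_inf.2 ⟨?_, tendsto_principal.2 (.of_forall fun n ↦ ?_)⟩
    · have := (tendsto_inf.1 hI).1
      rw [← tendsto_norm_atTop_iff_cobounded] at this ⊢
      simpa only [norm_neg] using this
    · simp [wideSector]
  have l1 := (tendsto_cbfTransform_div ρ').comp hIneg
  have l2 := (ht.comp hI).sub_const 1
  rw [sub_self] at l2
  have l3 : Tendsto (fun n : ℕ ↦ cbfTransform ρ' (-(((M + 1 + n : ℝ) : ℂ) * Complex.I)) /
      (-(((M + 1 + n : ℝ) : ℂ) * Complex.I))) atTop (𝓝 0) := by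
    rw [← neg_zero]
    refine l2.neg.congr fun n ↦ ?_
    have hm : ((M + 1 + n : ℝ) : ℂ) * Complex.I ∈ truncatedCone α M :=
      mul_I_mem_truncatedCone hα hM.le (by linarith [(Nat.cast_nonneg n : (0 : ℝ) ≤ n)])
    have hne : ((M + 1 + n : ℝ) : ℂ) * Complex.I ≠ 0 := fun h ↦ by
      have := im_pos_of_mem_truncatedCone hM.le hm
      rw [h, Complex.zero_im] at this
      exact this.false
    simp only [Function.comp]
    rw [heq _ hm]
    generalize ((M + 1 + n : ℝ) : ℂ) * Complex.I = z at hne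
    field_simp
    ring
  have l4 : ((ρ'.real {0} : ℝ) : ℂ) = 0 := tendsto_nhds_unique l1 l3
  have l5 : ρ'.real {0} = 0 := by exact_mod_cast l4
  exact (measureReal_eq_zero_iff (by finiteness)).1 l5

end FreeRegular

namespace FreeRegular

open Complex (slitPlane)
open unitInterval

/-! ### Existence of the measure with a given Voiculescu transform -/

/-- The iterates solving `Ψ w = w + f (Ψ w)`. -/
noncomputable def iterSolution (f : ℂ → ℂ) : ℕ → ℂ → ℂ
  | 0, w => w
  | k + 1, w => w + f (iterSolution f k w)

/-- If the iterate is `a + b w` and `f` maps it to `a' + b' (a + b w)`, the next one is `(a' + b' a)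
+ (1 + b' b) w`. The bound `b ≥ 1` keeps iterates in the slit plane and later bounds the masses. -/
lemma iterSolution_cone {f : ℂ → ℂ} (hf : IsConeFun f) (k : ℕ) {w : ℂ} (hw : w ∈ slitPlane) :
    ∃ a b : ℝ, 0 ≤ a ∧ 1 ≤ b ∧ iterSolution f k w = a + b * w := by
  induction k with
  | zero => exact ⟨0, 1, le_rfl, le_rfl, by simp [iterSolution]⟩
  | succ k ih =>
    obtain ⟨a, b, ha, hb, h⟩ := ih
    have hm := add_mul_mem_slitPlane ha (zero_le_one.trans hb) (by linarith) hw
    obtain ⟨a', b', ha', hb', h'⟩ := hf.cone _ hm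
    refine ⟨a' + b' * a, 1 + b' * b, by positivity, ?_, ?_⟩
    · nlinarith
    · rw [iterSolution, h, h']
      push_cast
      ring

lemma iterSolution_mem {f : ℂ → ℂ} (hf : IsConeFun f) (k : ℕ) {w : ℂ} (hw : w ∈ slitPlane) :
    iterSolution f k w ∈ slitPlane := by
  obtain ⟨a, b, ha, hb, h⟩ := iterSolution_cone hf k hw
  rw [h]
  exact add_mul_mem_slitPlane ha (zero_le_one.trans hb) (by linarith) hw

lemma differentiableOn_iterSolution {f : ℂ → ℂ} (hf : IsConeFun f) (k : ℕ) :
    DifferentiableOn ℂ (iterSolution f k) slitPlane := by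
  induction k with
  | zero => exact differentiableOn_id
  | succ k ih =>
    exact differentiableOn_id.add (hf.differentiableOn.comp ih fun w hw ↦ iterSolution_mem hf k hw)

/-- For real `a`, `b`, multiplying by the conjugate gives `w / (a + b w) = (b |w|² + a w) / |a + b
w|²`. -/
lemma isConeFun_div_iterSolution {f : ℂ → ℂ} (hf : IsConeFun f) (k : ℕ) :
    IsConeFun fun w ↦ w / iterSolution f k w := by
  refine ⟨differentiableOn_id.div (differentiableOn_iterSolution hf k) fun w hw ↦
    Complex.slitPlane_ne_zero (iterSolution_mem hf k hw), fun w hw ↦ ?_⟩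
  have hne := Complex.slitPlane_ne_zero (iterSolution_mem hf k hw)
  obtain ⟨a, b, ha, hb, h⟩ := iterSolution_cone hf k hw
  set D := iterSolution f k w
  have hN : 0 < Complex.normSq D := Complex.normSq_pos.2 hne
  have hw2 := Complex.normSq_nonneg w
  refine ⟨b * Complex.normSq w / Complex.normSq D, a / Complex.normSq D, by positivity,
    by positivity, ?_⟩
  rw [div_eq_mul_inv, Complex.inv_def, h]
  push_cast
  rw [Complex.normSq_eq_conj_mul_self (z := w)]
  simp only [map_add, map_mul, Complex.conj_ofReal]
  ring

section

variable {ρ : Measure I} [IsFiniteMeasure ρ]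

lemma integrable_inv_cbfDenom {r : ℝ} (hr : 0 < r) :
    Integrable (fun y : I ↦ (1 - (y : ℝ) + y * r)⁻¹) ρ :=
  integrable_of_continuous (Continuous.inv₀ (by fun_prop) fun y ↦ (cbfDenom_pos hr y).ne')

/-- For `r > 0` this average is `f r / r` with `f = cbfTransform ρ`. It governs both the size and
the Lipschitz constant of `f` at modulus `r`, so its decay provides a contraction far out. -/
lemma tendsto_integral_inv_cbfDenom (h0 : ρ {0} = 0) :
    Tendsto (fun r : ℝ ↦ ∫ y : I, (1 - (y : ℝ) + y * r)⁻¹ ∂ρ) atTop (𝓝 0) := by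
  have h1 : Tendsto (fun r : ℝ ↦ (r : ℂ)) atTop (Bornology.cobounded ℂ ⊓ 𝓟 wideSector) := by
    refine tendsto_inf.2 ⟨?_, tendsto_principal.2 ?_⟩
    · rw [← tendsto_norm_atTop_iff_cobounded]
      simpa using tendsto_abs_atTop_atTop
    · filter_upwards [eventually_ge_atTop 0] with r hr using ofReal_mem_wideSector hr
  have h2 := (Complex.continuous_re.tendsto _).comp ((tendsto_cbfTransform_div ρ).comp h1)
  have h3 : ρ.real {0} = 0 := by simp [Measure.real, h0]
  rw [h3] at h2
  simp only [Complex.ofReal_zero, Complex.zero_re] at h2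
  refine h2.congr' ?_
  filter_upwards [eventually_gt_atTop 0] with r hr
  simp only [Function.comp]
  rw [cbfTransform_div ρ (by exact_mod_cast hr.ne')]
  have : ∀ y : I, ((1 : ℂ) - (y : ℝ) + (y : ℝ) * (r : ℂ))⁻¹ =
      (((1 - (y : ℝ) + y * r)⁻¹ : ℝ) : ℂ) := fun y ↦ by push_cast; rfl
  simp_rw [this]
  rw [integral_complex_ofReal, Complex.ofReal_re]

lemma norm_cbfTransform_le {v : ℂ} (hv : v ∈ wideSector) (h0 : v ≠ 0) :
    ‖cbfTransform ρ v‖ ≤ 3 * ‖v‖ * ∫ y : I, (1 - (y : ℝ) + y * ‖v‖)⁻¹ ∂ρ := by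
  have hpos : 0 < ‖v‖ := norm_pos_iff.2 h0
  have h1 : cbfTransform ρ v = v * ∫ y : I, (1 - (y : ℝ) + (y : ℝ) * v)⁻¹ ∂ρ := by
    rw [← cbfTransform_div ρ h0]
    field_simp
  rw [h1, norm_mul, mul_assoc, mul_left_comm, ← integral_const_mul]
  gcongr
  refine norm_integral_le_of_norm_le ((integrable_inv_cbfDenom hpos).const_mul 3)
    (.of_forall fun y ↦ ?_)
  have h2 := le_norm_cbfDenom hv y
  have h3 := cbfDenom_pos hpos y
  rw [norm_inv]
  calc ‖(1 : ℂ) - (y : ℝ) + (y : ℝ) * v‖⁻¹ ≤ ((1 / 3) * (1 - (y : ℝ) + y * ‖v‖))⁻¹ :=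
        inv_anti₀ (by positivity) h2
    _ = 3 * (1 - (y : ℝ) + y * ‖v‖)⁻¹ := by rw [mul_inv]; norm_num

/-- A point `v' = -s` on the removed ray has `|v' - v| = |s + v| ≥ (s + |v|) / 3`, too far from `v`.
-/
lemma mem_slitPlane_of_norm_sub_le {v v' : ℂ} (hv : v ∈ wideSector) (h0 : v ≠ 0)
    (h : ‖v' - v‖ ≤ 3 / 100 * ‖v‖) : v' ∈ slitPlane := by
  have hpos : 0 < ‖v‖ := norm_pos_iff.2 h0
  rw [Complex.mem_slitPlane_iff_not_le_zero]
  intro hle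
  rw [Complex.le_def] at hle
  simp only [Complex.zero_re, Complex.zero_im] at hle
  have h1 : v' = -((-v'.re : ℝ) : ℂ) := Complex.ext (by simp) (by simp [hle.2])
  have h2 := le_norm_add_mul (neg_nonneg.2 hle.1) zero_le_one hv
  have h3 : ‖v' - v‖ = ‖((-v'.re : ℝ) : ℂ) + ((1 : ℝ) : ℂ) * v‖ := by
    conv_lhs => rw [h1]
    rw [← norm_neg]
    congr 1
    push_cast
    ring
  rw [← h3] at h2
  linarith [hle.1]

lemma norm_cbfTransform_sub_le {v v' : ℂ} (hv : v ∈ wideSector) (h1 : 1 ≤ ‖v‖)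
    (h : ‖v' - v‖ ≤ 3 / 100 * ‖v‖) :
    ‖cbfTransform ρ v' - cbfTransform ρ v‖ ≤
      12 * (∫ y : I, (1 - (y : ℝ) + y * ‖v‖)⁻¹ ∂ρ) * ‖v' - v‖ := by
  have hpos : 0 < ‖v‖ := by linarith
  have h0 : v ≠ 0 := norm_pos_iff.1 hpos
  have hv' := mem_slitPlane_of_norm_sub_le hv h0 h
  have hvs := wideSector_mem_slitPlane hv h0
  rw [cbfTransform, cbfTransform, ← integral_sub (integrable_cbfKernel hv')
    (integrable_cbfKernel hvs), ← integral_const_mul, ← integral_mul_const]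
  refine norm_integral_le_of_norm_le (((integrable_inv_cbfDenom hpos).const_mul 12).mul_const _)
    (.of_forall fun y ↦ ?_)
  set D : ℂ := 1 - (y : ℝ) + (y : ℝ) * v with hD
  set D' : ℂ := 1 - (y : ℝ) + (y : ℝ) * v' with hD'
  set d : ℝ := 1 - (y : ℝ) + y * ‖v‖ with hd
  have hD0 : D ≠ 0 := cbfDenom_ne_zero hvs y
  have hD'0 : D' ≠ 0 := cbfDenom_ne_zero hv' y
  have e1 : cbfKernel v' y - cbfKernel v y = (1 - (y : ℝ)) * (v' - v) / (D * D') := by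
    rw [cbfKernel, cbfKernel, ← hD, ← hD']
    field_simp
    rw [hD, hD']
    ring
  have hd1 : 1 ≤ d := one_le_cbfDenom h1 y
  have e2 : (1 / 3) * d ≤ ‖D‖ := le_norm_cbfDenom hv y
  have e3 : (1 / 4) * d ≤ ‖D'‖ := by
    have h3 : ‖D' - D‖ ≤ 3 / 100 * d := by
      have : D' - D = (y : ℝ) * (v' - v) := by rw [hD, hD']; ring
      rw [this, norm_mul, Complex.norm_real, Real.norm_of_nonneg y.2.1]
      have := mul_le_mul_of_nonneg_left h y.2.1
      have := y.2.2
      rw [hd]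
      linarith
    have h4 := norm_sub_le D' (D' - D)
    rw [sub_sub_cancel] at h4
    linarith
  rw [e1, norm_div, norm_mul, norm_mul]
  have e4 : ‖(1 : ℂ) - (y : ℝ)‖ ≤ 1 := by
    have : (1 : ℂ) - (y : ℝ) = ((1 - y : ℝ) : ℂ) := by simp
    rw [this, Complex.norm_real, Real.norm_of_nonneg (sub_nonneg.2 y.2.2)]
    linarith [y.2.1]
  -- The product of the two lower bounds is `d² / 12`; since `d ≥ 1` one factor `d` can be dropped,
  -- leaving the average of `1 / d`.
  have e5 : 1 / 12 * d ≤ ‖D‖ * ‖D'‖ := by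
    calc 1 / 12 * d ≤ ((1 / 3) * d) * ((1 / 4) * d) := by nlinarith
      _ ≤ ‖D‖ * ‖D'‖ := by gcongr
  calc ‖(1 : ℂ) - (y : ℝ)‖ * ‖v' - v‖ / (‖D‖ * ‖D'‖) ≤ 1 * ‖v' - v‖ / (1 / 12 * d) := by gcongr
    _ = 12 * d⁻¹ * ‖v' - v‖ := by field_simp

/-- Where `ρ`-averages are small the iterates converge to the solution. -/
lemma tendsto_iterSolution {v : ℂ} (hv : v ∈ wideSector) (h1 : 1 ≤ ‖v‖)
    (hm : ∫ y : I, (1 - (y : ℝ) + y * ‖v‖)⁻¹ ∂ρ ≤ 1 / 100) :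
    v - cbfTransform ρ v ∈ slitPlane ∧
    Tendsto (fun k ↦ iterSolution (cbfTransform ρ) k (v - cbfTransform ρ v)) atTop (𝓝 v) := by
  have hpos : 0 < ‖v‖ := by linarith
  have h0 : v ≠ 0 := norm_pos_iff.1 hpos
  have hf : ‖cbfTransform ρ v‖ ≤ 3 / 100 * ‖v‖ := by
    refine (norm_cbfTransform_le hv h0).trans ?_
    nlinarith
  set w := v - cbfTransform ρ v with hw
  have hwv : ‖w - v‖ ≤ 3 / 100 * ‖v‖ := by
    rw [hw, sub_sub_cancel_left, norm_neg]
    exact hf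
  refine ⟨mem_slitPlane_of_norm_sub_le hv h0 hwv, ?_⟩
  -- The Lipschitz factor is at most `12 / 100 < 1 / 2`, and the contraction keeps every iterate
  -- inside the ball of radius `3/100 * ‖v‖` where the estimate is valid.
  have key (k : ℕ) : ‖iterSolution (cbfTransform ρ) k w - v‖ ≤ (1 / 2) ^ k * (3 / 100 * ‖v‖) := by
    induction k with
    | zero => simpa [iterSolution] using hwv
    | succ k ih =>
      have hle : ‖iterSolution (cbfTransform ρ) k w - v‖ ≤ 3 / 100 * ‖v‖ :=
        ih.trans (mul_le_of_le_one_left (by positivity) (pow_le_one₀ (by norm_num) (by norm_num)))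
      have h2 := norm_cbfTransform_sub_le (ρ := ρ) hv h1 hle
      have h3 : iterSolution (cbfTransform ρ) (k + 1) w - v =
          cbfTransform ρ (iterSolution (cbfTransform ρ) k w) - cbfTransform ρ v := by
        rw [iterSolution, hw]
        ring
      rw [h3]
      refine h2.trans ?_
      calc 12 * (∫ y : I, (1 - (y : ℝ) + y * ‖v‖)⁻¹ ∂ρ) *
            ‖iterSolution (cbfTransform ρ) k w - v‖
          ≤ 12 * (1 / 100) * ((1 / 2) ^ k * (3 / 100 * ‖v‖)) := by gcongr
        _ ≤ (1 / 2) ^ (k + 1) * (3 / 100 * ‖v‖) := by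
          rw [pow_succ]
          nlinarith [pow_pos (by norm_num : (0 : ℝ) < 1 / 2) k,
            mul_pos (pow_pos (by norm_num : (0 : ℝ) < 1 / 2) k) hpos]
  rw [tendsto_iff_norm_sub_tendsto_zero]
  refine squeeze_zero (fun _ ↦ norm_nonneg _) key ?_
  simpa using (tendsto_pow_atTop_nhds_zero_of_lt_one (by norm_num : (0 : ℝ) ≤ 1 / 2)
    (by norm_num)).mul_const (3 / 100 * ‖v‖)

/-- The limit of the cone functions `w / Ψ_k w`. Their masses are their values `1 / (a + b) ≤ 1` at
`w = 1`, and at `w = v - f v` the iterates converge to `v`. -/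
lemma exists_measure_eq_div :
    ∃ ρ' : Measure I, IsFiniteMeasure ρ' ∧ ∀ v ∈ wideSector, 1 ≤ ‖v‖ →
      ∫ y : I, (1 - (y : ℝ) + y * ‖v‖)⁻¹ ∂ρ ≤ 1 / 100 →
      cbfTransform ρ' (v - cbfTransform ρ v) = (v - cbfTransform ρ v) / v := by
  have hf := isConeFun_cbfTransform ρ
  choose τ hτ hrep using fun k ↦ (isConeFun_div_iterSolution hf k).exists_eqOn_cbfTransform
  have hmass (k : ℕ) : (τ k).real univ ≤ 1 := by
    have h1 := hrep k Complex.one_mem_slitPlane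
    obtain ⟨a, b, ha, hb, h⟩ := iterSolution_cone hf k Complex.one_mem_slitPlane
    simp only at h1
    rw [cbfTransform_one, h, mul_one] at h1
    have h2 : (τ k).real univ = 1 / (a + b) := by
      have : ((1 / (a + b) : ℝ) : ℂ) = ((τ k).real univ : ℝ) := by rw [← h1]; push_cast; rfl
      exact_mod_cast this.symm
    rw [h2, div_le_one (by linarith)]
    linarith
  obtain ⟨ρ', hρ', hlim⟩ := exists_cbfTransform_eq_of_tendsto hmass
  refine ⟨ρ', hρ', fun v hv h1 hm ↦ ?_⟩
  obtain ⟨hw, ht⟩ := tendsto_iterSolution hv h1 hm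
  have h0 : v ≠ 0 := norm_pos_iff.1 (by linarith)
  refine hlim (fun _ ↦ v - cbfTransform ρ v) _ _ (fun _ ↦ hw) hw tendsto_const_nhds ?_
  exact (tendsto_const_nhds.div ht h0).congr fun k ↦ hrep k hw

/-- A measure whose transform is asymptotically `1` along the positive axis comes from a probability
measure on the positive half-axis. -/
lemma exists_probabilityMeasure {x : ℕ → ℝ} (hx0 : ∀ n, 0 < x n) (hx : Tendsto x atTop atTop)
    (h1 : Tendsto (fun n ↦ ∫ y : I, x n / (1 - (y : ℝ) + y * x n) ∂ρ) atTop (𝓝 1)) :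
    ∃ μ : ProbabilityMeasure ℝ, (μ : Measure ℝ) (Iio 0) = 0 ∧
      ∀ z : ℂ, 0 < z.im → cbfTransform ρ (-z) = z * cauchyTransform μ z := by
  set k : ℕ → I → ℝ≥0∞ := fun n y ↦ ENNReal.ofReal (x n / (1 - (y : ℝ) + y * x n)) with hk
  set J : I → ℝ≥0∞ := fun y ↦ (ENNReal.ofReal y)⁻¹ with hJ
  have hJm : Measurable J := by fun_prop
  have hkle (n : ℕ) (y : I) : k n y ≤ J y := by
    by_cases hy : (y : ℝ) = 0
    · simp [hJ, hy]
    · have hy0 : 0 < (y : ℝ) := lt_of_le_of_ne y.2.1 (Ne.symm hy)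
      simp only [hJ]
      rw [← ENNReal.ofReal_inv_of_pos hy0]
      refine ENNReal.ofReal_le_ofReal ?_
      rw [div_le_iff₀ (cbfDenom_pos (hx0 n) y), inv_mul_eq_div, le_div_iff₀ hy0]
      have := y.2.2
      linarith
  have hklim (y : I) : Tendsto (fun n ↦ k n y) atTop (𝓝 (J y)) := by
    by_cases hy : (y : ℝ) = 0
    · simp only [hk, hJ, hy]
      simpa using ENNReal.tendsto_ofReal_nhds_top.2 hx
    · have hy0 : 0 < (y : ℝ) := lt_of_le_of_ne y.2.1 (Ne.symm hy)
      simp only [hJ]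
      rw [← ENNReal.ofReal_inv_of_pos hy0]
      refine ENNReal.tendsto_ofReal ?_
      have h2 : Tendsto (fun n ↦ ((1 - (y : ℝ)) / x n + y)⁻¹) atTop (𝓝 (y : ℝ)⁻¹) := by
        have := (hx.const_div_atTop (1 - (y : ℝ))).add_const (y : ℝ)
        rw [zero_add] at this
        exact this.inv₀ hy
      refine h2.congr fun n ↦ ?_
      have := (hx0 n).ne'
      field_simp
  have hint (n : ℕ) : ∫⁻ y, k n y ∂ρ =
      ENNReal.ofReal (∫ y : I, x n / (1 - (y : ℝ) + y * x n) ∂ρ) := by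
    refine (ofReal_integral_eq_lintegral_ofReal ?_ (.of_forall fun y ↦ ?_)).symm
    · exact (integrable_inv_cbfDenom (hx0 n)).const_mul (x n)
    · exact div_nonneg (hx0 n).le (cbfDenom_pos (hx0 n) y).le
  have hlim1 : Tendsto (fun n ↦ ∫⁻ y, k n y ∂ρ) atTop (𝓝 1) := by
    simp_rw [hint]
    simpa using ENNReal.tendsto_ofReal h1
  -- Fatou's lemma bounds the integral of `1 / y` by `1`, and `k n ≤ J` gives the other inequality.
  -- As `J` is infinite at `0`, this also excludes an atom there.
  have hJ1 : ∫⁻ y, J y ∂ρ = 1 := by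
    refine le_antisymm ?_ (le_of_tendsto' hlim1 fun n ↦ lintegral_mono (hkle n))
    calc ∫⁻ y, J y ∂ρ = ∫⁻ y, liminf (fun n ↦ k n y) atTop ∂ρ :=
          lintegral_congr fun y ↦ (hklim y).liminf_eq.symm
      _ ≤ liminf (fun n ↦ ∫⁻ y, k n y ∂ρ) atTop := lintegral_liminf_le fun n ↦ by
          simp only [hk]; fun_prop
      _ = 1 := hlim1.liminf_eq
  have hJtop : ∀ᵐ y ∂ρ, J y < ∞ := ae_lt_top hJm (by rw [hJ1]; simp)
  -- The density `1 / y` and the position `s = (1 - y) / y` are forced by `-z / (1 - y - y z) = (1 /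
  -- y) * z / (z - s)`.
  set P : Measure I := ρ.withDensity J with hP
  have : IsProbabilityMeasure P := ⟨by rw [hP, withDensity_apply _ MeasurableSet.univ]; simpa⟩
  have hmm : Measurable fun y : I ↦ (1 - (y : ℝ)) / y := by fun_prop
  refine ⟨⟨P.map fun y : I ↦ (1 - (y : ℝ)) / y, Measure.isProbabilityMeasure_map hmm.aemeasurable⟩,
    ?_, fun z hz ↦ ?_⟩
  · simp only [ProbabilityMeasure.coe_mk]
    rw [Measure.map_apply hmm measurableSet_Iio]
    convert measure_empty (μ := P)
    ext y
    simp only [mem_preimage, mem_Iio, mem_empty_iff_false, iff_false, not_lt]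
    exact div_nonneg (sub_nonneg.2 y.2.2) y.2.1
  · simp only [cauchyTransform, ProbabilityMeasure.coe_mk]
    rw [integral_map hmm.aemeasurable (Measurable.aestronglyMeasurable (by fun_prop)), hP,
      integral_withDensity_eq_integral_toReal_smul hJm hJtop, ← integral_const_mul, cbfTransform]
    refine integral_congr_ae ?_
    filter_upwards [hJtop] with y hy
    have hy0 : (y : ℝ) ≠ 0 := fun h ↦ by simp [hJ, h] at hy
    have hy0' : 0 < (y : ℝ) := lt_of_le_of_ne y.2.1 (Ne.symm hy0)
    have hD := cbfDenom_ne_zero (neg_mem_slitPlane_of_im_pos hz) y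
    have hz2 := sub_ofReal_ne_zero hz.ne' ((1 - (y : ℝ)) / y)
    have hyC : ((y : ℝ) : ℂ) ≠ 0 := by exact_mod_cast hy0
    have e1 : (J y).toReal = (y : ℝ)⁻¹ := by
      rw [hJ, ENNReal.toReal_inv, ENNReal.toReal_ofReal y.2.1]
    rw [e1, cbfKernel, Complex.real_smul]
    have e2 : (1 : ℂ) - (y : ℝ) + (y : ℝ) * -z =
        -((y : ℝ) : ℂ) * (z - ((1 - (y : ℝ)) / y : ℝ)) := by
      push_cast
      field_simp
      ring
    rw [e2]
    push_cast at hz2 ⊢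
    field_simp

/-- Every function represented by a measure without mass at `0` is the Voiculescu transform of a
probability measure on the positive half-axis. -/
theorem exists_isVoiculescuTransform_cbfTransform (h0 : ρ {0} = 0) :
    ∃ μ : ProbabilityMeasure ℝ, (μ : Measure ℝ) (Iio 0) = 0 ∧
      IsVoiculescuTransform μ fun z ↦ cbfTransform ρ (-z) := by
  obtain ⟨R₁, hR₁⟩ := eventually_atTop.1 ((tendsto_integral_inv_cbfDenom h0).eventually_le_const
    (by norm_num : (0 : ℝ) < 1 / 100))
  set R := max R₁ 1 with hR
  have hR1 : 1 ≤ R := le_max_right _ _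
  have hsmall (r : ℝ) (hr : R ≤ r) : ∫ y : I, (1 - (y : ℝ) + y * r)⁻¹ ∂ρ ≤ 1 / 100 :=
    hR₁ r ((le_max_left _ _).trans hr)
  obtain ⟨ρ', hρ', heq⟩ := exists_measure_eq_div (ρ := ρ)
  have hbound (v : ℂ) (hv : v ∈ wideSector) (hn : R ≤ ‖v‖) :
      ‖cbfTransform ρ v‖ ≤ 3 / 100 * ‖v‖ := by
    refine (norm_cbfTransform_le hv (norm_pos_iff.1 (by linarith))).trans ?_
    nlinarith [hsmall _ hn]
  -- Test on the positive axis: at `v = r` the identity for `ρ'` says that the transform at `r - f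
  -- r` is `1 - f r / r`, which tends to `1`.
  have hreal : ∃ μ : ProbabilityMeasure ℝ, (μ : Measure ℝ) (Iio 0) = 0 ∧
      ∀ z : ℂ, 0 < z.im → cbfTransform ρ' (-z) = z * cauchyTransform μ z := by
    set r : ℕ → ℝ := fun n ↦ R + n with hr
    have hrR (n : ℕ) : R ≤ r n := by simp [hr]
    have hr0 (n : ℕ) : 0 < r n := by linarith [hrR n]
    have hrt : Tendsto r atTop atTop :=
      tendsto_atTop_add_const_left _ _ tendsto_natCast_atTop_atTop
    have hrsec (n : ℕ) := ofReal_mem_wideSector (hr0 n).le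
    have hnorm (n : ℕ) : ‖(r n : ℂ)‖ = r n := by
      rw [Complex.norm_real, Real.norm_of_nonneg (hr0 n).le]
    set u : ℕ → ℝ := fun n ↦ ∫ y : I, r n / (1 - (y : ℝ) + y * r n) ∂ρ with hu
    have hfu (n : ℕ) : cbfTransform ρ (r n) = u n := cbfTransform_ofReal ρ (r n)
    have hule (n : ℕ) : u n ≤ 3 / 100 * r n := by
      have := hbound _ (hrsec n) (by rw [hnorm]; exact hrR n)
      rw [hfu, hnorm, Complex.norm_real] at this
      exact (le_abs_self _).trans this
    have hx0 (n : ℕ) : 0 < r n - u n := by linarith [hule n, hr0 n]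
    refine exists_probabilityMeasure (x := fun n ↦ r n - u n) (ρ := ρ') hx0 ?_ ?_
    · refine tendsto_atTop_mono (f := fun n ↦ (97 / 100) * r n) (fun n ↦ ?_)
        (hrt.const_mul_atTop (by norm_num))
      linarith [hule n]
    · have h2 : Tendsto (fun n ↦ 1 - u n / r n) atTop (𝓝 1) := by
        have h3 := ((tendsto_integral_inv_cbfDenom h0).comp hrt).const_sub 1
        rw [sub_zero] at h3
        refine h3.congr fun n ↦ ?_
        simp only [Function.comp, hu]
        rw [← integral_div]
        congr 2
        ext y
        have := (hr0 n).ne'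
        have := (cbfDenom_pos (hr0 n) y).ne'
        field_simp
      refine h2.congr fun n ↦ ?_
      have h4 := heq (r n) (hrsec n) (by rw [hnorm]; linarith [hrR n])
        (by rw [hnorm]; exact hsmall _ (hrR n))
      rw [hfu, ← Complex.ofReal_sub, cbfTransform_ofReal, ← Complex.ofReal_div] at h4
      have h5 := Complex.ofReal_injective h4
      rw [h5, sub_div, div_self (hr0 n).ne']
  obtain ⟨μ, hμ0, hμ⟩ := hreal
  have hcone : ∀ z ∈ truncatedCone 1 R, -z ∈ wideSector ∧ R ≤ ‖-z‖ ∧ ‖-z‖ ≤ 2 * z.im := by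
    intro z hz
    have him := im_pos_of_mem_truncatedCone (by linarith) hz
    have h2 := norm_le_of_mem_truncatedCone (by linarith) hz
    refine ⟨?_, ?_, by rw [norm_neg]; linarith⟩
    · have h1 := hz.1
      rw [one_mul] at h1
      simp only [wideSector, mem_ofPred_eq, norm_neg, Complex.neg_re]
      have h3 := Complex.sq_norm z
      rw [Complex.normSq_apply] at h3
      have h4 : z.re ^ 2 ≤ z.im ^ 2 := sq_le_sq.2 (h1.le.trans (le_abs_self _))
      -- In the cone of aperture `1` the real part is at most `|z| / √2`, and `1/2 < 9/16`.
      have h5 : z.re ≤ 3 / 4 * ‖z‖ := by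
        refine abs_le_of_sq_le_sq' ?_ (by positivity) |>.2
        nlinarith
      linarith
    · rw [norm_neg]
      have := Complex.abs_im_le_norm z
      have := le_abs_self z.im
      linarith [hz.2]
  refine ⟨μ, hμ0, 1, R, one_pos, by linarith, ?_, fun z hz ↦ ?_, ?_⟩
  · refine DifferentiableOn.analyticOnNhd ?_ (isOpen_truncatedCone 1 R)
    exact (differentiableOn_cbfTransform ρ).comp differentiableOn_id.neg fun z hz ↦
      neg_mem_slitPlane_of_im_pos (im_pos_of_mem_truncatedCone (by linarith) hz)
  · obtain ⟨hs, hn, hle⟩ := hcone z hz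
    have him := im_pos_of_mem_truncatedCone (by linarith) hz
    have hz0 : z ≠ 0 := fun h ↦ by simp [h] at him
    have hb := hbound _ hs hn
    have hpos : 0 < (z + cbfTransform ρ (-z)).im := by
      have := neg_le_of_abs_le (Complex.abs_im_le_norm (cbfTransform ρ (-z)))
      rw [Complex.add_im]
      linarith
    refine ⟨hpos, ?_⟩
    -- At `v = -z` one has `v - f v = -(z + φ z)`, so the identity becomes `(z + φ z) G(z + φ z) =
    -- (z + φ z) / z`.
    have h4 := heq (-z) hs (hR1.trans hn) (hsmall _ hn)
    rw [show -z - cbfTransform ρ (-z) = -(z + cbfTransform ρ (-z)) by ring, hμ _ hpos,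
      neg_div_neg_eq] at h4
    have hne : z + cbfTransform ρ (-z) ≠ 0 := fun h ↦ by simp [h] at hpos
    rw [div_eq_mul_inv] at h4
    rw [reciprocalCauchy, mul_left_cancel₀ hne h4, one_div, inv_inv]
  · have h1 : Tendsto (fun z : ℂ ↦ -z) (coneFilter 1 R)
        (Bornology.cobounded ℂ ⊓ 𝓟 wideSector) := by
      refine tendsto_inf.2 ⟨?_, tendsto_principal.2 ?_⟩
      · rw [← tendsto_norm_atTop_iff_cobounded]
        simpa only [norm_neg] using tendsto_norm_coneFilter 1 R
      · filter_upwards [eventually_mem_truncatedCone 1 R] with z hz using (hcone z hz).1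
    have h2 := ((tendsto_cbfTransform_div ρ).comp h1).const_sub 1
    have h3 : ρ.real {0} = 0 := by simp [Measure.real, h0]
    rw [h3, Complex.ofReal_zero, sub_zero] at h2
    refine h2.congr' ?_
    filter_upwards [eventually_mem_truncatedCone 1 R] with z hz
    have him := im_pos_of_mem_truncatedCone (by linarith) hz
    have hz0 : z ≠ 0 := fun h ↦ by simp [h] at him
    simp only [Function.comp]
    field_simp
    ring

end

end FreeRegular

namespace FreeRegular

open unitInterval

/-! ### Functions with an integral representation are complete Bernstein functions -/

/-- The rate of the exponential attached to a point of the unit interval. -/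
noncomputable def rate (y : I) : ℝ := (1 - y) / y

lemma rate_nonneg (y : I) : 0 ≤ rate y := div_nonneg (sub_nonneg.2 y.2.2) y.2.1

@[fun_prop]
lemma measurable_rate : Measurable rate := by
  unfold rate
  fun_prop

/-- Derivatives of the Lévy density attached to `ρ`. -/
noncomputable def levyDensity (ρ : Measure I) (k : ℕ) (r : ℝ) : ℝ :=
  ∫ y, (-rate y) ^ k * (rate y * (1 + rate y) * Real.exp (-(rate y * r))) ∂ρ

/-- From `x ^ m / m! ≤ e ^ x` at `x = s c`; it bounds the integrands of all derivatives of the Lévy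
density uniformly in the rate. -/
lemma pow_mul_exp_neg_le {s c r : ℝ} (hs : 0 ≤ s) (hc : 0 < c) (hr : c ≤ r) (m : ℕ) :
    s ^ m * Real.exp (-(s * r)) ≤ m.factorial / c ^ m := by
  have h1 := Real.pow_div_factorial_le_exp (s * c) (by positivity) m
  have h2 : Real.exp (-(s * r)) ≤ Real.exp (-(s * c)) := by gcongr
  have hm : (0 : ℝ) < m.factorial := by exact_mod_cast m.factorial_pos
  rw [div_le_iff₀ hm, mul_pow] at h1
  rw [le_div_iff₀ (by positivity)]
  calc s ^ m * Real.exp (-(s * r)) * c ^ m ≤ s ^ m * Real.exp (-(s * c)) * c ^ m := by gcongr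
    _ = (s ^ m * c ^ m) * Real.exp (-(s * c)) := by ring
    _ ≤ (Real.exp (s * c) * m.factorial) * Real.exp (-(s * c)) := by gcongr
    _ = m.factorial := by rw [mul_right_comm, ← Real.exp_add]; simp

/-- A bound for the integrands of `levyDensity`. -/
noncomputable def levyBound (k : ℕ) (c : ℝ) : ℝ :=
  (k + 1).factorial / c ^ (k + 1) + (k + 2).factorial / c ^ (k + 2)

lemma norm_levyDensity_integrand_le {c r : ℝ} (hc : 0 < c) (hr : c ≤ r) (k : ℕ) (y : I) :
    ‖(-rate y) ^ k * (rate y * (1 + rate y) * Real.exp (-(rate y * r)))‖ ≤ levyBound k c := by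
  have hs := rate_nonneg y
  rw [norm_mul, norm_pow, norm_neg, Real.norm_of_nonneg hs, Real.norm_of_nonneg (by positivity)]
  have h1 := pow_mul_exp_neg_le hs hc hr (k + 1)
  have h2 := pow_mul_exp_neg_le hs hc hr (k + 2)
  rw [levyBound]
  refine le_trans (le_of_eq ?_) (add_le_add h1 h2)
  ring

variable {ρ : Measure I} [IsFiniteMeasure ρ]

lemma integrable_levyDensity {r : ℝ} (hr : 0 < r) (k : ℕ) :
    Integrable (fun y ↦ (-rate y) ^ k * (rate y * (1 + rate y) * Real.exp (-(rate y * r)))) ρ :=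
  Integrable.of_bound (Measurable.aestronglyMeasurable (by fun_prop)) (levyBound k r)
    (.of_forall fun y ↦ norm_levyDensity_integrand_le hr le_rfl k y)

lemma hasDerivAt_levyDensity {r : ℝ} (hr : 0 < r) (k : ℕ) :
    HasDerivAt (levyDensity ρ k) (levyDensity ρ (k + 1) r) r := by
  refine (hasDerivAt_integral_of_dominated_loc_of_deriv_le (μ := ρ)
    (F := fun (r : ℝ) y ↦ (-rate y) ^ k * (rate y * (1 + rate y) * Real.exp (-(rate y * r))))
    (F' := fun (r : ℝ) y ↦
      (-rate y) ^ (k + 1) * (rate y * (1 + rate y) * Real.exp (-(rate y * r))))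
    (bound := fun _ ↦ levyBound (k + 1) (r / 2))
    (Ioi_mem_nhds (half_lt_self hr)) (.of_forall fun w ↦ Measurable.aestronglyMeasurable
    (by fun_prop)) (integrable_levyDensity hr k) (Measurable.aestronglyMeasurable (by fun_prop))
    (.of_forall fun y x hx ↦ norm_levyDensity_integrand_le (half_pos hr) (le_of_lt hx) (k + 1) y)
    (integrable_const _) (.of_forall fun y x _ ↦ ?_)).2
  have h1 : HasDerivAt (fun x : ℝ ↦ Real.exp (-(rate y * x)))
      (Real.exp (-(rate y * x)) * -(rate y * 1)) x :=
    ((hasDerivAt_id x).const_mul (rate y)).neg.exp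
  refine ((h1.const_mul (rate y * (1 + rate y))).const_mul ((-rate y) ^ k)).congr_deriv ?_
  ring

lemma iteratedDeriv_levyDensity (k : ℕ) :
    ∀ r : ℝ, 0 < r → iteratedDeriv k (levyDensity ρ 0) r = levyDensity ρ k r := by
  induction k with
  | zero => simp
  | succ k ih =>
    intro r hr
    rw [iteratedDeriv_succ]
    have : iteratedDeriv k (levyDensity ρ 0) =ᶠ[𝓝 r] levyDensity ρ k := by
      filter_upwards [Ioi_mem_nhds hr] with x hx using ih x hx
    rw [this.deriv_eq, (hasDerivAt_levyDensity hr k).deriv]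

lemma contDiffOn_levyDensity (n : ℕ) :
    ∀ k, ContDiffOn ℝ n (levyDensity ρ k) (Ioi 0) := by
  induction n with
  | zero =>
    intro k
    rw [Nat.cast_zero, contDiffOn_zero]
    exact fun r hr ↦ (hasDerivAt_levyDensity hr k).continuousAt.continuousWithinAt
  | succ n ih =>
    intro k
    rw [Nat.cast_add, Nat.cast_one, contDiffOn_succ_iff_deriv_of_isOpen isOpen_Ioi]
    refine ⟨fun r hr ↦ (hasDerivAt_levyDensity hr k).differentiableAt.differentiableWithinAt,
      by simp, (ih (k + 1)).congr fun r hr ↦ (hasDerivAt_levyDensity hr k).deriv⟩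

lemma isCompletelyMonotone_levyDensity : IsCompletelyMonotone (levyDensity ρ 0) := by
  refine ⟨contDiffOn_infty.2 fun n ↦ contDiffOn_levyDensity n 0, fun n r hr ↦ ?_⟩
  rw [iteratedDeriv_levyDensity n r hr, levyDensity, ← integral_const_mul]
  refine integral_nonneg fun y ↦ ?_
  have hs := rate_nonneg y
  simp only [Pi.zero_apply]
  rw [← mul_assoc, ← mul_pow, neg_one_mul, neg_neg]
  positivity

lemma integral_one_sub_exp_mul_exp {s z : ℝ} (hs : 0 < s) (hz : 0 ≤ z) :
    IntegrableOn (fun r ↦ (1 - Real.exp (-(z * r))) * Real.exp (-(s * r))) (Ioi 0) ∧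
    ∫ r in Ioi (0 : ℝ), (1 - Real.exp (-(z * r))) * Real.exp (-(s * r)) = z / (s * (s + z)) := by
  have e (r : ℝ) : (1 - Real.exp (-(z * r))) * Real.exp (-(s * r)) =
      Real.exp (-s * r) - Real.exp (-(s + z) * r) := by
    rw [sub_mul, one_mul, ← Real.exp_add]
    congr 2 <;> ring_nf
  have i1 : IntegrableOn (fun r ↦ Real.exp (-s * r)) (Ioi 0) :=
    integrableOn_exp_mul_Ioi (by linarith) 0
  have i2 : IntegrableOn (fun r ↦ Real.exp (-(s + z) * r)) (Ioi 0) :=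
    integrableOn_exp_mul_Ioi (by linarith) 0
  simp_rw [e]
  refine ⟨i1.sub i2, ?_⟩
  rw [integral_sub i1 i2, integral_exp_mul_Ioi (by linarith), integral_exp_mul_Ioi (by linarith)]
  have : s + z ≠ 0 := by linarith
  rw [mul_zero, mul_zero, Real.exp_zero, neg_div_neg_eq, neg_div_neg_eq]
  field_simp
  ring

/-- By Tonelli each rate `s` contributes `s (1 + s) * z / (s (s + z)) = (1 + s) z / (s + z)`, which
is the kernel at `y = 1 / (1 + s)`. Both endpoints drop out: `rate 1 = 0`, and `rate 0 = 0` by the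
convention for division by zero. -/
lemma lintegral_levyDensity {z : ℝ} (hz : 0 ≤ z) :
    ∫⁻ r in Ioi (0 : ℝ), ENNReal.ofReal (levyDensity ρ 0 r) *
      ENNReal.ofReal (1 - Real.exp (-(z * r))) =
    ∫⁻ y in {0, 1}ᶜ, ENNReal.ofReal (z / (1 - (y : ℝ) + y * z)) ∂ρ := by
  have e1 : ∀ r ∈ Ioi (0 : ℝ), ENNReal.ofReal (levyDensity ρ 0 r) *
      ENNReal.ofReal (1 - Real.exp (-(z * r))) =
      ∫⁻ y, ENNReal.ofReal (rate y * (1 + rate y) * Real.exp (-(rate y * r))) *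
        ENNReal.ofReal (1 - Real.exp (-(z * r))) ∂ρ := by
    intro r hr
    rw [lintegral_mul_const _ (by fun_prop)]
    congr 1
    have hi := integrable_levyDensity (ρ := ρ) hr 0
    simp only [pow_zero, one_mul] at hi
    rw [levyDensity]
    simp only [pow_zero, one_mul]
    exact ofReal_integral_eq_lintegral_ofReal hi (.of_forall fun y ↦ by
      have hs := rate_nonneg y
      simp only [Pi.zero_apply]
      positivity)
  rw [setLIntegral_congr_fun measurableSet_Ioi e1, lintegral_lintegral_swap
    (by fun_prop), ← lintegral_indicator (by measurability)]
  refine lintegral_congr fun y ↦ ?_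
  by_cases hy : y ∈ ({0, 1} : Set I)
  · rw [indicator_of_notMem (notMem_compl_iff.2 hy)]
    have : rate y = 0 := by
      rcases hy with rfl | hy
      · simp [rate]
      · rw [mem_singleton_iff.1 hy]; simp [rate]
    simp [this]
  · rw [indicator_of_mem hy]
    simp only [mem_insert_iff, mem_singleton_iff, not_or] at hy
    have hy0 : 0 < (y : ℝ) := lt_of_le_of_ne y.2.1 fun h ↦ hy.1 (Subtype.ext h.symm)
    have hy1 : (y : ℝ) < 1 := lt_of_le_of_ne y.2.2 fun h ↦ hy.2 (Subtype.ext h)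
    have hs : 0 < rate y := div_pos (by linarith) hy0
    obtain ⟨hi, he⟩ := integral_one_sub_exp_mul_exp hs hz
    have h1 : ∀ r : ℝ, ENNReal.ofReal (rate y * (1 + rate y) * Real.exp (-(rate y * r))) *
        ENNReal.ofReal (1 - Real.exp (-(z * r))) = ENNReal.ofReal (rate y * (1 + rate y) *
          ((1 - Real.exp (-(z * r))) * Real.exp (-(rate y * r)))) := fun r ↦ by
      rw [← ENNReal.ofReal_mul (by positivity)]
      congr 1
      ring
    simp_rw [h1]
    rw [← ofReal_integral_eq_lintegral_ofReal (hi.const_mul _), integral_const_mul, he]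
    · congr 1
      have h3 : 1 - (y : ℝ) + y * z ≠ 0 := by nlinarith
      have h4 : (1 - (y : ℝ)) ≠ 0 := by linarith
      rw [rate]
      have h5 : (1 - (y : ℝ)) / y + z ≠ 0 := by positivity
      field_simp
      ring
    · filter_upwards [ae_restrict_mem measurableSet_Ioi] with r hr
      have : Real.exp (-(z * r)) ≤ 1 := Real.exp_le_one_iff.2 (by
        have : (0 : ℝ) < r := hr
        nlinarith)
      have h2 : 0 ≤ 1 - Real.exp (-(z * r)) := by linarith
      simp only [Pi.zero_apply]
      positivity

lemma min_one_le_two_mul_one_sub_exp {x : ℝ} (hx : 0 ≤ x) :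
    min 1 x ≤ 2 * (1 - Real.exp (-(1 * x))) := by
  have h1 := Real.add_one_le_exp x
  have h2 : Real.exp (-(1 * x)) ≤ 1 / (1 + x) := by
    rw [one_mul, Real.exp_neg, one_div]
    exact inv_anti₀ (by linarith) (by linarith)
  have h3 : min 1 x ≤ 2 * (1 - 1 / (1 + x)) := by
    have : 2 * (1 - 1 / (1 + x)) = 2 * x / (1 + x) := by field_simp; ring
    rw [this, le_div_iff₀ (by linarith)]
    rcases le_total 1 x with h | h
    · rw [min_eq_left h]; linarith
    · rw [min_eq_right h]; nlinarith
  linarith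

lemma aemeasurable_levyDensity :
    AEMeasurable (levyDensity ρ 0) (volume.restrict (Ioi (0 : ℝ))) :=
  (contDiffOn_levyDensity 0 0).continuousOn.aemeasurable measurableSet_Ioi

/-- The atom of `ρ` at `1` becomes the killing rate, the part in the open interval becomes the Lévy
density, and there is no atom at `0` to produce a drift. Finiteness at `z = 1` gives the Lévy
condition, since `min 1 x ≤ 2 (1 - e^{-x})`. -/
theorem exists_mem_CBFflat (h0 : ρ {0} = 0) :
    ∃ f ∈ CBFflat, ∀ z : ℝ≥0, 0 < z → cbfTransform ρ (z : ℝ) = ((f z : ℝ) : ℂ) := by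
  set u : ℝ≥0 → ℝ := fun z ↦ ∫ y in ({0, 1}ᶜ : Set I), (z : ℝ) / (1 - (y : ℝ) + y * z) ∂ρ with hu
  have hden (z : ℝ≥0) (y : I) : 0 ≤ (z : ℝ) / (1 - (y : ℝ) + y * z) :=
    div_nonneg z.2 (add_nonneg (sub_nonneg.2 y.2.2) (mul_nonneg y.2.1 z.2))
  have hu0 (z : ℝ≥0) : 0 ≤ u z := integral_nonneg fun y ↦ hden z y
  have hint (z : ℝ≥0) : Integrable (fun y : I ↦ (z : ℝ) / (1 - (y : ℝ) + y * z)) ρ := by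
    rcases eq_zero_or_pos z with rfl | hz
    · simp
    · exact (integrable_inv_cbfDenom hz).const_mul (z : ℝ)
  have hul (z : ℝ≥0) : ENNReal.ofReal (u z) =
      ∫⁻ y in {0, 1}ᶜ, ENNReal.ofReal ((z : ℝ) / (1 - (y : ℝ) + y * z)) ∂ρ :=
    ofReal_integral_eq_lintegral_ofReal (hint z).integrableOn (.of_forall fun y ↦ hden z y)
  set m : Measure ℝ := (volume.restrict (Ioi (0 : ℝ))).withDensity
    fun x ↦ ENNReal.ofReal (levyDensity ρ 0 x) with hm
  have hml (z : ℝ≥0) : ∫⁻ x, ENNReal.ofReal (1 - Real.exp (-((z : ℝ) * x))) ∂m =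
      ENNReal.ofReal (u z) := by
    rw [hul, ← lintegral_levyDensity (ρ := ρ) z.coe_nonneg, hm,
      lintegral_withDensity_eq_lintegral_mul₀
      aemeasurable_levyDensity.ennreal_ofReal (by fun_prop)]
    rfl
  have hmc : m (Iic 0) = 0 := by
    refine withDensity_absolutelyContinuous _ _ ?_
    rw [Measure.restrict_apply measurableSet_Iic, Iic_inter_Ioi, Ioc_self, measure_empty]
  have hmpos : ∀ᵐ x ∂m, 0 < x := by
    rw [ae_iff]
    convert hmc using 2
    exact Set.ext fun x ↦ not_lt
  refine ⟨fun z ↦ ⟨ρ.real {1} + u z, add_nonneg measureReal_nonneg (hu0 z)⟩,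
    ⟨⟨ρ.real {1}, measureReal_nonneg⟩, levyDensity ρ 0, isCompletelyMonotone_levyDensity,
      hmc, ?_, fun z ↦ ?_⟩, fun z hz ↦ ?_⟩
  · change ∫⁻ x, ENNReal.ofReal (min 1 x) ∂m < ∞
    have h1 := hml 1
    calc ∫⁻ x, ENNReal.ofReal (min 1 x) ∂m
        ≤ ∫⁻ x, 2 * ENNReal.ofReal (1 - Real.exp (-(((1 : ℝ≥0) : ℝ) * x))) ∂m := by
          refine lintegral_mono_ae (hmpos.mono fun x hx ↦ ?_)
          rw [← ENNReal.ofReal_ofNat 2, ← ENNReal.ofReal_mul (by norm_num)]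
          exact ENNReal.ofReal_le_ofReal (by
            simpa using min_one_le_two_mul_one_sub_exp hx.le)
      _ = 2 * ENNReal.ofReal (u 1) := by rw [lintegral_const_mul _ (by fun_prop), h1]
      _ < ∞ := ENNReal.mul_lt_top (by simp) ENNReal.ofReal_lt_top
  · change ρ.real {1} + u z = ρ.real {1} + ((0 : ℝ≥0) : ℝ) * z + ∫ x, _ ∂m
    rw [NNReal.coe_zero, zero_mul, add_zero, integral_eq_lintegral_of_nonneg_ae
      (hmpos.mono fun x hx ↦ ?_) (by fun_prop), hml, ENNReal.toReal_ofReal (hu0 z)]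
    simp only [Pi.zero_apply, sub_nonneg, Real.exp_le_one_iff]
    exact neg_nonpos.2 (mul_nonneg z.coe_nonneg hx.le)
  · rw [cbfTransform_ofReal]
    congr 1
    change _ = ρ.real {1} + u z
    have hi := hint z
    rw [← setIntegral_univ, ← union_compl_self ({0, 1} : Set I), setIntegral_union
      disjoint_compl_right (by measurability) hi.integrableOn hi.integrableOn]
    congr 1
    rw [show ({0, 1} : Set I) = {0} ∪ {1} from rfl, setIntegral_union (by simp)
      (measurableSet_singleton _) hi.integrableOn hi.integrableOn, Measure.restrict_singleton,
      Measure.restrict_singleton, h0]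
    have : (z : ℝ) ≠ 0 := by exact_mod_cast hz.ne'
    simp [this, Measure.real]

end FreeRegular

namespace FreeRegular

open unitInterval

/-! ### Completely monotone functions -/

namespace IsCompletelyMonotone

variable {g : ℝ → ℝ}

lemma contDiffOn_Icc (hg : IsCompletelyMonotone g) {x b : ℝ} (hx : 0 < x) :
    ContDiffOn ℝ (⊤ : ℕ∞) g (Icc x b) :=
  hg.1.mono fun _ hy ↦ hx.trans_le hy.1

lemma iteratedDerivWithin_eq (hg : IsCompletelyMonotone g) {x b y : ℝ} (hx : 0 < x) (hb : x < b)
    (hy : y ∈ Icc x b) (k : ℕ) : iteratedDerivWithin k g (Icc x b) y = iteratedDeriv k g y :=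
  iteratedDerivWithin_eq_iteratedDeriv (uniqueDiffOn_Icc hb)
    ((hg.1.contDiffAt (Ioi_mem_nhds (hx.trans_le hy.1))).of_le (mod_cast le_top)) hy

/-- Taylor's formula with the remainder in Cauchy's form, at the right end of an interval. -/
lemma exists_remainder (hg : IsCompletelyMonotone g) {x b : ℝ} (hx : 0 < x) (hb : x < b) (n : ℕ) :
    ∃ ξ ∈ Ioo x b, g x - ∑ k ∈ Finset.range (n + 1),
        (-1) ^ k * iteratedDeriv k g b / k.factorial * (b - x) ^ k =
      (-1) ^ (n + 1) * iteratedDeriv (n + 1) g ξ / n.factorial * (ξ - x) ^ n * (b - x) := by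
  have hu : uIcc b x = Icc x b := uIcc_of_ge hb.le
  have hc := hg.contDiffOn_Icc (b := b) hx
  have hd : DifferentiableOn ℝ (iteratedDerivWithin n g (Icc x b)) (Ioo x b) :=
    (hc.differentiableOn_iteratedDerivWithin (m := n) (by exact_mod_cast ENat.natCast_lt_top n)
      (uniqueDiffOn_Icc hb)).mono Ioo_subset_Icc_self
  obtain ⟨ξ, hξ, h⟩ := taylor_mean_remainder_cauchy (f := g) (x := x) (x₀ := b) (n := n) hb.ne'
    (hu ▸ hc.of_le (mod_cast le_top)) (by rwa [hu, uIoo_of_ge hb.le])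
  rw [uIoo_of_ge hb.le] at hξ
  rw [hu, taylor_within_apply, hg.iteratedDerivWithin_eq hx hb (Ioo_subset_Icc_self hξ)] at h
  refine ⟨ξ, hξ, ?_⟩
  have e : ∑ k ∈ Finset.range (n + 1), (-1) ^ k * iteratedDeriv k g b / k.factorial * (b - x) ^ k =
      ∑ k ∈ Finset.range (n + 1), ((k.factorial : ℝ)⁻¹ * (x - b) ^ k) •
        iteratedDerivWithin k g (Icc x b) b := by
    refine Finset.sum_congr rfl fun k _ ↦ ?_
    rw [hg.iteratedDerivWithin_eq hx hb (right_mem_Icc.2 hb.le), smul_eq_mul,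
      show x - b = -1 * (b - x) by ring, mul_pow]
    ring
  rw [e, h, show x - ξ = -1 * (ξ - x) by ring, mul_pow, pow_succ]
  ring

lemma term_nonneg (hg : IsCompletelyMonotone g) {x b : ℝ} (hx : x ≤ b) (hb : 0 < b) (k : ℕ) :
    0 ≤ (-1) ^ k * iteratedDeriv k g b / k.factorial * (b - x) ^ k :=
  mul_nonneg (div_nonneg (hg.2 k b hb) (by positivity)) (pow_nonneg (sub_nonneg.2 hx) _)

lemma sum_term_le (hg : IsCompletelyMonotone g) {x b : ℝ} (hx : 0 < x) (hb : x < b) (n : ℕ) :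
    ∑ k ∈ Finset.range (n + 1), (-1) ^ k * iteratedDeriv k g b / k.factorial * (b - x) ^ k
      ≤ g x := by
  obtain ⟨ξ, hξ, h⟩ := hg.exists_remainder hx hb n
  rw [← sub_nonneg, h]
  have := hg.2 (n + 1) ξ (hx.trans hξ.1)
  exact mul_nonneg (mul_nonneg (div_nonneg this (by positivity))
    (pow_nonneg (sub_nonneg.2 hξ.1.le) _)) (sub_nonneg.2 hb.le)

lemma term_le (hg : IsCompletelyMonotone g) {x b : ℝ} (hx : 0 < x) (hb : x < b) (k : ℕ) :
    (-1) ^ k * iteratedDeriv k g b / k.factorial * (b - x) ^ k ≤ g x :=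
  le_trans (Finset.single_le_sum (f := fun k ↦ (-1) ^ k * iteratedDeriv k g b / k.factorial *
    (b - x) ^ k) (fun j _ ↦ hg.term_nonneg hb.le (hx.trans hb) j)
    (Finset.mem_range.2 k.lt_succ_self)) (hg.sum_term_le hx hb k)

lemma nonneg (hg : IsCompletelyMonotone g) {x : ℝ} (hx : 0 < x) : 0 ≤ g x := by
  simpa using hg.2 0 x hx

lemma anti (hg : IsCompletelyMonotone g) {x b : ℝ} (hx : 0 < x) (hb : x ≤ b) : g b ≤ g x := by
  rcases hb.eq_or_lt with rfl | hb
  · rfl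
  · simpa using hg.term_le hx hb 0

/-- A completely monotone function is the sum of its Taylor series to the left of any point. -/
theorem hasSum (hg : IsCompletelyMonotone g) {x b : ℝ} (hx : 0 < x) (hb : x < b) :
    HasSum (fun k : ℕ ↦ (-1) ^ k * iteratedDeriv k g b / k.factorial * (b - x) ^ k) (g x) := by
  rw [hasSum_iff_tendsto_nat_of_nonneg (fun k ↦ hg.term_nonneg hb.le (hx.trans hb) k)]
  rw [← tendsto_add_atTop_iff_nat 1]
  -- An auxiliary point left of `x`: the Taylor term of order `n + 1` about `ξ`, evaluated at `y`,
  -- is at most `g y`, which bounds the derivative in the remainder.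
  set y := x / 2 with hy
  have hy0 : 0 < y := by positivity
  have hyx : y < x := by linarith
  set q := (b - x) / (b - y) with hq
  have hq0 : 0 ≤ q := div_nonneg (by linarith) (by linarith)
  have hq1 : q < 1 := (div_lt_one (by linarith)).2 (by linarith)
  have hlim : Tendsto (fun n : ℕ ↦ g x - (((n : ℝ) * q ^ n) + q ^ n) * (g y * (b - x) / (x - y)))
      atTop (𝓝 (g x)) := by
    have h1 := tendsto_self_mul_const_pow_of_lt_one hq0 hq1
    have h2 := tendsto_pow_atTop_nhds_zero_of_lt_one hq0 hq1
    simpa using ((h1.add h2).mul_const (g y * (b - x) / (x - y))).const_sub (g x)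
  refine tendsto_of_tendsto_of_tendsto_of_le_of_le hlim tendsto_const_nhds (fun n ↦ ?_)
    (fun n ↦ hg.sum_term_le hx hb n)
  obtain ⟨ξ, hξ, h⟩ := hg.exists_remainder hx hb n
  have hξ0 : 0 < ξ := hx.trans hξ.1
  have hyξ : 0 < ξ - y := by linarith [hξ.1]
  have h1 := hg.term_le hy0 (hyx.trans hξ.1) (n + 1)
  rw [Nat.factorial_succ, Nat.cast_mul] at h1
  have hw := hg.2 (n + 1) ξ hξ0
  set w := (-1) ^ (n + 1) * iteratedDeriv (n + 1) g ξ
  have hf : (0 : ℝ) < n.factorial := by exact_mod_cast n.factorial_pos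
  have h2 : w / n.factorial ≤ ((n : ℝ) + 1) * g y / (ξ - y) ^ (n + 1) := by
    rw [le_div_iff₀ (by positivity)]
    rw [div_mul_eq_mul_div, div_le_iff₀ (by positivity)] at h1
    rw [div_mul_eq_mul_div, div_le_iff₀ hf]
    push_cast at h1
    linarith
  have hgy := hg.nonneg hy0
  -- The quotient increases with `ξ`, so its value at `b` bounds it; the remainder is then `O((n +
  -- 1) q ^ n)` with `q < 1`.
  have h3 : (ξ - x) / (ξ - y) ≤ q := by
    rw [hq, div_le_div_iff₀ hyξ (by linarith)]
    nlinarith [hξ.2, mul_pos (sub_pos.2 hyx) (sub_pos.2 hξ.2)]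
  have h4 : 1 / (ξ - y) ≤ 1 / (x - y) := one_div_le_one_div_of_le (by linarith) (by linarith [hξ.1])
  have hξx : 0 ≤ ξ - x := by linarith [hξ.1]
  have hbx : 0 ≤ b - x := by linarith
  have h5 : w / n.factorial * (ξ - x) ^ n * (b - x) ≤
      ((n : ℝ) * q ^ n + q ^ n) * (g y * (b - x) / (x - y)) := by
    calc w / n.factorial * (ξ - x) ^ n * (b - x)
        ≤ ((n : ℝ) + 1) * g y / (ξ - y) ^ (n + 1) * (ξ - x) ^ n * (b - x) := by gcongr
      _ = ((n : ℝ) + 1) * ((ξ - x) / (ξ - y)) ^ n * (g y * (b - x) * (1 / (ξ - y))) := by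
          rw [div_pow]; field_simp; ring
      _ ≤ ((n : ℝ) + 1) * q ^ n * (g y * (b - x) * (1 / (x - y))) := by gcongr
      _ = _ := by ring
  change g x - _ ≤ _
  linarith [h]

end IsCompletelyMonotone

/-! ### Functions with an integral representation over the unit interval -/

/-- The functions on `(0,∞)` that are given by `cbfTransform`. -/
def HasCbfRep (u : ℝ → ℝ) : Prop :=
  ∃ ρ : Measure I, IsFiniteMeasure ρ ∧ ∀ x : ℝ, 0 < x → cbfTransform ρ x = (u x : ℂ)

lemma HasCbfRep.congr {u v : ℝ → ℝ} (hu : HasCbfRep u) (h : ∀ x, 0 < x → u x = v x) :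
    HasCbfRep v := by
  obtain ⟨ρ, hρ, h'⟩ := hu
  exact ⟨ρ, hρ, fun x hx ↦ by rw [h' x hx, h x hx]⟩

lemma HasCbfRep.const_mul {u : ℝ → ℝ} (hu : HasCbfRep u) {c : ℝ} (hc : 0 ≤ c) :
    HasCbfRep fun x ↦ c * u x := by
  obtain ⟨ρ, hρ, h⟩ := hu
  refine ⟨ENNReal.ofReal c • ρ, ρ.smul_finite ENNReal.ofReal_ne_top, fun x hx ↦ ?_⟩
  rw [cbfTransform, integral_smul_measure, ENNReal.toReal_ofReal hc, ← cbfTransform, h x hx]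
  simp

lemma HasCbfRep.add {u v : ℝ → ℝ} (hu : HasCbfRep u) (hv : HasCbfRep v) :
    HasCbfRep fun x ↦ u x + v x := by
  obtain ⟨ρ, hρ, h⟩ := hu
  obtain ⟨τ, hτ, h'⟩ := hv
  refine ⟨ρ + τ, inferInstance, fun x hx ↦ ?_⟩
  rw [cbfTransform, integral_add_measure (integrable_cbfKernel (ofReal_mem_slitPlane' hx))
    (integrable_cbfKernel (ofReal_mem_slitPlane' hx)), ← cbfTransform, ← cbfTransform, h x hx,
    h' x hx]
  push_cast
  rfl

lemma hasCbfRep_zero : HasCbfRep fun _ ↦ 0 :=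
  ⟨0, inferInstance, fun x _ ↦ by simp [cbfTransform]⟩

lemma HasCbfRep.sum {u : ℕ → ℝ → ℝ} (hu : ∀ k, HasCbfRep (u k)) (n : ℕ) :
    HasCbfRep fun x ↦ ∑ k ∈ Finset.range n, u k x := by
  induction n with
  | zero => simpa using hasCbfRep_zero
  | succ n ih => simpa only [Finset.sum_range_succ] using ih.add (hu n)

lemma hasCbfRep_dirac (y : I) : HasCbfRep fun x ↦ x / (1 - (y : ℝ) + y * x) :=
  ⟨Measure.dirac y, inferInstance, fun x _ ↦ by rw [cbfTransform_ofReal, integral_dirac]⟩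

/-- The mass of a representing measure is the value of the function at `1`, so pointwise convergence
already bounds the masses. -/
lemma HasCbfRep.of_tendsto {u : ℕ → ℝ → ℝ} {v : ℝ → ℝ} (hu : ∀ n, HasCbfRep (u n))
    (h : ∀ x, 0 < x → Tendsto (fun n ↦ u n x) atTop (𝓝 (v x))) : HasCbfRep v := by
  choose ρ hρ hρu using hu
  obtain ⟨C, hC⟩ := (h 1 one_pos).bddAbove_range
  obtain ⟨ρ', hρ', hlim⟩ := exists_cbfTransform_eq_of_tendsto (ρ := ρ) (C := C) fun n ↦ by
    have h1 := hρu n 1 one_pos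
    rw [Complex.ofReal_one, cbfTransform_one] at h1
    have h2 : (ρ n).real univ = u n 1 := by exact_mod_cast h1
    rw [h2]
    exact hC (mem_range_self n)
  refine ⟨ρ', hρ', fun x hx ↦ hlim (fun _ ↦ (x : ℂ)) x _ (fun _ ↦ ofReal_mem_slitPlane' hx)
    (ofReal_mem_slitPlane' hx) tendsto_const_nhds ?_⟩
  simp_rw [fun n ↦ hρu n x hx]
  exact (Complex.continuous_ofReal.tendsto _).comp (h x hx)

/-! ### Lévy integrals -/

/-- The driftless Bernstein function with Lévy density `h`. -/
noncomputable def levyIntegral (h : ℝ → ℝ) (x : ℝ) : ℝ :=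
  ∫ r in Ioi (0 : ℝ), (1 - Real.exp (-(x * r))) * h r

lemma one_sub_exp_nonneg {x r : ℝ} (hx : 0 ≤ x) (hr : 0 ≤ r) : 0 ≤ 1 - Real.exp (-(x * r)) :=
  sub_nonneg.2 (Real.exp_le_one_iff.2 (neg_nonpos.2 (mul_nonneg hx hr)))

lemma one_sub_exp_le {x r : ℝ} (hx : 0 ≤ x) (hr : 0 ≤ r) :
    1 - Real.exp (-(x * r)) ≤ (1 + x) * min 1 r := by
  have h1 := Real.add_one_le_exp (-(x * r))
  have h2 := Real.exp_pos (-(x * r))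
  rcases le_total 1 r with h | h
  · rw [min_eq_left h]; linarith
  · rw [min_eq_right h]; nlinarith

/-- Convergence of Lévy integrals by domination. -/
lemma tendsto_levyIntegral {h : ℕ → ℝ → ℝ} {k H : ℝ → ℝ}
    (hm : ∀ n, AEStronglyMeasurable (h n) (volume.restrict (Ioi 0)))
    (hH : IntegrableOn (fun r ↦ min 1 r * H r) (Ioi 0))
    (hb : ∀ n r, 0 < r → |h n r| ≤ H r)
    (hlim : ∀ r, 0 < r → Tendsto (fun n ↦ h n r) atTop (𝓝 (k r))) {x : ℝ} (hx : 0 < x) :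
    Tendsto (fun n ↦ levyIntegral (h n) x) atTop (𝓝 (levyIntegral k x)) := by
  refine tendsto_integral_of_dominated_convergence (fun r ↦ (1 + x) * (min 1 r * H r))
    (fun n ↦ (Measurable.aestronglyMeasurable (by fun_prop)).mul (hm n)) (hH.const_mul _)
    (fun n ↦ ?_) ?_
  · filter_upwards [ae_restrict_mem measurableSet_Ioi] with r hr
    have hr : 0 < r := hr
    rw [norm_mul, Real.norm_of_nonneg (one_sub_exp_nonneg hx.le hr.le), ← mul_assoc]
    exact mul_le_mul (one_sub_exp_le hx.le hr.le) (hb n r hr) (norm_nonneg _)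
      (mul_nonneg (by linarith) (le_min zero_le_one hr.le))
  · filter_upwards [ae_restrict_mem measurableSet_Ioi] with r hr
    exact (hlim r hr).const_mul _

lemma HasCbfRep.levyIntegral_of_tendsto {h : ℕ → ℝ → ℝ} {k H : ℝ → ℝ}
    (hm : ∀ n, AEStronglyMeasurable (h n) (volume.restrict (Ioi 0)))
    (hH : IntegrableOn (fun r ↦ min 1 r * H r) (Ioi 0))
    (hb : ∀ n r, 0 < r → |h n r| ≤ H r)
    (hlim : ∀ r, 0 < r → Tendsto (fun n ↦ h n r) atTop (𝓝 (k r)))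
    (hu : ∀ n, HasCbfRep (levyIntegral (h n))) : HasCbfRep (levyIntegral k) :=
  .of_tendsto hu fun _ hx ↦ tendsto_levyIntegral hm hH hb hlim hx

lemma hasCbfRep_levyIntegral_exp {s : ℝ} (hs : 0 < s) :
    HasCbfRep (levyIntegral fun r ↦ Real.exp (-(s * r))) := by
  have hy : 1 / (1 + s) ∈ I := ⟨by positivity, (div_le_one (by linarith)).2 (by linarith)⟩
  refine ((hasCbfRep_dirac ⟨_, hy⟩).const_mul (c := 1 / (s * (1 + s))) (by positivity)).congr
    fun x hx ↦ ?_
  rw [levyIntegral, (integral_one_sub_exp_mul_exp hs hx.le).2]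
  have : (1 : ℝ) - 1 / (1 + s) + 1 / (1 + s) * x = (s + x) / (1 + s) := by field_simp; ring
  change 1 / (s * (1 + s)) * (x / (1 - 1 / (1 + s) + 1 / (1 + s) * x)) = _
  rw [this]
  field_simp

lemma hasCbfRep_levyIntegral_sum {c s : ℕ → ℝ} (hc : ∀ k, 0 ≤ c k) (hs : ∀ k, 0 < s k) (n : ℕ) :
    HasCbfRep (levyIntegral fun r ↦ ∑ k ∈ Finset.range n, c k * Real.exp (-(s k * r))) := by
  refine (HasCbfRep.sum (fun k ↦ (hasCbfRep_levyIntegral_exp (hs k)).const_mul (hc k)) n).congr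
    fun x hx ↦ ?_
  simp_rw [levyIntegral, Finset.mul_sum]
  rw [integral_finsetSum]
  · refine Finset.sum_congr rfl fun k _ ↦ ?_
    rw [← integral_const_mul]
    congr with r
    ring
  · intro k _
    refine ((integral_one_sub_exp_mul_exp (hs k) hx.le).1.const_mul (c k)).congr
      (.of_forall fun r ↦ ?_)
    simp only
    ring

namespace IsCompletelyMonotone

variable {g : ℝ → ℝ}

lemma aestronglyMeasurable (hg : IsCompletelyMonotone g) :
    AEStronglyMeasurable g (volume.restrict (Ioi 0)) :=
  hg.1.continuousOn.aestronglyMeasurable measurableSet_Ioi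

/-- A common dominating function for `g` at the nodes, which lie above `min 1 r / 2`. The term `g (r
/ 2)` is handled by scaling; the exponential makes the constant `g (1 / 2)` integrable at infinity.
-/
lemma integrableOn_min_mul_bound (hg : IsCompletelyMonotone g)
    (hi : IntegrableOn (fun r ↦ min 1 r * g r) (Ioi 0)) {ε : ℝ} (hε : 0 < ε) :
    IntegrableOn (fun r ↦ min 1 r * ((g (r / 2) + g (1 / 2)) * Real.exp (-(ε * r)))) (Ioi 0) := by
  have h1 : IntegrableOn (fun r ↦ 2 * (min 1 (r / 2) * g (r / 2))) (Ioi 0) := by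
    have := (integrableOn_Ioi_comp_mul_right_iff (fun r ↦ min 1 r * g r) 0
      (a := 1 / 2) (by norm_num)).2 (by simpa using hi)
    simp only [mul_one_div] at this
    exact this.const_mul 2
  have h2 : IntegrableOn (fun r ↦ g (1 / 2) * Real.exp (-ε * r)) (Ioi 0) :=
    (integrableOn_exp_mul_Ioi (by linarith) 0).const_mul _
  have hm : AEStronglyMeasurable (fun r ↦ g (r / 2)) (volume.restrict (Ioi 0)) := by
    refine ContinuousOn.aestronglyMeasurable ?_ measurableSet_Ioi
    exact hg.1.continuousOn.comp (by fun_prop) fun r (hr : 0 < r) ↦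
      mem_Ioi.2 (half_pos hr)
  refine (h1.add h2).mono' ?_ ?_
  · exact AEStronglyMeasurable.mul (Measurable.aestronglyMeasurable (by fun_prop))
      ((hm.add aestronglyMeasurable_const).mul (Measurable.aestronglyMeasurable (by fun_prop)))
  · filter_upwards [ae_restrict_mem measurableSet_Ioi] with r hr
    have hr : 0 < r := hr
    have g1 := hg.nonneg (half_pos hr)
    have g2 := hg.nonneg (x := 1 / 2) (by norm_num)
    have hmin : 0 ≤ min 1 r := le_min zero_le_one hr.le
    have he : Real.exp (-(ε * r)) ≤ 1 :=
      Real.exp_le_one_iff.2 (neg_nonpos.2 (mul_nonneg hε.le hr.le))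
    have hmm : min 1 r ≤ 2 * min 1 (r / 2) := by
      rcases le_total 1 (r / 2) with h | h
      · rw [min_eq_left h]; linarith [min_le_left 1 r]
      · rw [min_eq_right h]; linarith [min_le_right 1 r]
    rw [Real.norm_of_nonneg (by positivity)]
    simp only [Pi.add_apply, neg_mul]
    calc min 1 r * ((g (r / 2) + g (1 / 2)) * Real.exp (-(ε * r)))
        = min 1 r * g (r / 2) * Real.exp (-(ε * r)) +
          min 1 r * (g (1 / 2) * Real.exp (-(ε * r))) := by ring
      _ ≤ 2 * min 1 (r / 2) * g (r / 2) * 1 + 1 * (g (1 / 2) * Real.exp (-(ε * r))) := by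
          gcongr
          exact min_le_left 1 r
      _ = _ := by ring

/-- The points at which a completely monotone function is expanded. -/
noncomputable def node (n : ℕ) (r : ℝ) : ℝ := ((n : ℝ) + 1) * (1 - Real.exp (-(r / (n + 1))))

lemma node_lt (n : ℕ) (r : ℝ) : node n r < n + 1 := by
  have := Real.exp_pos (-(r / (n + 1)))
  rw [node]
  nlinarith

/-- The lower bound does not depend on `n`; since `g` decreases, it dominates `g (node n r)`
uniformly. -/
lemma min_le_node (n : ℕ) {r : ℝ} (hr : 0 < r) : min 1 r / 2 ≤ node n r := by
  have hn : (0 : ℝ) < n + 1 := by positivity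
  have h := min_one_le_two_mul_one_sub_exp (x := r / (n + 1)) (by positivity)
  rw [one_mul] at h
  have h2 : min 1 r ≤ (n + 1) * min 1 (r / (n + 1)) := by
    rw [mul_min_of_nonneg _ _ hn.le, mul_one, mul_div_cancel₀ _ hn.ne']
    exact min_le_min_right _ (by linarith [n.cast_nonneg (α := ℝ)])
  rw [node]
  nlinarith

lemma node_pos (n : ℕ) {r : ℝ} (hr : 0 < r) : 0 < node n r :=
  lt_of_lt_of_le (half_pos (lt_min one_pos hr)) (min_le_node n hr)

lemma tendsto_node (r : ℝ) : Tendsto (fun n ↦ node n r) atTop (𝓝 r) := by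
  have hd : HasDerivAt (fun t : ℝ ↦ -Real.exp (-(r * t))) r 0 := by
    have h1 : HasDerivAt (fun t : ℝ ↦ -Real.exp (-(r * t))) (-(Real.exp (-(r * 0)) * -(r * 1))) 0 :=
      (((hasDerivAt_id (0 : ℝ)).const_mul r).neg.exp).neg
    simpa using h1
  rw [hasDerivAt_iff_tendsto_slope_zero] at hd
  have ht : Tendsto (fun n : ℕ ↦ (1 : ℝ) / (n + 1)) atTop (𝓝[≠] 0) :=
    tendsto_nhdsWithin_iff.2 ⟨tendsto_one_div_add_atTop_nhds_zero_nat,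
      .of_forall fun n ↦ (by positivity : (0 : ℝ) < 1 / (n + 1)).ne'⟩
  refine (hd.comp ht).congr fun n ↦ ?_
  simp only [Function.comp_apply, one_div, inv_inv, zero_add, smul_eq_mul, mul_zero, neg_zero,
    Real.exp_zero, node]
  rw [div_eq_mul_inv]
  ring

lemma apply_node_le (hg : IsCompletelyMonotone g) (n : ℕ) {r : ℝ} (hr : 0 < r) :
    g (node n r) ≤ g (r / 2) + g (1 / 2) := by
  refine (hg.anti (half_pos (lt_min one_pos hr)) (min_le_node n hr)).trans ?_
  have g1 := hg.nonneg (half_pos hr)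
  have g2 := hg.nonneg (x := 1 / 2) (by norm_num)
  rcases le_total 1 r with h | h
  · rw [min_eq_left h]; linarith
  · rw [min_eq_right h]; linarith

/-- The expansion of `g (node n r)` in exponentials. -/
lemma hasSum_node (hg : IsCompletelyMonotone g) (n : ℕ) (ε : ℝ) {r : ℝ} (hr : 0 < r) :
    HasSum (fun k : ℕ ↦ (-1) ^ k * iteratedDeriv k g (n + 1) / k.factorial * ((n : ℝ) + 1) ^ k *
      Real.exp (-((k / (n + 1) + ε) * r))) (g (node n r) * Real.exp (-(ε * r))) := by
  refine ((hg.hasSum (node_pos n hr) (node_lt n r)).mul_right (Real.exp (-(ε * r)))).congr_fun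
    fun k ↦ ?_
  -- The node is chosen for this identity: powers of the distance to the centre `n + 1` become pure
  -- exponentials in `r`, with nonnegative coefficients.
  have e1 : (n : ℝ) + 1 - node n r = (n + 1) * Real.exp (-(r / (n + 1))) := by
    rw [node]; ring
  rw [e1, mul_pow, ← Real.exp_nat_mul, ← mul_assoc, mul_assoc _ (Real.exp _) (Real.exp _),
    ← Real.exp_add]
  congr 2
  ring

/-- Bernstein's theorem for Lévy densities. -/
theorem hasCbfRep_levyIntegral (hg : IsCompletelyMonotone g)
    (hi : IntegrableOn (fun r ↦ min 1 r * g r) (Ioi 0)) : HasCbfRep (levyIntegral g) := by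
  -- Limit of partial sums. The shift `ε` is needed because the term `k = 0` would otherwise be a
  -- constant density, whose Lévy integral diverges.
  have h1 (n : ℕ) {ε : ℝ} (hε : 0 < ε) :
      HasCbfRep (levyIntegral fun r ↦ g (node n r) * Real.exp (-(ε * r))) := by
    refine .levyIntegral_of_tendsto (h := fun N r ↦ ∑ k ∈ Finset.range N,
        (-1) ^ k * iteratedDeriv k g (n + 1) / k.factorial * ((n : ℝ) + 1) ^ k *
          Real.exp (-((k / (n + 1) + ε) * r))) (fun N ↦ Continuous.aestronglyMeasurable
        (by fun_prop)) (hg.integrableOn_min_mul_bound hi hε) (fun N r hr ↦ ?_)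
      (fun r hr ↦ (hg.hasSum_node n ε hr).tendsto_sum_nat)
      (fun N ↦ hasCbfRep_levyIntegral_sum (fun k ↦ ?_) (fun k ↦ by positivity) N)
    · have h0 (k : ℕ) : 0 ≤ (-1) ^ k * iteratedDeriv k g (n + 1) / k.factorial *
          ((n : ℝ) + 1) ^ k * Real.exp (-((k / (n + 1) + ε) * r)) := by
        have := hg.2 k (n + 1) (by positivity)
        positivity
      rw [abs_of_nonneg (Finset.sum_nonneg fun k _ ↦ h0 k)]
      refine (sum_le_hasSum _ (fun k _ ↦ h0 k) (hg.hasSum_node n ε hr)).trans ?_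
      gcongr
      exact hg.apply_node_le n hr
    · have := hg.2 k (n + 1) (by positivity)
      positivity
  have h2 {ε : ℝ} (hε : 0 < ε) : HasCbfRep (levyIntegral fun r ↦ g r * Real.exp (-(ε * r))) := by
    refine .levyIntegral_of_tendsto (fun n ↦ ?_) (hg.integrableOn_min_mul_bound hi hε)
      (fun n r hr ↦ ?_) (fun r hr ↦ ?_) (fun n ↦ h1 n hε)
    · refine (ContinuousOn.mul ?_ (by fun_prop)).aestronglyMeasurable measurableSet_Ioi
      exact hg.1.continuousOn.comp (by unfold node; fun_prop) fun r hr ↦ node_pos n hr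
    · rw [abs_of_nonneg (mul_nonneg (hg.nonneg (node_pos n hr)) (Real.exp_pos _).le)]
      gcongr
      exact hg.apply_node_le n hr
    · exact (((hg.1.continuousOn.continuousAt (Ioi_mem_nhds hr)).tendsto.comp
        (tendsto_node r))).mul_const _
  -- Finally `ε = 1 / (n + 1)` tends to `0`, with `g` itself as dominating function.
  refine .levyIntegral_of_tendsto (h := fun n r ↦ g r * Real.exp (-(1 / ((n : ℝ) + 1) * r)))
    (fun n ↦ hg.aestronglyMeasurable.mul (Measurable.aestronglyMeasurable (by fun_prop))) hi
    (fun n r hr ↦ ?_) (fun r hr ↦ ?_) (fun n ↦ h2 (by positivity))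
  · have hgr := hg.nonneg hr
    rw [abs_of_nonneg (by positivity)]
    exact mul_le_of_le_one_right hgr (Real.exp_le_one_iff.2 (neg_nonpos.2 (by positivity)))
  · have := ((tendsto_one_div_add_atTop_nhds_zero_nat (𝕜 := ℝ)).mul_const
      r).neg.rexp.const_mul (g r)
    simpa using this

end IsCompletelyMonotone

/-! ### Complete Bernstein functions have an integral representation -/

lemma IsBernsteinTriplet.ae_pos {f : ℝ≥0 → ℝ≥0} {a b : ℝ≥0} {m : Measure ℝ}
    (h : IsBernsteinTriplet f a b m) : ∀ᵐ x ∂m, 0 < x := by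
  rw [ae_iff]
  convert h.concentrated using 2
  exact Set.ext fun x ↦ not_lt

lemma IsBernsteinTriplet.integrable_min {f : ℝ≥0 → ℝ≥0} {a b : ℝ≥0} {m : Measure ℝ}
    (h : IsBernsteinTriplet f a b m) : Integrable (fun x ↦ min 1 x) m := by
  refine ⟨Measurable.aestronglyMeasurable (by fun_prop), ?_⟩
  rw [hasFiniteIntegral_iff_ofReal (h.ae_pos.mono fun x hx ↦ le_min zero_le_one hx.le)]
  exact h.levy

lemma IsBernsteinTriplet.integrable_one_sub_exp {f : ℝ≥0 → ℝ≥0} {a b : ℝ≥0} {m : Measure ℝ}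
    (h : IsBernsteinTriplet f a b m) {z : ℝ} (hz : 0 ≤ z) :
    Integrable (fun x ↦ 1 - Real.exp (-(z * x))) m := by
  refine (h.integrable_min.const_mul (1 + z)).mono' (Measurable.aestronglyMeasurable (by fun_prop))
    (h.ae_pos.mono fun x hx ↦ ?_)
  rw [Real.norm_of_nonneg (one_sub_exp_nonneg hz hx.le)]
  exact one_sub_exp_le hz hx.le

/-- A Bernstein function is continuous at the origin. -/
lemma IsBernsteinTriplet.tendsto_zero {f : ℝ≥0 → ℝ≥0} {a : ℝ≥0} {m : Measure ℝ}
    (h : IsBernsteinTriplet f a 0 m) : Tendsto f (𝓝[>] 0) (𝓝 (f 0)) := by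
  rw [← NNReal.tendsto_coe]
  simp_rw [h.repr]
  simp only [NNReal.coe_zero, zero_mul, neg_zero, Real.exp_zero, sub_self, integral_zero, add_zero]
  have : Tendsto (fun z : ℝ≥0 ↦ ∫ x, (1 - Real.exp (-(z * x))) ∂m) (𝓝[>] 0)
      (𝓝 (∫ _, (0 : ℝ) ∂m)) := by
    refine tendsto_integral_filter_of_dominated_convergence (fun x ↦ 2 * min 1 x)
      (.of_forall fun z ↦ Measurable.aestronglyMeasurable (by fun_prop)) ?_
      (h.integrable_min.const_mul 2) (.of_forall fun x ↦ ?_)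
    · have : ∀ᶠ z : ℝ≥0 in 𝓝[>] 0, z < 1 := nhdsWithin_le_nhds (Iio_mem_nhds one_pos)
      filter_upwards [this] with z hz
      refine h.ae_pos.mono fun x hx ↦ ?_
      rw [Real.norm_of_nonneg (one_sub_exp_nonneg z.coe_nonneg hx.le)]
      refine (one_sub_exp_le z.coe_nonneg hx.le).trans ?_
      have : (z : ℝ) < 1 := by exact_mod_cast hz
      have h0 : 0 ≤ min 1 x := le_min zero_le_one hx.le
      gcongr
      change (1 : ℝ) + (z : ℝ) ≤ 2
      linarith
    · have : Tendsto (fun z : ℝ≥0 ↦ 1 - Real.exp (-(z * x))) (𝓝 0)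
          (𝓝 (1 - Real.exp (-(((0 : ℝ≥0) : ℝ) * x)))) :=
        Continuous.tendsto (by fun_prop) 0
      simp only [NNReal.coe_zero, zero_mul, neg_zero, Real.exp_zero, sub_self] at this
      exact this.mono_left nhdsWithin_le_nhds
  simpa using this.const_add (a : ℝ)

/-- A Bernstein function without drift is sublinear. -/
lemma IsBernsteinTriplet.tendsto_div {f : ℝ≥0 → ℝ≥0} {a : ℝ≥0} {m : Measure ℝ}
    (h : IsBernsteinTriplet f a 0 m) :
    Tendsto (fun n : ℕ ↦ (f ((n : ℝ≥0) + 1) : ℝ) / (n + 1)) atTop (𝓝 0) := by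
  have h1 : Tendsto (fun n : ℕ ↦ ∫ x, (1 - Real.exp (-(((n : ℝ) + 1) * x))) / (n + 1) ∂m) atTop
      (𝓝 (∫ _, (0 : ℝ) ∂m)) := by
    refine tendsto_integral_of_dominated_convergence (fun x ↦ 2 * min 1 x)
      (fun n ↦ Measurable.aestronglyMeasurable (by fun_prop)) (h.integrable_min.const_mul 2)
      (fun n ↦ h.ae_pos.mono fun x hx ↦ ?_) (h.ae_pos.mono fun x hx ↦ ?_)
    · have hn : (0 : ℝ) < n + 1 := by positivity
      rw [Real.norm_of_nonneg (div_nonneg (one_sub_exp_nonneg hn.le hx.le) hn.le), div_le_iff₀ hn]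
      refine (one_sub_exp_le hn.le hx.le).trans ?_
      have h0 : 0 ≤ min 1 x := le_min zero_le_one hx.le
      have := n.cast_nonneg (α := ℝ)
      nlinarith
    · refine squeeze_zero (fun n ↦ div_nonneg (one_sub_exp_nonneg (by positivity) hx.le)
        (by positivity)) (fun n ↦ ?_) (tendsto_one_div_add_atTop_nhds_zero_nat (𝕜 := ℝ))
      have := Real.exp_pos (-(((n : ℝ) + 1) * x))
      gcongr
      linarith
  have h2 := ((tendsto_one_div_add_atTop_nhds_zero_nat (𝕜 := ℝ)).const_mul (a : ℝ)).add h1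
  simp only [mul_zero, integral_zero, add_zero] at h2
  refine h2.congr fun n ↦ ?_
  rw [h.repr, integral_div]
  push_cast
  ring

/-- The killing rate is a multiple of the Dirac mass at `1`, and the Lévy part is represented by
Bernstein's theorem. Without drift `f` is sublinear, so the limit of `f z / z`, which is the mass at
`0`, vanishes. -/
theorem exists_cbfTransform_eq {f : ℝ≥0 → ℝ≥0} (hf : f ∈ CBFflat) :
    ∃ ρ : Measure I, IsFiniteMeasure ρ ∧ ρ {0} = 0 ∧
      ∀ z : ℝ≥0, 0 < z → cbfTransform ρ (z : ℝ) = ((f z : ℝ) : ℂ) := by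
  obtain ⟨a, g, hg, h⟩ := hf
  have hgm : AEMeasurable (fun x ↦ ENNReal.ofReal (g x)) (volume.restrict (Ioi (0 : ℝ))) :=
    hg.aestronglyMeasurable.aemeasurable.ennreal_ofReal
  have hfin : ∀ᵐ x ∂volume.restrict (Ioi (0 : ℝ)), ENNReal.ofReal (g x) < ∞ :=
    .of_forall fun x ↦ ENNReal.ofReal_lt_top
  have hi : IntegrableOn (fun r ↦ min 1 r * g r) (Ioi 0) := by
    have := (integrable_withDensity_iff_integrable_smul₀' hgm hfin).1 h.integrable_min
    refine Integrable.congr this ?_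
    filter_upwards [ae_restrict_mem measurableSet_Ioi] with r hr
    rw [ENNReal.toReal_ofReal (hg.nonneg hr), smul_eq_mul, mul_comm]
  have hrep (z : ℝ≥0) : (f z : ℝ) = a + levyIntegral g z := by
    rw [h.repr, integral_withDensity_eq_integral_toReal_smul₀ hgm hfin, NNReal.coe_zero, zero_mul,
      add_zero, levyIntegral]
    congr 1
    refine setIntegral_congr_fun measurableSet_Ioi fun r hr ↦ ?_
    rw [ENNReal.toReal_ofReal (hg.nonneg hr), smul_eq_mul, mul_comm]
  obtain ⟨ρ, hρ, hρf⟩ := ((hasCbfRep_dirac 1).const_mul a.coe_nonneg).add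
    (hg.hasCbfRep_levyIntegral hi)
  have key (z : ℝ≥0) (hz : 0 < z) : cbfTransform ρ (z : ℝ) = ((f z : ℝ) : ℂ) := by
    have hz' : (z : ℝ) ≠ 0 := by exact_mod_cast hz.ne'
    rw [hρf z (by exact_mod_cast hz), hrep]
    simp [hz']
  refine ⟨ρ, hρ, ?_, key⟩
  have h1 : Tendsto (fun n : ℕ ↦ (((n : ℝ) + 1 : ℝ) : ℂ)) atTop
      (Bornology.cobounded ℂ ⊓ 𝓟 wideSector) := by
    refine tendsto_inf.2 ⟨tendsto_norm_atTop_iff_cobounded.1 ?_, tendsto_principal.2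
      (.of_forall fun n ↦ ofReal_mem_wideSector (by positivity))⟩
    simp_rw [Complex.norm_real]
    exact tendsto_norm_atTop_atTop.comp
      (tendsto_atTop_add_const_right _ _ tendsto_natCast_atTop_atTop)
  have h2 := (tendsto_cbfTransform_div ρ).comp h1
  have h3 := (Complex.continuous_ofReal.tendsto _).comp h.tendsto_div
  have h4 := tendsto_nhds_unique h2 (h3.congr fun n ↦ by
    have := key ((n : ℝ≥0) + 1) (by positivity)
    push_cast at this
    simp [this])
  have h5 : ρ.real {0} = 0 := by exact_mod_cast h4
  exact (measureReal_eq_zero_iff).1 h5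

end FreeRegular

namespace FreeRegular

open unitInterval

/-! ### Uniqueness of the Laplace transform -/

section LaplaceUniqueness

variable {ν τ : Measure ℝ≥0} [IsFiniteMeasure ν] [IsFiniteMeasure τ]

lemma exp_neg_mul_coe_le_one (z : ℝ≥0) (y : ℝ≥0) : Real.exp (-((z : ℝ) * y)) ≤ 1 :=
  Real.exp_le_one_iff.2 (neg_nonpos.2 (mul_nonneg z.coe_nonneg y.coe_nonneg))

lemma integrable_exp_neg_mul (z : ℝ≥0) : Integrable (fun y : ℝ≥0 ↦ Real.exp (-((z : ℝ) * y))) ν :=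
  Integrable.of_bound (Measurable.aestronglyMeasurable (by fun_prop)) 1 (.of_forall fun y ↦ by
    rw [Real.norm_of_nonneg (Real.exp_pos _).le]
    exact exp_neg_mul_coe_le_one z y)

lemma tendsto_laplace : Tendsto (fun n : ℕ ↦ ∫ y : ℝ≥0, Real.exp (-((((1 : ℝ≥0) / (n + 1) : ℝ≥0) :
    ℝ) * y)) ∂ν) atTop (𝓝 (ν.real univ)) := by
  have : ν.real univ = ∫ _ : ℝ≥0, (1 : ℝ) ∂ν := by simp
  rw [this]
  refine tendsto_integral_of_dominated_convergence (fun _ ↦ 1)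
    (fun n ↦ Measurable.aestronglyMeasurable (by fun_prop)) (integrable_const _)
    (fun n ↦ .of_forall fun y ↦ ?_) (.of_forall fun y ↦ ?_)
  · rw [Real.norm_of_nonneg (Real.exp_pos _).le]
    exact exp_neg_mul_coe_le_one _ y
  · have := ((tendsto_one_div_add_atTop_nhds_zero_nat (𝕜 := ℝ)).mul_const (y : ℝ)).neg.rexp
    simpa using this

/-- Polynomials in `exp (-y)`. -/
def expPolynomials : StarSubalgebra ℝ (BoundedContinuousFunction ℝ≥0 ℝ) where
  carrier := {g | ∃ p : Polynomial ℝ, ∀ y : ℝ≥0, g y = p.eval (Real.exp (-(y : ℝ)))}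
  mul_mem' := by
    rintro g h ⟨p, hp⟩ ⟨q, hq⟩
    exact ⟨p * q, fun y ↦ by simp [hp, hq]⟩
  add_mem' := by
    rintro g h ⟨p, hp⟩ ⟨q, hq⟩
    exact ⟨p + q, fun y ↦ by simp [hp, hq]⟩
  algebraMap_mem' r := ⟨Polynomial.C r, fun y ↦ by simp⟩
  star_mem' := by
    rintro g ⟨p, hp⟩
    exact ⟨p, fun y ↦ by simp [hp]⟩

/-- Integer exponents suffice: polynomials in `e^{-y}` separate points. The constant term needs `z =
0`, which is reached as a limit. -/
theorem ext_of_laplace_eq (h : ∀ z : ℝ≥0, 0 < z → ∫ y : ℝ≥0, Real.exp (-((z : ℝ) * y)) ∂ν =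
    ∫ y : ℝ≥0, Real.exp (-((z : ℝ) * y)) ∂τ) : ν = τ := by
  have h0 (z : ℝ≥0) : ∫ y : ℝ≥0, Real.exp (-((z : ℝ) * y)) ∂ν =
      ∫ y : ℝ≥0, Real.exp (-((z : ℝ) * y)) ∂τ := by
    rcases eq_zero_or_pos z with rfl | hz
    · have := tendsto_nhds_unique (tendsto_laplace (ν := ν))
        ((tendsto_laplace (ν := τ)).congr fun n ↦ (h _ (by positivity)).symm)
      simpa using this
    · exact h z hz
  refine ext_of_forall_mem_subalgebra_integral_eq_of_polish (𝕜 := ℝ) (A := expPolynomials) ?_ ?_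
  · intro x y hxy
    let g : BoundedContinuousFunction ℝ≥0 ℝ := BoundedContinuousFunction.ofNormedAddCommGroup
      (fun y : ℝ≥0 ↦ Real.exp (-(y : ℝ))) (by fun_prop) 1 fun y ↦ by
        rw [Real.norm_of_nonneg (Real.exp_pos _).le]
        simp
    refine ⟨g, ⟨g.toContinuousMap, ⟨g, ⟨Polynomial.X, fun y ↦ by simp [g]⟩, rfl⟩, rfl⟩, ?_⟩
    change Real.exp (-(x : ℝ)) ≠ Real.exp (-(y : ℝ))
    simpa using hxy
  · rintro g ⟨p, hp⟩
    simp_rw [hp, Polynomial.eval_eq_sum_range]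
    have e (k : ℕ) (y : ℝ≥0) : p.coeff k * Real.exp (-(y : ℝ)) ^ k =
        p.coeff k * Real.exp (-(((k : ℝ≥0) : ℝ) * y)) := by
      rw [← Real.exp_nat_mul]
      simp
    simp_rw [e]
    have hi (k : ℕ) (P : Measure ℝ≥0) [IsFiniteMeasure P] :
        Integrable (fun y : ℝ≥0 ↦ p.coeff k * Real.exp (-(((k : ℝ≥0) : ℝ) * y))) P :=
      (integrable_exp_neg_mul _).const_mul _
    rw [integral_finsetSum _ fun k _ ↦ hi k ν, integral_finsetSum _ fun k _ ↦ hi k τ]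
    refine Finset.sum_congr rfl fun k _ ↦ ?_
    rw [integral_const_mul, integral_const_mul, h0]

lemma laplace_conv (z : ℝ≥0) : ∫ y : ℝ≥0, Real.exp (-((z : ℝ) * y)) ∂(ν.conv τ) =
    (∫ y : ℝ≥0, Real.exp (-((z : ℝ) * y)) ∂ν) * ∫ y : ℝ≥0, Real.exp (-((z : ℝ) * y)) ∂τ := by
  rw [integral_conv (integrable_exp_neg_mul z)]
  simp_rw [NNReal.coe_add, mul_add, neg_add, Real.exp_add, integral_const_mul]
  rw [integral_mul_const]

end LaplaceUniqueness

/-! ### Existence of sub-probability measures with given Laplace transform -/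

/-- Laplace transforms of sub-probability measures on `(0,∞]`, after the change of variables
`y = exp (-s)`. -/
def IsSubLaplace (L : ℝ → ℝ) : Prop :=
  ∃ ν : Measure I, ν univ ≤ 1 ∧ ∀ x : ℝ, 0 < x → L x = ∫ y : I, (y : ℝ) ^ x ∂ν

lemma isFiniteMeasure_of_le_one {α : Type*} [MeasurableSpace α] {ν : Measure α}
    (h : ν univ ≤ 1) : IsFiniteMeasure ν :=
  ⟨h.trans_lt ENNReal.one_lt_top⟩

lemma continuous_coe_rpow {x : ℝ} (hx : 0 < x) : Continuous fun y : I ↦ (y : ℝ) ^ x :=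
  (Real.continuous_rpow_const hx.le).comp continuous_subtype_val

lemma IsSubLaplace.congr {L L' : ℝ → ℝ} (hL : IsSubLaplace L) (h : ∀ x, 0 < x → L x = L' x) :
    IsSubLaplace L' := by
  obtain ⟨ν, hν, h'⟩ := hL
  exact ⟨ν, hν, fun x hx ↦ by rw [← h x hx, h' x hx]⟩

lemma isSubLaplace_const {c : ℝ} (hc : 0 ≤ c) (hc1 : c ≤ 1) : IsSubLaplace fun _ ↦ c := by
  refine ⟨ENNReal.ofReal c • Measure.dirac 1, by simpa using hc1, fun x hx ↦ ?_⟩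
  rw [integral_smul_measure, integral_dirac, ENNReal.toReal_ofReal hc]
  simp

lemma IsSubLaplace.mul {L L' : ℝ → ℝ} (hL : IsSubLaplace L) (hL' : IsSubLaplace L') :
    IsSubLaplace fun x ↦ L x * L' x := by
  obtain ⟨ν, hν, h⟩ := hL
  obtain ⟨τ, hτ, h'⟩ := hL'
  have := isFiniteMeasure_of_le_one hν
  have := isFiniteMeasure_of_le_one hτ
  refine ⟨ν.mconv τ, ?_, fun x hx ↦ ?_⟩
  · rw [Measure.mconv, Measure.map_apply (by fun_prop) MeasurableSet.univ, preimage_univ,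
      ← univ_prod_univ, Measure.prod_prod]
    exact mul_le_one' hν hτ
  · rw [integral_mconv (integrable_of_continuous (continuous_coe_rpow hx))]
    simp only [h x hx, h' x hx]
    simp_rw [Icc.coe_mul, fun y z : I ↦ Real.mul_rpow y.2.1 z.2.1 (z := x),
      integral_const_mul]
    rw [integral_mul_const]

lemma IsSubLaplace.pow {L : ℝ → ℝ} (hL : IsSubLaplace L) (n : ℕ) :
    IsSubLaplace fun x ↦ L x ^ n := by
  induction n with
  | zero => simpa using isSubLaplace_const zero_le_one le_rfl
  | succ n ih => simpa only [pow_succ] using ih.mul hL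

/-- On the compact interval mass can escape only to `y = 0`, the image of infinity, where `y ^ x`
vanishes for `x > 0`; hence limits stay in the class. -/
lemma IsSubLaplace.of_tendsto {L : ℕ → ℝ → ℝ} {L' : ℝ → ℝ} (hL : ∀ n, IsSubLaplace (L n))
    (h : ∀ x, 0 < x → Tendsto (fun n ↦ L n x) atTop (𝓝 (L' x))) : IsSubLaplace L' := by
  choose ν hν hL using hL
  have := fun n ↦ isFiniteMeasure_of_le_one (hν n)
  have hr (n : ℕ) : (ν n).real univ ≤ 1 :=
    ENNReal.toReal_le_of_le_ofReal zero_le_one (by simpa using hν n)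
  obtain ⟨ν', hν', hlim⟩ := exists_tendsto_integral hr
  have key (f : C(I, ℝ)) {l : ℝ} (hl : Tendsto (fun n ↦ ∫ y, f y ∂ν n) (hyperfilter ℕ) (𝓝 l)) :
      l = ∫ y, f y ∂ν' := by
    have h1 := hlim ⟨fun y ↦ (f y : ℂ), by fun_prop⟩
    simp only [ContinuousMap.coe_mk, integral_complex_ofReal] at h1
    have h2 := tendsto_nhds_unique ((Complex.continuous_ofReal.tendsto _).comp hl) h1
    exact_mod_cast h2
  refine ⟨ν', ?_, fun x hx ↦ ?_⟩
  · have h1 := hlim ⟨fun _ ↦ 1, by fun_prop⟩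
    have h2 : Tendsto (fun n ↦ (ν n).real univ) (hyperfilter ℕ) (𝓝 (ν'.real univ)) := by
      have := (Complex.continuous_re.tendsto _).comp h1
      simpa [Function.comp_def] using this
    have h3 := le_of_tendsto' h2 hr
    rw [Measure.real, ← ENNReal.toReal_one] at h3
    exact (ENNReal.toReal_le_toReal (measure_ne_top _ _) ENNReal.one_ne_top).1 h3
  · refine key ⟨fun y ↦ (y : ℝ) ^ x, continuous_coe_rpow hx⟩ ?_
    simp only [ContinuousMap.coe_mk, ← fun n ↦ hL n x hx]
    exact (h x hx).mono_left Nat.hyperfilter_le_atTop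

/-- The point of the unit interval that corresponds to the exponential rate `r`. -/
noncomputable def expPoint (r : ℝ) : I :=
  ⟨min 1 (Real.exp (-r)), le_min zero_le_one (Real.exp_pos _).le, min_le_left _ _⟩

lemma measurable_expPoint : Measurable expPoint :=
  Measurable.subtype_mk (by fun_prop)

/-- Compound Poisson distributions. -/
lemma isSubLaplace_exp_neg_finite {m : Measure ℝ} [IsFiniteMeasure m] (hm : ∀ᵐ x ∂m, 0 < x) :
    IsSubLaplace fun x ↦ Real.exp (-∫ r, (1 - Real.exp (-(x * r))) ∂m) := by
  set M := m.real univ with hM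
  have hM0 : 0 ≤ M := measureReal_nonneg
  obtain ⟨N, hN⟩ := exists_nat_gt M
  have hint {x : ℝ} (hx : 0 < x) : Integrable (fun r ↦ Real.exp (-(x * r))) m :=
    Integrable.of_bound (Measurable.aestronglyMeasurable (by fun_prop)) 1 (hm.mono fun r hr ↦ by
      rw [Real.norm_of_nonneg (Real.exp_pos _).le]
      exact Real.exp_le_one_iff.2 (neg_nonpos.2 (by positivity)))
  -- The mixture `(1 - M / n) δ₁ + m / n`, with `m` transported by `expPoint`, is a probability
  -- measure; the point `1` stands for the jump `0`. Its `n`-th convolution power converges to the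
  -- compound Poisson law.
  have key (n : ℕ) (hn : M < n) :
      IsSubLaplace fun x ↦ 1 + (-∫ r, (1 - Real.exp (-(x * r))) ∂m) / n := by
    have hn0 : (0 : ℝ) < n := hM0.trans_lt hn
    have h1 : 0 ≤ 1 - M / n := sub_nonneg.2 ((div_le_one hn0).2 hn.le)
    refine ⟨ENNReal.ofReal (1 - M / n) • Measure.dirac 1 +
      ENNReal.ofReal (1 / n) • m.map expPoint, ?_, fun x hx ↦ ?_⟩
    · rw [Measure.add_apply, Measure.smul_apply, Measure.smul_apply,
        Measure.map_apply measurable_expPoint MeasurableSet.univ, preimage_univ, measure_univ,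
        smul_eq_mul, smul_eq_mul, mul_one, ← ofReal_measureReal (μ := m),
        ← ENNReal.ofReal_mul (by positivity), ← ENNReal.ofReal_add h1 (by positivity)]
      refine ENNReal.ofReal_le_one.2 (le_of_eq ?_)
      rw [← hM]
      ring
    · have hc := continuous_coe_rpow hx
      have : IsFiniteMeasure (m.map expPoint) := Measure.isFiniteMeasure_map _ _
      have i1 : Integrable (fun y : I ↦ (y : ℝ) ^ x) (ENNReal.ofReal (1 - M / n) •
        Measure.dirac 1) := (integrable_of_continuous hc).smul_measure ENNReal.ofReal_ne_top
      have i2 : Integrable (fun y : I ↦ (y : ℝ) ^ x) (ENNReal.ofReal (1 / n) • m.map expPoint) :=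
        (integrable_of_continuous hc).smul_measure ENNReal.ofReal_ne_top
      rw [integral_add_measure i1 i2, integral_smul_measure, integral_smul_measure,
        ENNReal.toReal_ofReal h1, ENNReal.toReal_ofReal (by positivity), integral_dirac,
        integral_map measurable_expPoint.aemeasurable hc.aestronglyMeasurable]
      have e : ∫ r, (expPoint r : ℝ) ^ x ∂m = ∫ r, Real.exp (-(x * r)) ∂m := by
        refine integral_congr_ae (hm.mono fun r hr ↦ ?_)
        simp only [expPoint]
        rw [min_eq_right (Real.exp_le_one_iff.2 (neg_nonpos.2 hr.le)), ← Real.exp_mul]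
        ring_nf
      rw [e]
      simp only [integral_sub (integrable_const _) (hint hx), integral_const, smul_eq_mul,
        Icc.coe_one, Real.one_rpow]
      rw [← hM]
      field_simp
      ring
  refine .of_tendsto (L := fun n x ↦ (1 + (-∫ r, (1 - Real.exp (-(x * r))) ∂m) / (n + N + 1 : ℕ)) ^
    (n + N + 1)) (fun n ↦ (key _ ?_).pow _) fun x hx ↦ ?_
  · push_cast
    have := n.cast_nonneg (α := ℝ)
    linarith
  · exact (Real.tendsto_one_add_div_pow_exp _).comp
      (tendsto_add_atTop_nat (N + 1))

/-- Cutting the Lévy measure off below `1 / (n + 1)` makes it finite, which is the compound Poisson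
case; the killing rate contributes a constant factor. -/
lemma IsBernsteinTriplet.isSubLaplace {f : ℝ≥0 → ℝ≥0} {a : ℝ≥0} {m : Measure ℝ}
    (h : IsBernsteinTriplet f a 0 m) :
    IsSubLaplace fun x ↦ Real.exp (-a) * Real.exp (-∫ r, (1 - Real.exp (-(x * r))) ∂m) := by
  refine (isSubLaplace_const (Real.exp_pos _).le (Real.exp_le_one_iff.2
    (neg_nonpos.2 a.coe_nonneg))).mul ?_
  let s (n : ℕ) : Set ℝ := Ioi (1 / ((n : ℝ) + 1))
  have hs (n : ℕ) : MeasurableSet (s n) := measurableSet_Ioi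
  refine .of_tendsto (L := fun n x ↦ Real.exp (-∫ r in s n, (1 - Real.exp (-(x * r))) ∂m))
    (fun n ↦ ?_) fun x hx ↦ ?_
  · have : IsFiniteMeasure (m.restrict (s n)) := by
      have hi := h.integrable_min
      have h1 := hi.measure_norm_ge_lt_top (ε := 1 / ((n : ℝ) + 1)) (by positivity)
      refine ⟨?_⟩
      rw [Measure.restrict_apply_univ]
      refine (measure_mono fun r hr ↦ ?_).trans_lt h1
      have hr' : 1 / ((n : ℝ) + 1) < r := hr
      have h2 : 1 / ((n : ℝ) + 1) ≤ 1 := (div_le_one (by positivity)).2 (by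
        linarith [n.cast_nonneg (α := ℝ)])
      exact (le_min h2 hr'.le).trans (le_abs_self _)
    exact isSubLaplace_exp_neg_finite (ae_restrict_of_ae h.ae_pos)
  · refine (Tendsto.neg ?_).rexp
    simp_rw [← integral_indicator (hs _)]
    have hi := h.integrable_one_sub_exp hx.le
    refine tendsto_integral_of_dominated_convergence (fun r ↦ ‖1 - Real.exp (-(x * r))‖)
      (fun n ↦ (hi.indicator (hs n)).aestronglyMeasurable) hi.norm
      (fun n ↦ .of_forall fun r ↦ norm_indicator_le_norm_self _ _) (h.ae_pos.mono fun r hr ↦ ?_)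
    refine tendsto_const_nhds.congr' ?_
    have := (tendsto_one_div_add_atTop_nhds_zero_nat (𝕜 := ℝ)).eventually (Iio_mem_nhds hr)
    filter_upwards [this] with n hn
    rw [indicator_of_mem (show r ∈ s n from hn)]

/-- The point of `[0,∞)` that corresponds to a point of the unit interval. -/
noncomputable def negLog (y : I) : ℝ≥0 := Real.toNNReal (-Real.log y)

lemma measurable_negLog : Measurable negLog := by
  unfold negLog
  fun_prop

/-- Mass at `y = 0` is discarded: it sits at infinity and does not contribute, because `0 ^ z = 0`
for `z > 0`. -/
lemma IsSubLaplace.exists_measure {L : ℝ → ℝ} (h : IsSubLaplace L) :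
    ∃ ν : Measure ℝ≥0, ν univ ≤ 1 ∧
      ∀ z : ℝ≥0, 0 < z → ∫ y : ℝ≥0, Real.exp (-((z : ℝ) * y)) ∂ν = L z := by
  obtain ⟨ν, hν, h⟩ := h
  have := isFiniteMeasure_of_le_one hν
  refine ⟨(ν.restrict {0}ᶜ).map negLog, ?_, fun z hz ↦ ?_⟩
  · rw [Measure.map_apply measurable_negLog MeasurableSet.univ, preimage_univ,
      Measure.restrict_apply_univ]
    exact (measure_mono (subset_univ _)).trans hν
  · have hz' : (0 : ℝ) < z := hz
    rw [integral_map measurable_negLog.aemeasurable (Measurable.aestronglyMeasurable (by fun_prop)),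
      h z hz', ← setIntegral_eq_integral_of_forall_compl_eq_zero
        (f := fun y : I ↦ (y : ℝ) ^ (z : ℝ)) (s := {0}ᶜ)]
    · refine setIntegral_congr_fun (measurableSet_singleton (0 : I)).compl fun y hy ↦ ?_
      have hy0 : 0 < (y : ℝ) := lt_of_le_of_ne y.2.1 fun h ↦ hy (Subtype.ext h.symm)
      simp only [negLog]
      rw [Real.coe_toNNReal _ (neg_nonneg.2 (Real.log_nonpos y.2.1 y.2.2)),
        Real.rpow_def_of_pos hy0]
      ring_nf
    · intro y hy
      rw [notMem_compl_iff, mem_singleton_iff] at hy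
      rw [hy]
      simp [hz.ne']

theorem exists_hasLaplaceExponent {f : ℝ≥0 → ℝ≥0} (hf : f ∈ CBFflat) :
    ∃ ν : Measure ℝ≥0, ν univ ≤ 1 ∧ HasLaplaceExponent ν f := by
  obtain ⟨a, g, -, h⟩ := hf
  obtain ⟨ν, hν, hL⟩ := h.isSubLaplace.exists_measure
  refine ⟨ν, hν, fun z hz ↦ ?_⟩
  rw [hL z hz, h.repr, NNReal.coe_zero, zero_mul, add_zero, neg_add, Real.exp_add]

/-! ### The class of complete Bernstein functions -/

lemma IsCompletelyMonotone.const_mul {g : ℝ → ℝ} (hg : IsCompletelyMonotone g) (t : ℝ≥0) :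
    IsCompletelyMonotone fun x ↦ t * g x := by
  refine ⟨contDiffOn_const.mul hg.1, fun n x hx ↦ ?_⟩
  rw [iteratedDeriv_const_mul_field, mul_left_comm]
  exact mul_nonneg t.coe_nonneg (hg.2 n x hx)

lemma IsBernsteinTriplet.const_mul {f : ℝ≥0 → ℝ≥0} {a b : ℝ≥0} {m : Measure ℝ}
    (h : IsBernsteinTriplet f a b m) (t : ℝ≥0) :
    IsBernsteinTriplet (fun z ↦ t * f z) (t * a) (t * b) ((t : ℝ≥0∞) • m) where
  concentrated := by simp [h.concentrated]
  levy := by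
    rw [lintegral_smul_measure]
    exact ENNReal.mul_lt_top ENNReal.coe_lt_top h.levy
  repr z := by
    rw [integral_smul_measure, NNReal.coe_mul, h.repr, NNReal.coe_mul, NNReal.coe_mul,
      ENNReal.coe_toReal, smul_eq_mul]
    ring

lemma const_mul_mem_CBFflat {f : ℝ≥0 → ℝ≥0} (hf : f ∈ CBFflat) (t : ℝ≥0) :
    (fun z ↦ t * f z) ∈ CBFflat := by
  obtain ⟨a, g, hg, h⟩ := hf
  refine ⟨t * a, fun x ↦ t * g x, hg.const_mul t, ?_⟩
  have := h.const_mul t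
  rw [mul_zero, ← withDensity_smul' _ _ ENNReal.coe_ne_top] at this
  convert this using 3 with x
  rw [ENNReal.ofReal_mul t.coe_nonneg, ENNReal.ofReal_coe_nnreal]
  rfl

lemma tendsto_zero_of_mem_CBFflat {f : ℝ≥0 → ℝ≥0} (hf : f ∈ CBFflat) :
    Tendsto f (𝓝[>] 0) (𝓝 (f 0)) := by
  obtain ⟨a, g, -, h⟩ := hf
  exact h.tendsto_zero

lemma eq_of_eq_pos {f f' : ℝ≥0 → ℝ≥0} (hf : Tendsto f (𝓝[>] 0) (𝓝 (f 0)))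
    (hf' : Tendsto f' (𝓝[>] 0) (𝓝 (f' 0))) (h : ∀ z, 0 < z → f z = f' z) : f = f' := by
  funext z
  rcases eq_zero_or_pos z with rfl | hz
  · refine tendsto_nhds_unique hf (hf'.congr' ?_)
    filter_upwards [self_mem_nhdsWithin] with z hz using (h z hz).symm
  · exact h z hz

/-- Additive functions on the nonnegative half-line are linear. -/
lemma eq_mul_one_of_add {h : ℝ≥0 → ℝ≥0} (hadd : ∀ s t, h (s + t) = h s + h t) (t : ℝ≥0) :
    h t = t * h 1 := by
  have hnat (n : ℕ) (t : ℝ≥0) : h (n * t) = n * h t := by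
    induction n with
    | zero =>
      have := hadd 0 0
      rw [add_zero, left_eq_add] at this
      simpa using this
    | succ n ih => rw [Nat.cast_succ, add_mul, hadd, ih, one_mul, add_mul, one_mul]
  have hmono {s t : ℝ≥0} (hst : s ≤ t) : h s ≤ h t := by
    rw [← add_tsub_cancel_of_le hst, hadd]
    exact le_self_add
  -- Monotonicity traps both `h (n t) = n h t` and `n t h 1` between consecutive integer multiples
  -- of `h 1`, so the discrepancy stays bounded while `n` grows.
  have key (n : ℕ) : (n : ℝ) * |(h t : ℝ) - t * h 1| ≤ h 1 := by
    have h1 : ((⌊n * t⌋₊ : ℝ≥0)) ≤ n * t := Nat.floor_le zero_le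
    have h2 : (n : ℝ≥0) * t ≤ (⌊n * t⌋₊ + 1 : ℕ) := by
      push_cast
      exact (Nat.lt_floor_add_one _).le
    have h3 := hmono h1
    have h4 := hmono h2
    rw [← mul_one (⌊n * t⌋₊ : ℝ≥0), hnat, hnat] at h3
    rw [← mul_one ((⌊n * t⌋₊ + 1 : ℕ) : ℝ≥0), hnat, hnat] at h4
    have h5 : ((⌊n * t⌋₊ : ℝ≥0)) * h 1 ≤ n * t * h 1 := by gcongr
    have h6 : (n : ℝ≥0) * t * h 1 ≤ (⌊n * t⌋₊ + 1 : ℕ) * h 1 := by gcongr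
    rw [← NNReal.coe_le_coe] at h3 h4 h5 h6
    push_cast at h3 h4 h5 h6
    rw [← abs_of_nonneg n.cast_nonneg (α := ℝ), ← abs_mul, abs_le]
    constructor <;> linarith
  by_contra hne
  have hpos : 0 < |(h t : ℝ) - t * h 1| := abs_pos.2 (sub_ne_zero.2 (by exact_mod_cast hne))
  obtain ⟨n, hn⟩ := exists_nat_gt ((h 1 : ℝ) / |(h t : ℝ) - t * h 1|)
  rw [div_lt_iff₀ hpos] at hn
  exact (key n).not_gt hn

/-! ### Bondesson semigroups -/

lemma HasLaplaceExponent.eq_of_pos {ν : Measure ℝ≥0} {f f' : ℝ≥0 → ℝ≥0}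
    (h : HasLaplaceExponent ν f) (h' : HasLaplaceExponent ν f') (z : ℝ≥0) (hz : 0 < z) :
    f z = f' z := by
  have := (h z hz).symm.trans (h' z hz)
  rw [Real.exp_eq_exp, neg_inj] at this
  exact_mod_cast this

lemma HasLaplaceExponent.ext {ν τ : Measure ℝ≥0} {f : ℝ≥0 → ℝ≥0} (hν : ν univ ≤ 1)
    (hτ : τ univ ≤ 1) (h : HasLaplaceExponent ν f) (h' : HasLaplaceExponent τ f) : ν = τ := by
  have := isFiniteMeasure_of_le_one hν
  have := isFiniteMeasure_of_le_one hτ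
  exact ext_of_laplace_eq fun z hz ↦ (h z hz).trans (h' z hz).symm

lemma HasLaplaceExponent.conv {ν τ : Measure ℝ≥0} {f g : ℝ≥0 → ℝ≥0} (hν : ν univ ≤ 1)
    (hτ : τ univ ≤ 1) (h : HasLaplaceExponent ν f) (h' : HasLaplaceExponent τ g) :
    HasLaplaceExponent (ν.conv τ) fun z ↦ f z + g z := by
  have := isFiniteMeasure_of_le_one hν
  have := isFiniteMeasure_of_le_one hτ
  intro z hz
  rw [laplace_conv, h z hz, h' z hz, NNReal.coe_add, neg_add, Real.exp_add]

lemma conv_univ_le_one {ν τ : Measure ℝ≥0} (hν : ν univ ≤ 1) (hτ : τ univ ≤ 1) :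
    ν.conv τ univ ≤ 1 := by
  have := isFiniteMeasure_of_le_one hν
  have := isFiniteMeasure_of_le_one hτ
  rw [Measure.conv, Measure.map_apply (by fun_prop) MeasurableSet.univ, preimage_univ,
    ← univ_prod_univ, Measure.prod_prod]
  exact mul_le_one' hν hτ

theorem existsUnique_isBondessonFlatSemigroup {f : ℝ≥0 → ℝ≥0} (hf : f ∈ CBFflat) :
    ∃! ν : ℝ≥0 → Measure ℝ≥0, IsBondessonFlatSemigroup ν ∧
      ∀ t, HasLaplaceExponent (ν t) fun z ↦ t * f z := by
  choose ν hν hL using fun t ↦ exists_hasLaplaceExponent (const_mul_mem_CBFflat hf t)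
  refine ⟨ν, ⟨⟨fun t ↦ ⟨hν t, _, const_mul_mem_CBFflat hf t, hL t⟩, fun s t ↦ ?_⟩, hL⟩, ?_⟩
  · refine (hL (s + t)).ext (hν _) (conv_univ_le_one (hν s) (hν t)) ?_
    simp_rw [add_mul]
    exact (hL s).conv (hν s) (hν t) (hL t)
  · rintro τ ⟨hτ, hτL⟩
    funext t
    exact (hτL t).ext (hτ.1 t).1 (hν t) (hL t)

/-- Convolution adds Laplace exponents, so for fixed `z > 0` the exponent is additive in `t` and
therefore linear; the value at `z = 0` follows by continuity. -/
theorem IsBondessonFlatSemigroup.existsUnique {ν : ℝ≥0 → Measure ℝ≥0}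
    (hν : IsBondessonFlatSemigroup ν) :
    ∃! f : ℝ≥0 → ℝ≥0, f ∈ CBFflat ∧ ∀ t, HasLaplaceExponent (ν t) fun z ↦ t * f z := by
  obtain ⟨hB, hadd⟩ := hν
  choose h1 f hf hL using hB
  have key (z : ℝ≥0) (hz : 0 < z) (t : ℝ≥0) : f t z = t * f 1 z :=
    eq_mul_one_of_add (h := fun t ↦ f t z) (fun s t ↦ (hL (s + t)).eq_of_pos
      (hadd s t ▸ (hL s).conv (h1 s) (h1 t) (hL t)) z hz) t
  refine ⟨f 1, ⟨hf 1, fun t z hz ↦ ?_⟩, ?_⟩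
  · simp only
    rw [hL t z hz, key z hz t]
  · rintro f' ⟨hf', hL'⟩
    refine eq_of_eq_pos (tendsto_zero_of_mem_CBFflat hf') (tendsto_zero_of_mem_CBFflat (hf 1))
      fun z hz ↦ ?_
    simpa using (hL' 1).eq_of_pos (hL 1) z hz

end FreeRegular

namespace FreeRegular

open Complex (slitPlane)
open unitInterval

/-! ### The domain of continuation -/

/-- The upper half-plane together with the negative half-axis. -/
def continuationDomain : Set ℂ := {z | 0 < z.im ∨ (z.im = 0 ∧ z.re < 0)}

lemma neg_mem_slitPlane {z : ℂ} (hz : z ∈ continuationDomain) : -z ∈ slitPlane := by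
  rw [Complex.mem_slitPlane_iff]
  rcases hz with hz | hz
  · exact Or.inr (by simpa using hz.ne')
  · exact Or.inl (by simpa using hz.2)

/-- Convexity yields the connectedness on which the uniqueness of the continuation rests. -/
lemma convex_continuationDomain : Convex ℝ continuationDomain := by
  rw [convex_iff_forall_pos]
  rintro z hz w hw a b ha hb -
  simp only [continuationDomain, mem_ofPred_eq, Complex.add_re, Complex.real_smul,
    Complex.re_ofReal_mul, Complex.add_im, Complex.im_ofReal_mul]
  rcases hz with hz | ⟨hz, hz'⟩ <;> rcases hw with hw | ⟨hw, hw'⟩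
  · left; positivity
  · left; rw [hw, mul_zero, add_zero]; positivity
  · left; rw [hz, mul_zero, zero_add]; positivity
  · right
    rw [hz, hw]
    refine ⟨by simp, ?_⟩
    nlinarith

lemma truncatedCone_subset_continuationDomain {α M : ℝ} (hM : 0 ≤ M) :
    truncatedCone α M ⊆ continuationDomain :=
  fun _ hz ↦ Or.inl (im_pos_of_mem_truncatedCone hM hz)

lemma neg_ofReal_mem_continuationDomain {x : ℝ} (hx : 0 < x) : -(x : ℂ) ∈ continuationDomain :=
  Or.inr (by simpa using hx)

lemma analyticOnNhd_cbfTransform_neg (ρ : Measure I) [IsFiniteMeasure ρ] :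
    AnalyticOnNhd ℂ (fun z ↦ cbfTransform ρ (-z)) continuationDomain := fun _ hz ↦
  ((differentiableOn_cbfTransform ρ).analyticOnNhd Complex.isOpen_slitPlane _
    (neg_mem_slitPlane hz)).comp analyticAt_id.neg

lemma eqOn_continuationDomain_of_cone {φ φ' : ℂ → ℂ} (h : AnalyticOnNhd ℂ φ continuationDomain)
    (h' : AnalyticOnNhd ℂ φ' continuationDomain) {α M : ℝ} (hα : 0 < α) (hM : 0 < M)
    (he : EqOn φ φ' (truncatedCone α M)) : EqOn φ φ' continuationDomain := by
  have hz : ((M + 1 : ℝ) : ℂ) * Complex.I ∈ truncatedCone α M :=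
    mul_I_mem_truncatedCone hα hM.le (by linarith)
  exact h.eqOn_of_preconnected_of_eventuallyEq h' convex_continuationDomain.isPreconnected
    (truncatedCone_subset_continuationDomain hM.le hz)
    (he.eventuallyEq_of_mem ((isOpen_truncatedCone α M).mem_nhds hz))

lemma eqOn_continuationDomain_of_neg {φ φ' : ℂ → ℂ} (h : AnalyticOnNhd ℂ φ continuationDomain)
    (h' : AnalyticOnNhd ℂ φ' continuationDomain)
    (he : ∀ z : ℝ≥0, 0 < z → φ (-((z : ℝ) : ℂ)) = φ' (-((z : ℝ) : ℂ))) :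
    EqOn φ φ' continuationDomain := by
  refine h.eqOn_of_preconnected_of_frequently_eq h' convex_continuationDomain.isPreconnected
    (neg_ofReal_mem_continuationDomain one_pos) ?_
  have ht : Tendsto (fun n : ℕ ↦ -(((1 : ℝ) + 1 / ((n : ℝ) + 1) : ℝ) : ℂ)) atTop
      (𝓝[≠] (-((1 : ℝ) : ℂ))) := by
    refine tendsto_nhdsWithin_iff.2 ⟨?_, .of_forall fun n ↦ ?_⟩
    · have := (tendsto_one_div_add_atTop_nhds_zero_nat (𝕜 := ℝ)).const_add 1
      rw [add_zero] at this
      exact ((Complex.continuous_ofReal.tendsto _).comp this).neg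
    · rw [mem_compl_singleton_iff, Ne, neg_inj, Complex.ofReal_inj, add_eq_left]
      positivity
  refine ht.frequently (.of_forall fun n ↦ ?_)
  have hx : (0 : ℝ) < 1 + 1 / ((n : ℝ) + 1) := by positivity
  exact he ⟨_, hx.le⟩ hx

/-! ### Free regular measures -/

lemma cbfTransform_smul (ρ : Measure I) (t : ℝ≥0) (w : ℂ) :
    cbfTransform ((t : ℝ≥0∞) • ρ) w = ((t : ℝ) : ℂ) * cbfTransform ρ w := by
  rw [cbfTransform, integral_smul_measure, ← cbfTransform, ENNReal.coe_toReal, Complex.real_smul]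

variable {ρ : Measure I} [IsFiniteMeasure ρ]

lemma exists_isVoiculescuTransform_const_mul (h0 : ρ {0} = 0) (t : ℝ≥0) :
    ∃ μ : ProbabilityMeasure ℝ, (μ : Measure ℝ) (Iio 0) = 0 ∧
      IsVoiculescuTransform μ fun z ↦ ((t : ℝ) : ℂ) * cbfTransform ρ (-z) := by
  have : IsFiniteMeasure ((t : ℝ≥0∞) • ρ) := ρ.smul_finite ENNReal.coe_ne_top
  obtain ⟨μ, hμ, h⟩ := exists_isVoiculescuTransform_cbfTransform (ρ := (t : ℝ≥0∞) • ρ)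
    (by simp [h0])
  simp_rw [cbfTransform_smul] at h
  exact ⟨μ, hμ, h⟩

lemma isFreeConv_of_const_mul {φ : ℂ → ℂ} {s t u : ℝ} (hu : u = s + t)
    {μ ν χ : ProbabilityMeasure ℝ} (hμ : IsVoiculescuTransform μ fun z ↦ (s : ℂ) * φ z)
    (hν : IsVoiculescuTransform ν fun z ↦ (t : ℂ) * φ z)
    (hχ : IsVoiculescuTransform χ fun z ↦ (u : ℂ) * φ z) : IsFreeConv μ ν χ := by
  refine ⟨_, _, hμ, hν, ?_⟩
  convert hχ using 2 with z
  rw [hu]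
  push_cast
  ring

/-- Each intermediate convolution must itself be a measure; it exists because every nonnegative
multiple of the transform is a Voiculescu transform. At one factor, uniqueness of the measure
identifies it. -/
lemma isFreeConvIter_of_const_mul (h0 : ρ {0} = 0) {t : ℝ≥0} {ν : ProbabilityMeasure ℝ}
    (hν : IsVoiculescuTransform ν fun z ↦ ((t : ℝ) : ℂ) * cbfTransform ρ (-z)) (k : ℕ) :
    ∀ {u : ℝ} {χ : ProbabilityMeasure ℝ}, u = (k + 1) * t →
      IsVoiculescuTransform χ (fun z ↦ (u : ℂ) * cbfTransform ρ (-z)) →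
      IsFreeConvIter ν (k + 1) χ := by
  induction k with
  | zero =>
    intro u χ hu hχ
    rw [Nat.cast_zero, zero_add, one_mul] at hu
    exact eq_of_isVoiculescuTransform hχ (hu ▸ hν)
  | succ k ih =>
    intro u χ hu hχ
    obtain ⟨χ', -, h⟩ := exists_isVoiculescuTransform_const_mul h0 ((k + 1) * t)
    refine ⟨χ', ih (by push_cast; rfl) h, isFreeConv_of_const_mul ?_ h hν hχ⟩
    rw [hu]
    push_cast
    ring

/-- The `n`-th free convolution root is the measure belonging to `ρ / n`, and the power of order `t`
is the one belonging to `t ρ`, which lives on the positive half-axis. -/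
lemma isFreeRegular_of_isVoiculescuTransform (h0 : ρ {0} = 0) {μ : ProbabilityMeasure ℝ}
    (h : IsVoiculescuTransform μ fun z ↦ cbfTransform ρ (-z)) : IsFreeRegular μ := by
  refine ⟨fun n hn ↦ ?_, fun t ht ↦ ?_⟩
  · obtain ⟨k, rfl⟩ := Nat.exists_eq_add_of_le' hn
    obtain ⟨ν, -, hν⟩ := exists_isVoiculescuTransform_const_mul h0 (1 / ((k : ℝ≥0) + 1))
    refine ⟨ν, isFreeConvIter_of_const_mul h0 hν k (u := 1) ?_ (by simpa using h)⟩
    push_cast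
    field_simp
  · obtain ⟨χ, hχ, hV⟩ := exists_isVoiculescuTransform_const_mul h0 ⟨t, ht.le⟩
    exact ⟨χ, ⟨_, h, hV⟩, hχ⟩

/-! ### The Voiculescu transform on the negative half-axis -/

lemma isVoiculescuOnNegAxis_of_cbfTransform {f : ℝ≥0 → ℝ≥0} (hf : f ∈ CBFflat)
    (hρ : ∀ z : ℝ≥0, 0 < z → cbfTransform ρ (z : ℝ) = ((f z : ℝ) : ℂ)) {μ : ProbabilityMeasure ℝ}
    (h : IsVoiculescuTransform μ fun z ↦ cbfTransform ρ (-z)) : IsVoiculescuOnNegAxis μ f :=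
  ⟨⟨_, h, analyticOnNhd_cbfTransform_neg ρ, fun z hz ↦ by rw [neg_neg, hρ z hz]⟩,
    tendsto_zero_of_mem_CBFflat hf⟩

namespace IsVoiculescuOnNegAxis

lemma isVoiculescuTransform {f : ℝ≥0 → ℝ≥0} {μ : ProbabilityMeasure ℝ}
    (h : IsVoiculescuOnNegAxis μ f)
    (hρ : ∀ z : ℝ≥0, 0 < z → cbfTransform ρ (z : ℝ) = ((f z : ℝ) : ℂ)) :
    IsVoiculescuTransform μ fun z ↦ cbfTransform ρ (-z) := by
  obtain ⟨⟨φ, hφ, han, hf⟩, -⟩ := h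
  refine hφ.congr one_pos (M := 0) ((eqOn_continuationDomain_of_neg han
    (analyticOnNhd_cbfTransform_neg ρ) fun z hz ↦ ?_).mono
    (truncatedCone_subset_continuationDomain le_rfl))
  rw [hf z hz, neg_neg, hρ z hz]

/-- Additivity is known only on some cone; intersecting the cones and continuing analytically moves
it to the negative axis. -/
lemma eq_add {f g k : ℝ≥0 → ℝ≥0} {μ ν χ : ProbabilityMeasure ℝ} (hμ : IsVoiculescuOnNegAxis μ f)
    (hν : IsVoiculescuOnNegAxis ν g) (hχ : IsVoiculescuOnNegAxis χ k) (h : IsFreeConv μ ν χ)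
    (z : ℝ≥0) (hz : 0 < z) : k z = f z + g z := by
  obtain ⟨⟨φ, hφ, han, hf⟩, -⟩ := hμ
  obtain ⟨⟨ψ, hψ, han', hg⟩, -⟩ := hν
  obtain ⟨⟨θ, hθ, han'', hk⟩, -⟩ := hχ
  obtain ⟨φ₁, φ₂, h₁, h₂, h₃⟩ := h
  obtain ⟨α, M, hα, hM, he⟩ := hφ.exists_eqOn h₁
  obtain ⟨α', M', hα', hM', he'⟩ := hψ.exists_eqOn h₂
  obtain ⟨α'', M'', hα'', hM'', he''⟩ := hθ.exists_eqOn h₃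
  have hN : 0 < max M (max M' M'') := lt_max_of_lt_left hM
  have key : EqOn θ (φ + ψ) continuationDomain := by
    refine eqOn_continuationDomain_of_cone han'' (han.add han')
      (lt_min hα (lt_min hα' hα'')) hN fun z hz ↦ ?_
    have h1 := he (truncatedCone_mono (min_le_left _ _) (le_max_left _ _) hN.le hz)
    have h2 := he' (truncatedCone_mono ((min_le_right _ _).trans (min_le_left _ _))
      ((le_max_left _ _).trans (le_max_right _ _)) hN.le hz)
    have h3 := he'' (truncatedCone_mono ((min_le_right _ _).trans (min_le_right _ _))
      ((le_max_right _ _).trans (le_max_right _ _)) hN.le hz)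
    rw [Pi.add_apply, h1, h2, h3]
  have := key (neg_ofReal_mem_continuationDomain (NNReal.coe_pos.2 hz))
  rw [Pi.add_apply, hf z hz, hg z hz, hk z hz] at this
  exact_mod_cast this

lemma unique {f g : ℝ≥0 → ℝ≥0} {μ : ProbabilityMeasure ℝ} (hf : IsVoiculescuOnNegAxis μ f)
    (hg : IsVoiculescuOnNegAxis μ g) : f = g := by
  refine eq_of_eq_pos hf.2 hg.2 fun z hz ↦ ?_
  obtain ⟨⟨φ, hφ, han, hf⟩, -⟩ := hf
  obtain ⟨⟨ψ, hψ, han', hg⟩, -⟩ := hg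
  obtain ⟨α, M, hα, hM, he⟩ := hφ.exists_eqOn hψ
  have := eqOn_continuationDomain_of_cone han han' hα hM he
    (neg_ofReal_mem_continuationDomain (NNReal.coe_pos.2 hz))
  rw [hf z hz, hg z hz] at this
  exact_mod_cast this

end IsVoiculescuOnNegAxis

theorem isFreeRegular_iff (μ : ProbabilityMeasure ℝ) :
    IsFreeRegular μ ↔ ∃ f ∈ CBFflat, IsVoiculescuOnNegAxis μ f := by
  constructor
  · rintro ⟨-, h⟩
    obtain ⟨ρ, hρ, h0, hV⟩ := exists_cbfTransform_isVoiculescuTransform h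
    obtain ⟨f, hf, hρf⟩ := exists_mem_CBFflat h0
    exact ⟨f, hf, isVoiculescuOnNegAxis_of_cbfTransform hf hρf hV⟩
  · rintro ⟨f, hf, h⟩
    obtain ⟨ρ, hρ, h0, hρf⟩ := exists_cbfTransform_eq hf
    exact isFreeRegular_of_isVoiculescuTransform h0 (h.isVoiculescuTransform hρf)

theorem existsUnique_isFreeRegular {f : ℝ≥0 → ℝ≥0} (hf : f ∈ CBFflat) :
    ∃! μ : ProbabilityMeasure ℝ, IsFreeRegular μ ∧ IsVoiculescuOnNegAxis μ f := by
  obtain ⟨ρ, hρ, h0, hρf⟩ := exists_cbfTransform_eq hf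
  obtain ⟨μ, -, hμ⟩ := exists_isVoiculescuTransform_cbfTransform h0
  refine ⟨μ, ⟨isFreeRegular_of_isVoiculescuTransform h0 hμ,
    isVoiculescuOnNegAxis_of_cbfTransform hf hρf hμ⟩, ?_⟩
  rintro ν ⟨-, hν⟩
  exact eq_of_isVoiculescuTransform (hν.isVoiculescuTransform hρf) hμ

/-! ### Free regular semigroups -/

theorem existsUnique_isFreeRegularSemigroup {f : ℝ≥0 → ℝ≥0} (hf : f ∈ CBFflat) :
    ∃! μ : ℝ≥0 → ProbabilityMeasure ℝ, IsFreeRegularSemigroup μ ∧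
      ∀ t, IsVoiculescuOnNegAxis (μ t) fun z ↦ t * f z := by
  choose μ hμ huniq using fun t ↦ existsUnique_isFreeRegular (const_mul_mem_CBFflat hf t)
  obtain ⟨ρ, hρ, h0, hρf⟩ := exists_cbfTransform_eq hf
  have hV (t : ℝ≥0) :
      IsVoiculescuTransform (μ t) fun z ↦ ((t : ℝ) : ℂ) * cbfTransform ρ (-z) := by
    have : IsFiniteMeasure ((t : ℝ≥0∞) • ρ) := ρ.smul_finite ENNReal.coe_ne_top
    simp_rw [← cbfTransform_smul]
    refine (hμ t).2.isVoiculescuTransform fun z hz ↦ ?_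
    rw [cbfTransform_smul, hρf z hz]
    push_cast
    rfl
  refine ⟨μ, ⟨⟨fun t ↦ (hμ t).1, fun s t ↦ isFreeConv_of_const_mul (NNReal.coe_add s t) (hV s)
    (hV t) (hV (s + t))⟩, fun t ↦ (hμ t).2⟩, ?_⟩
  rintro ν ⟨hν, hνf⟩
  exact funext fun t ↦ huniq t (ν t) ⟨hν.1 t, hνf t⟩

/-- For fixed `z > 0` the values `φ_{μ_t}(-z)` are additive and nonnegative in `t`, hence linear, so
the function at time `1` determines all others. -/
theorem IsFreeRegularSemigroup.existsUnique {μ : ℝ≥0 → ProbabilityMeasure ℝ}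
    (hμ : IsFreeRegularSemigroup μ) :
    ∃! f : ℝ≥0 → ℝ≥0, f ∈ CBFflat ∧ ∀ t, IsVoiculescuOnNegAxis (μ t) fun z ↦ t * f z := by
  choose f hf hV using fun t ↦ (isFreeRegular_iff (μ t)).1 (hμ.1 t)
  have key (t : ℝ≥0) : f t = fun z ↦ t * f 1 z := by
    refine eq_of_eq_pos (tendsto_zero_of_mem_CBFflat (hf t))
      (tendsto_zero_of_mem_CBFflat (const_mul_mem_CBFflat (hf 1) t)) fun z hz ↦ ?_
    exact eq_mul_one_of_add (h := fun t ↦ f t z) (fun s t ↦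
      (hV s).eq_add (hV t) (hV (s + t)) (hμ.2 s t) z hz) t
  refine ⟨f 1, ⟨hf 1, fun t ↦ key t ▸ hV t⟩, ?_⟩
  rintro g ⟨-, hg⟩
  have := (hg 1).unique (hV 1)
  simpa using this

end FreeRegular
theorem proposition1 :
    -- a probability measure is free regular iff `z ↦ φ_μ(-z)` is in the class `CBFflat`
    (∀ μ : ProbabilityMeasure ℝ,
      IsFreeRegular μ ↔ ∃ f ∈ CBFflat, IsVoiculescuOnNegAxis μ f) ∧
    -- every function of the class arises, from exactly one free regular measure
    (∀ f ∈ CBFflat, ∃! μ : ProbabilityMeasure ℝ,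
      IsFreeRegular μ ∧ IsVoiculescuOnNegAxis μ f) ∧
    -- free regular semigroups are in bijection with `CBFflat`
    ((∀ f ∈ CBFflat, ∃! μ : ℝ≥0 → ProbabilityMeasure ℝ, IsFreeRegularSemigroup μ ∧
        ∀ t, IsVoiculescuOnNegAxis (μ t) fun z => t * f z) ∧
      ∀ μ : ℝ≥0 → ProbabilityMeasure ℝ, IsFreeRegularSemigroup μ →
        ∃! f : ℝ≥0 → ℝ≥0, f ∈ CBFflat ∧
          ∀ t, IsVoiculescuOnNegAxis (μ t) fun z => t * f z) ∧
    -- driftless Bondesson class semigroups are in bijection with `CBFflat`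
    ((∀ f ∈ CBFflat, ∃! ν : ℝ≥0 → Measure ℝ≥0, IsBondessonFlatSemigroup ν ∧
        ∀ t, HasLaplaceExponent (ν t) fun z => t * f z) ∧
      ∀ ν : ℝ≥0 → Measure ℝ≥0, IsBondessonFlatSemigroup ν →
        ∃! f : ℝ≥0 → ℝ≥0, f ∈ CBFflat ∧
          ∀ t, HasLaplaceExponent (ν t) fun z => t * f z) := by
  exact ⟨isFreeRegular_iff, fun _ hf ↦ existsUnique_isFreeRegular hf,
    ⟨fun _ hf ↦ existsUnique_isFreeRegularSemigroup hf, fun _ hμ ↦ hμ.existsUnique⟩,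
    fun _ hf ↦ existsUnique_isBondessonFlatSemigroup hf, fun _ hν ↦ hν.existsUnique⟩
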